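/- Let $d\ge 1$ and let $X$ be a simple (locally finite) point process on $\mathbb{R}^d$. For $1\le n\le 4$ suppose that $X$ has an $n$th-order intensity function $\lambda_n:\mathbb{R}^{nd}\to[0,\infty)$, i.e. $$\mathbb{E}\Big[\sum_{x_1,\dots,x_n\in X\ \text{pairwise distinct}} q(x_1,\dots,x_n)\Big]=\int q\,\lambda_n\,dx_1\cdots dx_n$$ for every nonnegative measurable $q$, and let $$\gamma_n(x_1,\dots,x_n)=\sum_{\pi}(\#\pi-1)!\,(-1)^{\#\pi-1}\prod_{B\in\pi}\lambda_{\#B}(x_B)$$ (sum over all partitions $\pi$ of $\{1,\dots,n\}$) be the $n$th-order cumulant intensity. Assume: 1. (second-order stationarity) $\lambda_1\equiv\lambda$ is constant and $\lambda_2(x_1,x_2)$ depends only on $x_1-x_2$; write $\gamma_2(x_1,x_2)=\gamma_{2,\mathrm{red}}(x_1-x_2)$. 2. (fourth-order cumulant integrability) $\sup_{x_n\in\mathbb{R}^d}\int_{\mathbb{R}^{d(n-1)}}|\gamma_n(x_1,\dots,x_n)|\,dx_1\cdots dx_{n-1}<\infty$ for $n=2,3,4$. 3. (windows) $D_n=\prod_{i=1}^d[-A_i(n)/2,A_i(n)/2]$,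 where each $A_i(n)>0$ is increasing in $n$, $|D_n|\to\infty$, and $A_i(n)/A_j(n)=O(1)$ for all $i,j$. 4. (taper) $h:\mathbb{R}^d\to[0,\infty)$ vanishes outside $[-1/2,1/2]^d$, is continuous on $[-1/2,1/2]^d$, and $H_{h,k}=\int_{[-1/2,1/2]^d}h^k>0$ for all $k\ge1$. 5. (kernel) $W:\mathbb{R}^d\to[0,\infty)$ vanishes outside $[-1/2,1/2]^d$, is continuous on $[-1/2,1/2]^d$, and satisfies $W(-x)=W(x)$, $\int W=1$ and $\int W^2<\infty$. 6. (bandwidth) $b(n)>0$ and $b(n)+|D_n|^{-1}b(n)^{-d}\to0$. Writing $x/A=(x_1/A_1(n),\dots,x_d/A_d(n))$, set $$\mathcal{J}_{h,n}(\omega)=(2\pi)^{-d/2}H_{h,2}^{-1/2}|D_n|^{-1/2}\sum_{x\in X\cap D_n}h(x/A)e^{-ix^\top\omega},$$ $$c_{h,n}(\omega)=(2\pi)^{-d/2}H_{h,2}^{-1/2}|D_n|^{-1/2}\int_{D_n}h(x/A)e^{-ix^\top\omega}\,dx,$$ $$\widehat\lambda_{h,n}=H_{h,1}^{-1}|D_n|^{-1}\sum_{x\in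 X\cap D_n}h(x/A),\qquad \widehat I_{h,n}(\omega)=\big|\mathcal{J}_{h,n}(\omega)-\widehat\lambda_{h,n}c_{h,n}(\omega)\big|^2,$$ $$\widehat f_{n,b}(\omega)=\int_{\mathbb{R}^d}b^{-d}\,W\big(b^{-1}(\omega-x)\big)\,\widehat I_{h,n}(x)\,dx,\qquad b=b(n),$$ and let $$f(\omega)=(2\pi)^{-d}\lambda+(2\pi)^{-d}\int_{\mathbb{R}^d}\gamma_{2,\mathrm{red}}(x)e^{-ix^\top\omega}\,dx$$ be the spectral density of $X$. Then for every $\omega\in\mathbb{R}^d$, $\widehat f_{n,b}(\omega)\to f(\omega)$ in probability as $n\to\infty$. -/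

import Mathlib

open MeasureTheory Filter Topology

namespace PointSpectral

noncomputable section

/-! ### Simple point processes and their intensity functions -/

/-- A simple point process on `ℝ^d`: a random locally finite subset `X w` of `ℝ^d` whose counts
`#(X ∩ B)` over bounded Borel sets `B` are random variables. -/
structure IsSimplePointProcess {Ω : Type*} [MeasurableSpace Ω] {d : ℕ}
    (X : Ω → Set (Fin d → ℝ)) : Prop where
  finite_inter : ∀ (w : Ω) (B : Set (Fin d → ℝ)), Bornology.IsBounded B → (X w ∩ B).Finite
  measurable_count : ∀ B : Set (Fin d → ℝ), MeasurableSet B → Bornology.IsBounded B →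
    Measurable fun w => (X w ∩ B).ncard

/-- `S^{n,≠}`: the `n`-tuples of pairwise distinct points of `S`. -/
def distinctTuples {d : ℕ} (n : ℕ) (S : Set (Fin d → ℝ)) : Set (Fin n → Fin d → ℝ) :=
  {x | Function.Injective x ∧ ∀ i, x i ∈ S}

/-- `lam` is (a version of) the `n`-th order intensity function of `X`: a nonnegative measurable
function with `E[∑ q(x₁,…,xₙ)] = ∫ q lam` for every nonnegative measurable `q`, the sum being over
all `n`-tuples of pairwise distinct points of `X`. -/
structure IsIntensityFunction {Ω : Type*} [MeasurableSpace Ω] (P : Measure Ω) {d : ℕ}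
    (X : Ω → Set (Fin d → ℝ)) (n : ℕ) (lam : (Fin n → Fin d → ℝ) → ℝ) : Prop where
  measurable : Measurable lam
  nonneg : ∀ x, 0 ≤ lam x
  campbell : ∀ q : (Fin n → Fin d → ℝ) → ENNReal, Measurable q →
    ∫⁻ w, ∑' x : distinctTuples n (X w), q x ∂P = ∫⁻ x, q x * ENNReal.ofReal (lam x)

/-- The `n`-th order cumulant intensity function `γₙ` built from the intensity functions
`lam 1, lam 2, …`: the sum over all partitions `π` of `{1,…,n}` of
`(#π - 1)! (-1)^(#π - 1) ∏_{B ∈ π} lam_{#B}(x_B)`. -/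
def cumulantIntensity {d : ℕ} (lam : (n : ℕ) → (Fin n → Fin d → ℝ) → ℝ) (n : ℕ)
    (x : Fin n → Fin d → ℝ) : ℝ :=
  ∑ p : Finpartition (Finset.univ : Finset (Fin n)),
    ((p.parts.card - 1).factorial : ℝ) * (-1) ^ (p.parts.card - 1) *
      ∏ B ∈ p.parts, lam B.card fun j => x (B.orderEmbOfFin rfl j)

/-- The reduced version `g_red(u₁,…,uₘ) = g(u₁,…,uₘ,0)` of a function `g` of `m + 1` points. -/
def reduced {d m : ℕ} (g : (Fin (m + 1) → Fin d → ℝ) → ℝ) (u : Fin m → Fin d → ℝ) : ℝ :=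
  g (Fin.snoc u 0)

/-- `k`-th order stationarity: for `1 ≤ n ≤ k` (here `n = m + 1`),
`lamₙ(x₁,…,xₙ) = lam_{n,red}(x₁ - xₙ,…,xₙ₋₁ - xₙ)`. -/
def IsStationaryOfOrder {d : ℕ} (k : ℕ) (lam : (n : ℕ) → (Fin n → Fin d → ℝ) → ℝ) : Prop :=
  ∀ m : ℕ, m + 1 ≤ k → ∀ x : Fin (m + 1) → Fin d → ℝ,
    lam (m + 1) x = reduced (lam (m + 1)) fun i => x i.castSucc - x (Fin.last m)

/-- Integrability of the cumulant intensities up to order `ℓ`: for `2 ≤ n ≤ ℓ` (here `n = m + 1`),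
`sup_{xₙ} ∫ |γₙ(x₁,…,xₙ)| dx₁ ⋯ dxₙ₋₁ < ∞`. -/
def CumulantsIntegrable {d : ℕ} (ℓ : ℕ) (lam : (n : ℕ) → (Fin n → Fin d → ℝ) → ℝ) : Prop :=
  ∀ m : ℕ, 1 ≤ m → m + 1 ≤ ℓ →
    (⨆ y : Fin d → ℝ, ∫⁻ u : Fin m → Fin d → ℝ,
      ‖cumulantIntensity lam (m + 1) (Fin.snoc u y)‖ₑ) < ⊤

/-! ### Spectral density -/

/-- The character `exp(-i xᵀω)`. -/
def expNeg {d : ℕ} (x ω : Fin d → ℝ) : ℂ :=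
  Complex.exp (-Complex.I * ((x ⬝ᵥ ω : ℝ) : ℂ))

/-- The inverse Fourier transform `(2π)^{-d} ∫ g(x) exp(-i xᵀω) dx`. -/
def invFourier {d : ℕ} (g : (Fin d → ℝ) → ℝ) (ω : Fin d → ℝ) : ℂ :=
  (((2 * Real.pi) ^ d)⁻¹ : ℝ) * ∫ x, (g x : ℂ) * expNeg x ω

/-- The constant first-order intensity `λ` of a stationary process. -/
def firstIntensity {d : ℕ} (lam : (n : ℕ) → (Fin n → Fin d → ℝ) → ℝ) : ℝ :=
  lam 1 fun _ => 0

/-- The reduced second-order cumulant intensity `γ_{2,red}`. -/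
def cumulant2Red {d : ℕ} (lam : (n : ℕ) → (Fin n → Fin d → ℝ) → ℝ) (u : Fin d → ℝ) : ℝ :=
  reduced (cumulantIntensity lam 2) fun _ => u

/-- The spectral density `f(ω) = (2π)^{-d} λ + 𝓕⁻¹(γ_{2,red})(ω)`, kept complex-valued so that no
real part has to be taken. -/
def spectralDensity {d : ℕ} (lam : (n : ℕ) → (Fin n → Fin d → ℝ) → ℝ) (ω : Fin d → ℝ) : ℂ :=
  (((2 * Real.pi) ^ d)⁻¹ * firstIntensity lam : ℝ) + invFourier (cumulant2Red lam) ω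

/-! ### Windows, tapers and kernels -/

/-- The cube `[-1/2, 1/2]^d`. -/
def unitCube (d : ℕ) : Set (Fin d → ℝ) := Set.Icc (fun _ => -1 / 2) (fun _ => 1 / 2)

/-- The window `[-A₁/2, A₁/2] × ⋯ × [-A_d/2, A_d/2]`. -/
def window {d : ℕ} (A : Fin d → ℝ) : Set (Fin d → ℝ) :=
  Set.Icc (fun i => -A i / 2) (fun i => A i / 2)

/-- The volume of the window. -/
def windowVol {d : ℕ} (A : Fin d → ℝ) : ℝ := volume.real (window A)

/-- The increasing-domain framework: increasing windows whose volume tends to infinity and which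
grow with the same speed in all coordinates. -/
structure IsGrowingWindow {d : ℕ} (A : ℕ → Fin d → ℝ) : Prop where
  pos : ∀ n i, 0 < A n i
  mono : ∀ i, Monotone fun n => A n i
  vol_tendsto : Tendsto (fun n => windowVol (A n)) atTop atTop
  comparable : ∀ i j, (fun n => A n i / A n j) =O[atTop] fun _ => (1 : ℝ)

/-- `H_{h,k} = ∫_{[-1/2,1/2]^d} h^k`. -/
def taperMoment {d : ℕ} (h : (Fin d → ℝ) → ℝ) (k : ℕ) : ℝ := ∫ x in unitCube d, h x ^ k

/-- A data taper: nonnegative, supported in `[-1/2,1/2]^d` and continuous on this cube, with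
`H_{h,k} > 0` for all `k ≥ 1`. -/
structure IsTaper {d : ℕ} (h : (Fin d → ℝ) → ℝ) : Prop where
  nonneg : ∀ x, 0 ≤ h x
  support : ∀ x, x ∉ unitCube d → h x = 0
  continuousOn : ContinuousOn h (unitCube d)
  moment_pos : ∀ k : ℕ, 1 ≤ k → 0 < taperMoment h k

/-- A smoothing kernel: nonnegative, symmetric, supported in `[-1/2,1/2]^d` and continuous on this
cube, with integral one and square integrable. -/
structure IsSmoothingKernel {d : ℕ} (W : (Fin d → ℝ) → ℝ) : Prop where
  nonneg : ∀ x, 0 ≤ W x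
  symm : ∀ x, W (-x) = W x
  support : ∀ x, x ∉ unitCube d → W x = 0
  continuousOn : ContinuousOn W (unitCube d)
  integral_eq_one : ∫ x, W x = 1
  sq_integrable : Integrable fun x => W x ^ 2

/-- `W_b(x) = b^{-d} W(b⁻¹ x)`. -/
def scaledKernel {d : ℕ} (W : (Fin d → ℝ) → ℝ) (b : ℝ) (x : Fin d → ℝ) : ℝ :=
  (b ^ d)⁻¹ * W (b⁻¹ • x)

/-! ### Discrete Fourier transform, periodogram and kernel estimator

In this part `A` is the vector of side lengths of the window, `S` a realization of the point
process, and `x / A` is the coordinatewise quotient. -/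

/-- `H_{h,k}^{(n)}(ω) = ∫_{D_n} h(x/A)^k exp(-i xᵀω) dx`. -/
def windowMoment {d : ℕ} (h : (Fin d → ℝ) → ℝ) (A : Fin d → ℝ) (k : ℕ) (ω : Fin d → ℝ) : ℂ :=
  ∫ x in window A, ((h (x / A) ^ k : ℝ) : ℂ) * expNeg x ω

/-- The normalization `(2π)^{-d/2} H_{h,2}^{-1/2} |D_n|^{-1/2}`. -/
def dftNorm {d : ℕ} (h : (Fin d → ℝ) → ℝ) (A : Fin d → ℝ) : ℝ :=
  (2 * Real.pi) ^ (-(d : ℝ) / 2) * taperMoment h 2 ^ (-(1 : ℝ) / 2) *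
    windowVol A ^ (-(1 : ℝ) / 2)

/-- The tapered discrete Fourier transform `𝓙_{h,n}(ω)`. -/
def dft {d : ℕ} (h : (Fin d → ℝ) → ℝ) (A : Fin d → ℝ) (S : Set (Fin d → ℝ))
    (ω : Fin d → ℝ) : ℂ :=
  (dftNorm h A : ℂ) * ∑ᶠ x ∈ S ∩ window A, (h (x / A) : ℂ) * expNeg x ω

/-- The bias factor `c_{h,n}(ω)`. -/
def biasFactor {d : ℕ} (h : (Fin d → ℝ) → ℝ) (A : Fin d → ℝ) (ω : Fin d → ℝ) : ℂ :=
  (dftNorm h A : ℂ) * windowMoment h A 1 ω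

/-- The estimator `H_{h,1}⁻¹ |D_n|⁻¹ ∑_{x ∈ X ∩ D_n} h(x/A)` of the first-order intensity. -/
def intensityEstimator {d : ℕ} (h : (Fin d → ℝ) → ℝ) (A : Fin d → ℝ)
    (S : Set (Fin d → ℝ)) : ℝ :=
  (taperMoment h 1)⁻¹ * (windowVol A)⁻¹ * ∑ᶠ x ∈ S ∩ window A, h (x / A)

/-- The feasible centered transform `𝓙_{h,n}(ω) - λ̂_{h,n} c_{h,n}(ω)`. -/
def centeredDft {d : ℕ} (h : (Fin d → ℝ) → ℝ) (A : Fin d → ℝ) (S : Set (Fin d → ℝ))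
    (ω : Fin d → ℝ) : ℂ :=
  dft h A S ω - (intensityEstimator h A S : ℂ) * biasFactor h A ω

/-- The feasible periodogram, the squared modulus of the feasible centered transform. -/
def periodogram {d : ℕ} (h : (Fin d → ℝ) → ℝ) (A : Fin d → ℝ) (S : Set (Fin d → ℝ))
    (ω : Fin d → ℝ) : ℝ :=
  ‖centeredDft h A S ω‖ ^ 2

/-- The kernel spectral density estimator `∫ W_b(ω - x) Î_{h,n}(x) dx`. -/
def kernelEstimator {d : ℕ} (W h : (Fin d → ℝ) → ℝ) (A : Fin d → ℝ) (b : ℝ)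
    (S : Set (Fin d → ℝ)) (ω : Fin d → ℝ) : ℝ :=
  ∫ x, scaledKernel W b (ω - x) * periodogram h A S x

end

end PointSpectral

/-!
Write `g_θ(x) = κ h(x/A) (exp(-i xᵀθ) - c(θ))` with `κ = dftNorm h A` and
`c(θ) = ∫ h(x/A) exp(-i xᵀθ) dx / ∫ h(x/A) dx`. Subtracting the estimated intensity times the bias
factor amounts to using `g_θ` in place of the tapered character: the centered transform is the sum
of `g_θ` over the points in the window (`centeredDft_eq_sum`), and `∫ g_θ = 0`
(`setIntegral_centeredTaper`). All moments needed are therefore moments of linear statistics with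
mean-zero test functions.

*Moments.* A product of sums over the points is a combination of sums over tuples of distinct
points, whose expectations are integrals against the intensity functions `λ_k`. Expanding `λ_k` in
cumulant intensities, every term with a singleton block carrying one of the mean-zero functions
vanishes. Hence `E[∑ f ∑ g] = C(f, g)` with the bilinear form `C = covForm`, and a fourth mixed
moment is the sum of products of values of `C` over the three pairings, up to `15 M⁴ G |D|`, where `M` bounds the
test functions and `G` the cumulant integrals
(`norm_integral_sum_mul_sum_mul_sum_mul_sum_sub_le`). As `κ²` is of the order `|D|⁻¹`, this makes
`Cov(Î(θ), Î(η)) ≤ |C(g_θ, g_η)|² + |C(ḡ_θ, g_η)|² + O(|D|⁻¹)`.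

*Variance.* By stationarity, `C(f, g_η)` is, for `f` bounded by `O(κ)`, the Fourier transform at `η`
of a function of size `O(κ²)` on the window, up to a bounded multiple of `c(η)`. Average its square
over `η` with weight `b^{-d} W((ω - η)/b)`. This weight is at most a constant times `b^{-d}` times a
Gaussian of width `b`; against a Gaussian, the squared Fourier transform of `v` on `D` integrates to at most
`(2π)^d ‖v‖_∞² |D|` by Fubini, the Fourier transform of a Gaussian being a Gaussian with the inverse
width (`integral_gaussFun_mul_norm_sq_le`). So the average is `O(|D|⁻¹ b^{-d})`, and the same bound
holds for `|c|²`. The variance of the estimator is the double average of the covariances, hence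
`O(|D|⁻¹ b^{-d} + |D|⁻¹)` (`exists_integral_sq_kernelEstimator_sub_le`).

*Mean.* `E Î(θ) = C(g_θ, ḡ_θ)` differs by `O(|c(θ)|)` from the same expression without centering,
which is `(2π)^{-d} (λ + ∫ γ_{2,red}(u) exp(-i uᵀθ) R(u) du)` with the autocorrelation `R` of the
rescaled taper (`covForm_taperedChar`). All sides of the window tend to infinity, so `R → 1`
pointwise, and dominated convergence gives the spectral density at `ω` for the kernel average
(`tendsto_integral_integral_periodogram`). Chebyshev's inequality concludes.
-/

namespace PointSpectral

/-! ### Cumulant intensities of orders two, three and four -/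

/-- The blocks (fibres) of a labelling `r` of `Fin n`. -/
def fibreBlocks {n : ℕ} (r : Fin n → Fin n) : Finset (Finset (Fin n)) :=
  Finset.univ.image fun i => Finset.univ.filter fun j => r i = r j

/-- The partitions of `Fin n`, as families of blocks, are the fibre families of the labellings with
`r i ≤ i`: label each element by the least element of its block. -/
theorem image_parts_eq (n : ℕ) :
    (Finset.univ : Finset (Finpartition (Finset.univ : Finset (Fin n)))).image
      Finpartition.parts =
    (Finset.univ.filter fun r : Fin n → Fin n => ∀ i, r i ≤ i).image fibreBlocks := by
  ext S
  simp only [Finset.mem_image, Finset.mem_univ, true_and, Finset.mem_filter]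
  constructor
  · rintro ⟨p, rfl⟩
    have hne : ∀ i, (p.part i).Nonempty := fun i => ⟨i, p.mem_part (Finset.mem_univ i)⟩
    refine ⟨fun i => (p.part i).min' (hne i), fun i => Finset.min'_le _ _
      (p.mem_part (Finset.mem_univ i)), ?_⟩
    have key : ∀ i j, (p.part i).min' (hne i) = (p.part j).min' (hne j) ↔ j ∈ p.part i := by
      intro i j
      constructor
      · intro h
        have h1 := (p.part i).min'_mem (hne i)
        have h2 := (p.part j).min'_mem (hne j)
        rw [← h] at h2
        have := p.eq_of_mem_parts (p.part_mem.2 (Finset.mem_univ i))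
          (p.part_mem.2 (Finset.mem_univ j)) h1 h2
        rw [this]; exact p.mem_part (Finset.mem_univ j)
      · intro h
        have := p.part_eq_of_mem (p.part_mem.2 (Finset.mem_univ i)) h
        simp only [this]
    ext B
    simp only [fibreBlocks, Finset.mem_image, Finset.mem_univ, true_and, key]
    have hB : ∀ i, Finset.univ.filter (fun j => j ∈ p.part i) = p.part i := by
      intro i; ext; simp
    simp only [hB]
    constructor
    · rintro ⟨i, rfl⟩; exact p.part_mem.2 (Finset.mem_univ i)
    · intro h
      obtain ⟨i, hi⟩ := p.nonempty_of_mem_parts h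
      exact ⟨i, p.part_eq_of_mem h hi⟩
  · rintro ⟨r, -, rfl⟩
    have : DecidableRel (Setoid.ker r).r := fun i j => inferInstanceAs (Decidable (r i = r j))
    refine ⟨Finpartition.ofSetoid (Setoid.ker r), ?_⟩
    simp only [Finpartition.ofSetoid, Finpartition.ofSetSetoid, fibreBlocks]
    refine Finset.image_congr fun i _ => ?_
    ext j
    simp only [Finset.mem_filter, Finset.mem_univ, true_and]
    exact Setoid.ker_def

theorem sum_finpartition {n : ℕ} (F : Finset (Finset (Fin n)) → ℝ) :
    ∑ p : Finpartition (Finset.univ : Finset (Fin n)), F p.parts =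
      ∑ S ∈ (Finset.univ.filter fun r : Fin n → Fin n => ∀ i, r i ≤ i).image fibreBlocks, F S := by
  rw [← image_parts_eq, Finset.sum_image]
  intro p _ q _ h
  exact Finpartition.ext h

/-- The two partitions of a two-element set. -/
theorem image_fibreBlocks_two :
    (Finset.univ.filter fun r : Fin 2 → Fin 2 => ∀ i, r i ≤ i).image fibreBlocks =
   {{{0,1}}, {{0},{1}}} := by decide +kernel

/-- The five partitions of a three-element set. -/
theorem image_fibreBlocks_three :
    (Finset.univ.filter fun r : Fin 3 → Fin 3 => ∀ i, r i ≤ i).image fibreBlocks =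
   {{{0,1,2}}, {{0},{1,2}}, {{1},{0,2}}, {{2},{0,1}}, {{0},{1},{2}}} := by decide +kernel

/-- The fifteen partitions of a four-element set. -/
theorem image_fibreBlocks_four :
    (Finset.univ.filter fun r : Fin 4 → Fin 4 => ∀ i, r i ≤ i).image fibreBlocks =
   {{{0,1,2,3}},
    {{0},{1,2,3}}, {{1},{0,2,3}}, {{2},{0,1,3}}, {{3},{0,1,2}},
    {{0,1},{2,3}}, {{0,2},{1,3}}, {{0,3},{1,2}},
    {{0},{1},{2,3}}, {{0},{2},{1,3}}, {{0},{3},{1,2}},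
    {{1},{2},{0,3}}, {{1},{3},{0,2}}, {{2},{3},{0,1}},
    {{0},{1},{2},{3}}} := by decide +kernel

/-- A strictly increasing enumeration of `B` may replace `orderEmbOfFin`. -/
theorem lam_comp_orderEmbOfFin {d n k : ℕ} (lam : (n : ℕ) → (Fin n → Fin d → ℝ) → ℝ)
    (x : Fin n → Fin d → ℝ)
    (B : Finset (Fin n)) (f : Fin k → Fin n) (hf : StrictMono f) (hB : Finset.univ.image f = B) :
    lam B.card (fun j => x (B.orderEmbOfFin rfl j)) = lam k fun j => x (f j) := by
  have hk : B.card = k := by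
    rw [← hB, Finset.card_image_of_injective _ hf.injective]; simp
  subst hk
  congr 1
  ext1 j
  congr 1
  have := Finset.orderEmbOfFin_unique (s := B) rfl (f := f) (fun i => by
    rw [← hB]; simp) hf
  rw [this]

section formulas
variable {d n : ℕ} (lam : (n : ℕ) → (Fin n → Fin d → ℝ) → ℝ)

/-- The factor `lam_{#B}(x_B)` of a block `B`. -/
def blockIntensity (x : Fin n → Fin d → ℝ) (B : Finset (Fin n)) : ℝ :=
  lam B.card fun j => x (B.orderEmbOfFin rfl j)

/-- The summand of a partition with blocks `S` in the cumulant intensity. -/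
def cumulantTerm (x : Fin n → Fin d → ℝ) (S : Finset (Finset (Fin n))) : ℝ :=
  ((S.card - 1).factorial : ℝ) * (-1) ^ (S.card - 1) * ∏ B ∈ S, blockIntensity lam x B

theorem cumulantIntensity_eq_sum_cumulantTerm (x : Fin n → Fin d → ℝ) :
    cumulantIntensity lam n x =
      ∑ S ∈ (Finset.univ.filter fun r : Fin n → Fin n => ∀ i, r i ≤ i).image fibreBlocks,
        cumulantTerm lam x S :=
  sum_finpartition (cumulantTerm lam x)

variable {lam} {x : Fin n → Fin d → ℝ}

theorem cumulantTerm_one (B : Finset (Fin n)) :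
    cumulantTerm lam x {B} = blockIntensity lam x B := by
  simp [cumulantTerm]

theorem cumulantTerm_two {B C : Finset (Fin n)} (h : B ∉ ({C} : Finset (Finset (Fin n)))) :
    cumulantTerm lam x {B, C} = -(blockIntensity lam x B * blockIntensity lam x C) := by
  rw [cumulantTerm, Finset.card_insert_of_notMem h, Finset.prod_insert h]
  simp

theorem cumulantTerm_three {B C D : Finset (Fin n)} (h : C ∉ ({D} : Finset (Finset (Fin n))))
    (h' : B ∉ ({C, D} : Finset (Finset (Fin n)))) :
    cumulantTerm lam x {B, C, D} =
      2 * (blockIntensity lam x B * blockIntensity lam x C * blockIntensity lam x D) := by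
  rw [cumulantTerm, Finset.card_insert_of_notMem h', Finset.prod_insert h',
    Finset.card_insert_of_notMem h, Finset.prod_insert h]
  simp
  ring

theorem cumulantTerm_four {B C D E : Finset (Fin n)} (h : D ∉ ({E} : Finset (Finset (Fin n))))
    (h' : C ∉ ({D, E} : Finset (Finset (Fin n))))
    (h'' : B ∉ ({C, D, E} : Finset (Finset (Fin n)))) :
    cumulantTerm lam x {B, C, D, E} = -6 * (blockIntensity lam x B * blockIntensity lam x C *
      blockIntensity lam x D * blockIntensity lam x E) := by
  rw [cumulantTerm, Finset.card_insert_of_notMem h'', Finset.prod_insert h'',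
    Finset.card_insert_of_notMem h', Finset.prod_insert h',
    Finset.card_insert_of_notMem h, Finset.prod_insert h]
  simp [Nat.factorial]
  ring

theorem blockIntensity_singleton (i : Fin n) :
    blockIntensity lam x {i} = lam 1 ![x i] := by
  rw [blockIntensity, lam_comp_orderEmbOfFin lam x {i} ![i] (Subsingleton.strictMono _)
    (by ext; simp)]
  congr 1; ext1 j; fin_cases j; rfl

theorem blockIntensity_pair {i k : Fin n} (h : i < k) :
    blockIntensity lam x {i, k} = lam 2 ![x i, x k] := by
  rw [blockIntensity, lam_comp_orderEmbOfFin lam x {i, k} ![i, k]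
    (by rw [Fin.strictMono_iff_lt_succ]; intro j; fin_cases j; simpa using h)
    (by ext a; simp [Fin.exists_fin_two, eq_comm])]
  congr 1; ext1 j; fin_cases j <;> rfl

theorem blockIntensity_triple {i k l : Fin n} (h : i < k) (h' : k < l) :
    blockIntensity lam x {i, k, l} = lam 3 ![x i, x k, x l] := by
  rw [blockIntensity, lam_comp_orderEmbOfFin lam x {i, k, l} ![i, k, l]
    (by rw [Fin.strictMono_iff_lt_succ]; intro j; fin_cases j <;> simpa)
    (by ext a; simp [Fin.exists_fin_succ, eq_comm])]
  congr 1; ext1 j; fin_cases j <;> rfl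

theorem blockIntensity_univ {B : Finset (Fin n)} (h : Finset.univ = B) :
    blockIntensity lam x B = lam n x := by
  rw [blockIntensity, lam_comp_orderEmbOfFin lam x B id strictMono_id (by simpa using h)]; rfl

variable (lam)

theorem cumulantIntensity_two (x : Fin 2 → Fin d → ℝ) :
    cumulantIntensity lam 2 x = lam 2 x - lam 1 ![x 0] * lam 1 ![x 1] := by
  rw [cumulantIntensity_eq_sum_cumulantTerm, image_fibreBlocks_two, Finset.sum_insert (by decide),
    Finset.sum_singleton, cumulantTerm_one, cumulantTerm_two (by decide),
    blockIntensity_univ (by decide), blockIntensity_singleton, blockIntensity_singleton]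
  ring

theorem cumulantIntensity_three (x : Fin 3 → Fin d → ℝ) :
    cumulantIntensity lam 3 x = lam 3 x
      - lam 1 ![x 0] * lam 2 ![x 1, x 2] - lam 1 ![x 1] * lam 2 ![x 0, x 2]
      - lam 1 ![x 2] * lam 2 ![x 0, x 1]
      + 2 * (lam 1 ![x 0] * lam 1 ![x 1] * lam 1 ![x 2]) := by
  rw [cumulantIntensity_eq_sum_cumulantTerm, image_fibreBlocks_three]
  repeat rw [Finset.sum_insert (by decide)]
  rw [Finset.sum_singleton, cumulantTerm_one]
  repeat rw [cumulantTerm_two (by decide)]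
  rw [cumulantTerm_three (by decide) (by decide), blockIntensity_univ (by decide)]
  repeat rw [blockIntensity_pair (by decide)]
  simp only [blockIntensity_singleton]
  ring

theorem cumulantIntensity_four (x : Fin 4 → Fin d → ℝ) :
    cumulantIntensity lam 4 x = lam 4 x
      - lam 1 ![x 0] * lam 3 ![x 1, x 2, x 3] - lam 1 ![x 1] * lam 3 ![x 0, x 2, x 3]
      - lam 1 ![x 2] * lam 3 ![x 0, x 1, x 3] - lam 1 ![x 3] * lam 3 ![x 0, x 1, x 2]
      - lam 2 ![x 0, x 1] * lam 2 ![x 2, x 3] - lam 2 ![x 0, x 2] * lam 2 ![x 1, x 3]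
      - lam 2 ![x 0, x 3] * lam 2 ![x 1, x 2]
      + 2 * (lam 1 ![x 0] * lam 1 ![x 1] * lam 2 ![x 2, x 3])
      + 2 * (lam 1 ![x 0] * lam 1 ![x 2] * lam 2 ![x 1, x 3])
      + 2 * (lam 1 ![x 0] * lam 1 ![x 3] * lam 2 ![x 1, x 2])
      + 2 * (lam 1 ![x 1] * lam 1 ![x 2] * lam 2 ![x 0, x 3])
      + 2 * (lam 1 ![x 1] * lam 1 ![x 3] * lam 2 ![x 0, x 2])
      + 2 * (lam 1 ![x 2] * lam 1 ![x 3] * lam 2 ![x 0, x 1])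
      - 6 * (lam 1 ![x 0] * lam 1 ![x 1] * lam 1 ![x 2] * lam 1 ![x 3]) := by
  rw [cumulantIntensity_eq_sum_cumulantTerm, image_fibreBlocks_four]
  repeat rw [Finset.sum_insert (by decide)]
  rw [Finset.sum_singleton, cumulantTerm_one, cumulantTerm_four (by decide) (by decide) (by decide)]
  repeat rw [cumulantTerm_three (by decide) (by decide)]
  repeat rw [cumulantTerm_two (by decide)]
  rw [blockIntensity_univ (by decide)]
  repeat rw [blockIntensity_triple (by decide) (by decide)]
  repeat rw [blockIntensity_pair (by decide)]
  simp only [blockIntensity_singleton]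
  ring

end formulas
/-! ### Sums over tuples of distinct points -/

section factorial
variable {E R : Type*}

open scoped Classical in
/-- The `k`-tuples of pairwise distinct points of the finite set `S`. -/
noncomputable def injTuples (k : ℕ) (S : Finset E) : Finset (Fin k → E) :=
  (Fintype.piFinset fun _ => S).filter Function.Injective

theorem mem_injTuples {k : ℕ} {S : Finset E} {x : Fin k → E} :
    x ∈ injTuples k S ↔ (∀ i, x i ∈ S) ∧ Function.Injective x := by
  simp [injTuples]

/-- The factorial sum `∑ g₁(x₁) ⋯ gₖ(xₖ)` over the `k`-tuples of distinct points of `S`. -/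
noncomputable def factorialSum [CommRing R] {k : ℕ} (S : Finset E) (g : Fin k → E → R) : R :=
  ∑ x ∈ injTuples k S, ∏ i, g i (x i)

variable [CommRing R]

theorem factorialSum_zero (S : Finset E) (g : Fin 0 → E → R) : factorialSum S g = 1 := by
  have : injTuples 0 S = {Fin.elim0} := by
    ext x; simp [mem_injTuples, Function.injective_of_subsingleton, Subsingleton.elim x Fin.elim0]
  simp [factorialSum, this]

open scoped Classical in
theorem injTuples_succ (k : ℕ) (S : Finset E) :
    injTuples (k + 1) S = (injTuples k S).biUnion fun x =>
      (S \ Finset.univ.image x).image fun y => (Fin.cons y x : Fin (k + 1) → E) := by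
  ext z
  simp only [mem_injTuples, Finset.mem_biUnion, Finset.mem_image, Finset.mem_sdiff,
    Finset.mem_univ, true_and, not_exists]
  constructor
  · rintro ⟨h1, h2⟩
    refine ⟨Fin.tail z, ⟨fun i => h1 _, h2.comp (Fin.succ_injective _)⟩, z 0, ⟨h1 0, ?_⟩,
      Fin.cons_self_tail z⟩
    intro i hi
    exact (Fin.succ_ne_zero i) (h2 hi)
  · rintro ⟨x, ⟨h1, h2⟩, y, ⟨h3, h4⟩, rfl⟩
    refine ⟨fun i => ?_, ?_⟩
    · refine Fin.cases ?_ (fun j => ?_) i <;> simp [h1, h3]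
    · rw [Fin.cons_injective_iff]
      exact ⟨by rintro ⟨i, hi⟩; exact h4 i hi, h2⟩

/-- Multiplying a factorial sum by a further sum either adds a point or merges the new factor with
one of the old ones. -/
theorem sum_mul_factorialSum {k : ℕ} (S : Finset E) (f : E → R) (g : Fin k → E → R) :
    (∑ y ∈ S, f y) * factorialSum S g =
      factorialSum S (Fin.cons f g : Fin (k + 1) → E → R) +
        ∑ i, factorialSum S (Function.update g i (f * g i)) := by
  classical
  have hsucc : factorialSum S (Fin.cons f g : Fin (k + 1) → E → R) =
      ∑ x ∈ injTuples k S, ∑ y ∈ S \ Finset.univ.image x, f y * ∏ i, g i (x i) := by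
    rw [factorialSum, injTuples_succ, Finset.sum_biUnion]
    · refine Finset.sum_congr rfl fun x hx => ?_
      rw [Finset.sum_image]
      · refine Finset.sum_congr rfl fun y hy => ?_
        rw [Fin.prod_univ_succ]; simp
      · intro y _ y' _ h
        exact (Fin.cons_inj.1 h).1
    · intro x _ x' _ hne
      rw [Function.onFun, Finset.disjoint_left]
      intro z hz hz'
      simp only [Finset.mem_image] at hz hz'
      obtain ⟨y, -, rfl⟩ := hz
      obtain ⟨y', -, h⟩ := hz'
      exact hne (Fin.cons_inj.1 h).2.symm
  have hupd : ∀ i, factorialSum S (Function.update g i (f * g i)) =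
      ∑ x ∈ injTuples k S, f (x i) * ∏ i, g i (x i) := by
    intro i
    refine Finset.sum_congr rfl fun x _ => ?_
    rw [← Finset.mul_prod_erase _ _ (Finset.mem_univ i),
      ← Finset.mul_prod_erase _ (fun i => g i (x i)) (Finset.mem_univ i)]
    simp only [Function.update_self, Pi.mul_apply, mul_assoc]
    congr 2
    refine Finset.prod_congr rfl fun j hj => ?_
    rw [Function.update_of_ne (Finset.ne_of_mem_erase hj)]
  simp only [hsucc, hupd]
  rw [Finset.sum_comm, factorialSum, Finset.mul_sum, ← Finset.sum_add_distrib]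
  refine Finset.sum_congr rfl fun x hx => ?_
  rw [← Finset.sum_mul, ← Finset.sum_mul, ← add_mul]
  congr 1
  obtain ⟨h1, h2⟩ := mem_injTuples.1 hx
  rw [← Finset.sum_image (s := Finset.univ) (g := x) (f := f) (h2.injOn),
    Finset.sum_sdiff]
  intro y hy
  simp only [Finset.mem_image, Finset.mem_univ, true_and] at hy
  obtain ⟨i, rfl⟩ := hy
  exact h1 i

theorem factorialSum_one (S : Finset E) (f : E → R) :
    factorialSum S ![f] = ∑ y ∈ S, f y := by
  have := sum_mul_factorialSum S f (Fin.elim0 : Fin 0 → E → R)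
  rw [factorialSum_zero] at this
  simp only [mul_one, Finset.univ_eq_empty, Finset.sum_empty, add_zero] at this
  exact this.symm

theorem sum_mul_factorialSum_one (S : Finset E) (f a : E → R) :
    (∑ y ∈ S, f y) * factorialSum S ![a] = factorialSum S ![f, a] + factorialSum S ![f * a] := by
  rw [sum_mul_factorialSum, Fin.sum_univ_one]
  congr 2
  ext i : 1; fin_cases i; rfl

theorem sum_mul_factorialSum_two (S : Finset E) (f a b : E → R) :
    (∑ y ∈ S, f y) * factorialSum S ![a, b] = factorialSum S ![f, a, b] +
      (factorialSum S ![f * a, b] + factorialSum S ![a, f * b]) := by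
  rw [sum_mul_factorialSum, Fin.sum_univ_two]
  congr 3 <;> (ext i : 1; fin_cases i <;> rfl)

theorem sum_mul_factorialSum_three (S : Finset E) (f a b c : E → R) :
    (∑ y ∈ S, f y) * factorialSum S ![a, b, c] = factorialSum S ![f, a, b, c] +
      (factorialSum S ![f * a, b, c] + factorialSum S ![a, f * b, c] +
        factorialSum S ![a, b, f * c]) := by
  rw [sum_mul_factorialSum, Fin.sum_univ_three]
  congr 4 <;> (ext i : 1; fin_cases i <;> rfl)

/-- A product of four sums in terms of factorial sums. -/
theorem sum_mul_sum_mul_sum_mul_sum (S : Finset E) (a b c e : E → R) :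
    (∑ y ∈ S, a y) * ((∑ y ∈ S, b y) * ((∑ y ∈ S, c y) * ∑ y ∈ S, e y)) =
      factorialSum S ![a, b, c, e]
      + factorialSum S ![a * b, c, e] + factorialSum S ![b, a * c, e]
      + factorialSum S ![b, c, a * e]
      + factorialSum S ![a, b * c, e] + factorialSum S ![a * (b * c), e]
      + factorialSum S ![b * c, a * e]
      + factorialSum S ![a, c, b * e] + factorialSum S ![a * c, b * e]
      + factorialSum S ![c, a * (b * e)]
      + factorialSum S ![a, b, c * e] + factorialSum S ![a * b, c * e]
      + factorialSum S ![b, a * (c * e)]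
      + factorialSum S ![a, b * (c * e)] + factorialSum S ![a * (b * (c * e))] := by
  rw [← factorialSum_one S e, sum_mul_factorialSum_one, mul_add, sum_mul_factorialSum_one,
    sum_mul_factorialSum_two]
  simp only [mul_add, sum_mul_factorialSum_one, sum_mul_factorialSum_two,
    sum_mul_factorialSum_three]
  ring

theorem factorialSum_comp_perm {k : ℕ} (S : Finset E) (g : Fin k → E → R)
    (σ : Equiv.Perm (Fin k)) : factorialSum S (g ∘ σ) = factorialSum S g := by
  refine Finset.sum_bij (fun x _ => x ∘ σ.symm) (fun x hx => ?_) (fun x _ y _ h => ?_)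
    (fun y hy => ?_) (fun x _ => ?_)
  · obtain ⟨h1, h2⟩ := mem_injTuples.1 hx
    exact mem_injTuples.2 ⟨fun i => h1 _, h2.comp σ.symm.injective⟩
  · exact σ.symm.surjective.injective_comp_right h
  · obtain ⟨h1, h2⟩ := mem_injTuples.1 hy
    exact ⟨y ∘ σ, mem_injTuples.2 ⟨fun i => h1 _, h2.comp σ.injective⟩, by ext; simp⟩
  · rw [← Equiv.prod_comp σ.symm]; simp

end factorial

/-! ### Campbell's formula for the points in a bounded set -/

section moments
variable {Ω : Type*} [MeasurableSpace Ω] {d : ℕ} {X : Ω → Set (Fin d → ℝ)}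

/-- The finitely many points of the process in a bounded set. -/
noncomputable def pointsIn (hX : IsSimplePointProcess X) {D : Set (Fin d → ℝ)}
    (hD : Bornology.IsBounded D) (w : Ω) : Finset (Fin d → ℝ) :=
  (hX.finite_inter w D hD).toFinset

variable (hX : IsSimplePointProcess X) {D : Set (Fin d → ℝ)} (hD : Bornology.IsBounded D)

theorem mem_pointsIn {w : Ω} {x : Fin d → ℝ} : x ∈ pointsIn hX hD w ↔ x ∈ X w ∧ x ∈ D := by
  simp [pointsIn]

theorem measurable_sum_indicator (hDm : MeasurableSet D) {B : Set (Fin d → ℝ)}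
    (hB : MeasurableSet B) :
    Measurable fun w => ∑ x ∈ pointsIn hX hD w, B.indicator (fun _ => (1 : ℝ)) x := by
  have h := hX.measurable_count (D ∩ B) (hDm.inter hB) (hD.subset Set.inter_subset_left)
  have h2 : (fun w => ∑ x ∈ pointsIn hX hD w, B.indicator (fun _ => (1 : ℝ)) x) =
      fun w => (((X w ∩ (D ∩ B)).ncard : ℕ) : ℝ) := by
    classical
    ext w
    rw [Finset.sum_indicator_eq_sum_filter, Finset.sum_const, nsmul_eq_mul, mul_one]
    rw [← Set.ncard_coe_finset]
    congr 3
    ext x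
    simp only [Finset.coe_filter, mem_pointsIn, Set.mem_ofPred_eq, Set.mem_inter_iff, and_assoc]
  rw [h2]
  exact measurable_from_top.comp h

/-- The number of tuples of distinct points in a product set is measurable: it is a polynomial in
counts, by induction on the length of the tuples. -/
theorem measurable_factorialSum_indicator (hDm : MeasurableSet D) {k : ℕ}
    (B : Fin k → Set (Fin d → ℝ)) (hB : ∀ i, MeasurableSet (B i)) :
    Measurable fun w => factorialSum (pointsIn hX hD w)
      fun i => (B i).indicator (fun _ => (1 : ℝ)) := by
  induction k with
  | zero => simp [factorialSum_zero]
  | succ k ih =>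
    have key : ∀ w, factorialSum (pointsIn hX hD w) (fun i => (B i).indicator (fun _ => (1 : ℝ))) =
        (∑ x ∈ pointsIn hX hD w, (B 0).indicator (fun _ => (1 : ℝ)) x) *
          factorialSum (pointsIn hX hD w) (fun i => (B i.succ).indicator (fun _ => (1 : ℝ))) -
        ∑ i, factorialSum (pointsIn hX hD w) (fun j => ((Function.update (fun j : Fin k => B j.succ)
          i (B 0 ∩ B i.succ)) j).indicator (fun _ => (1 : ℝ))) := by
      intro w
      rw [sum_mul_factorialSum, eq_sub_iff_add_eq]
      congr 1
      · congr 1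
        ext i : 1
        refine Fin.cases ?_ (fun j => ?_) i <;> simp
      · refine Finset.sum_congr rfl fun i _ => ?_
        congr 1
        ext j x
        by_cases hj : j = i
        · subst hj
          simp only [Pi.mul_apply, Function.update_self]
          by_cases h0 : x ∈ B 0 <;> by_cases h1 : x ∈ B j.succ <;> simp [h0, h1]
        · simp [Function.update_of_ne hj]
    simp only [key]
    refine ((measurable_sum_indicator hX hD hDm (hB 0)).mul (ih _ fun i => hB _)).sub ?_
    refine Finset.measurable_sum _ fun i _ => ih _ fun j => ?_
    by_cases hj : j = i
    · subst hj; simpa using (hB 0).inter (hB _)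
    · simpa [Function.update_of_ne hj] using hB _

/-- The empirical factorial measure: unit masses at all `k`-tuples of distinct points in `D`. -/
noncomputable def factorialMeasure (k : ℕ) (w : Ω) : Measure (Fin k → Fin d → ℝ) :=
  ∑ x ∈ injTuples k (pointsIn hX hD w), Measure.dirac x

instance (k : ℕ) (w : Ω) : IsFiniteMeasure (factorialMeasure hX hD k w) := by
  unfold factorialMeasure; infer_instance

theorem factorialMeasure_apply (k : ℕ) (w : Ω) {s : Set (Fin k → Fin d → ℝ)}
    (hs : MeasurableSet s) :
    factorialMeasure hX hD k w s =
      ∑ x ∈ injTuples k (pointsIn hX hD w), s.indicator (fun _ => 1) x := by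
  simp only [factorialMeasure, Measure.coe_finsetSum, Finset.sum_apply]
  exact Finset.sum_congr rfl fun x _ => Measure.dirac_apply' _ hs

theorem measurable_factorialMeasure (hDm : MeasurableSet D) (k : ℕ) :
    Measurable (factorialMeasure hX hD k) := by
  have hrect : ∀ B : Fin k → Set (Fin d → ℝ), (∀ i, MeasurableSet (B i)) →
      Measurable fun w => factorialMeasure hX hD k w (Set.univ.pi B) := by
    intro B hB
    have : ∀ w, factorialMeasure hX hD k w (Set.univ.pi B) =
        ENNReal.ofReal (factorialSum (pointsIn hX hD w)
          fun i => (B i).indicator (fun _ => (1 : ℝ))) := by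
      intro w
      rw [factorialMeasure_apply hX hD k w (MeasurableSet.univ_pi hB), factorialSum,
        ENNReal.ofReal_sum_of_nonneg fun x _ => Finset.prod_nonneg fun i _ =>
          Set.indicator_nonneg (fun _ _ => zero_le_one) _]
      refine Finset.sum_congr rfl fun x _ => ?_
      by_cases hx : ∀ i, x i ∈ B i
      · rw [Set.indicator_of_mem (by simpa using hx), Finset.prod_congr rfl fun i _ =>
          Set.indicator_of_mem (hx i) _]
        simp
      · rw [Set.indicator_of_notMem (by simpa using hx)]
        push Not at hx
        obtain ⟨i, hi⟩ := hx
        rw [Finset.prod_eq_zero (Finset.mem_univ i) (Set.indicator_of_notMem hi _)]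
        simp
    simp only [this]
    exact (measurable_factorialSum_indicator hX hD hDm B hB).ennreal_ofReal
  refine Measurable.measure_of_isPiSystem generateFrom_pi.symm isPiSystem_pi ?_ ?_
  · rintro s ⟨B, hB, rfl⟩
    exact hrect B fun i => hB i trivial
  · simpa using hrect (fun _ => Set.univ) fun _ => MeasurableSet.univ

theorem integral_factorialMeasure (k : ℕ) (w : Ω) (g : Fin k → (Fin d → ℝ) → ℂ) :
    ∫ x, ∏ i, g i (x i) ∂(factorialMeasure hX hD k w) = factorialSum (pointsIn hX hD w) g := by
  rw [factorialMeasure, integral_finsetSum_measure]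
  · exact Finset.sum_congr rfl fun x _ => integral_dirac _ _
  · intro x _
    exact integrable_dirac (by simp [enorm_lt_top])

theorem tsum_distinctTuples (k : ℕ) (w : Ω) (q : (Fin k → Fin d → ℝ) → ENNReal)
    (hq : ∀ x, (∃ i, x i ∉ D) → q x = 0) :
    ∑' x : distinctTuples k (X w), q x = ∑ x ∈ injTuples k (pointsIn hX hD w), q x := by
  rw [tsum_subtype, tsum_eq_sum (s := injTuples k (pointsIn hX hD w))]
  · refine Finset.sum_congr rfl fun x hx => Set.indicator_of_mem ?_ _
    obtain ⟨h1, h2⟩ := mem_injTuples.1 hx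
    exact ⟨h2, fun i => ((mem_pointsIn hX hD).1 (h1 i)).1⟩
  · intro x hx
    by_cases h : x ∈ distinctTuples k (X w)
    · rw [Set.indicator_of_mem h]
      apply hq
      by_contra! hc
      exact hx (mem_injTuples.2 ⟨fun i => (mem_pointsIn hX hD).2 ⟨h.2 i, hc i⟩, h.1⟩)
    · exact Set.indicator_of_notMem h _

variable {P : Measure Ω} {k : ℕ} {lamk : (Fin k → Fin d → ℝ) → ℝ}

/-- Campbell's formula as an identity of measures: the mean factorial measure has the intensity
function as its density. -/
theorem bind_factorialMeasure (hDm : MeasurableSet D) (hl : IsIntensityFunction P X k lamk) :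
    P.bind (factorialMeasure hX hD k) =
      (Measure.pi fun _ : Fin k => volume.restrict D).withDensity
        fun x => ENNReal.ofReal (lamk x) := by
  have hpi : MeasurableSet (Set.univ.pi fun _ : Fin k => D) := MeasurableSet.univ_pi fun _ => hDm
  ext s hs
  rw [Measure.bind_apply hs (measurable_factorialMeasure hX hD hDm k).aemeasurable,
    withDensity_apply _ hs, ← Measure.restrict_pi_pi, Measure.restrict_restrict hs]
  have := hl.campbell ((s ∩ Set.univ.pi fun _ => D).indicator fun _ => 1)
    (measurable_const.indicator (hs.inter hpi))
  rw [← volume_pi, ← lintegral_indicator (hs.inter hpi)]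
  convert this using 1
  · refine lintegral_congr fun w => ?_
    rw [tsum_distinctTuples hX hD, factorialMeasure_apply hX hD k w hs]
    · refine Finset.sum_congr rfl fun x hx => ?_
      have : x ∈ Set.univ.pi fun _ => D := fun i _ =>
        ((mem_pointsIn hX hD).1 ((mem_injTuples.1 hx).1 i)).2
      by_cases hxs : x ∈ s
      · rw [Set.indicator_of_mem hxs, Set.indicator_of_mem (Set.mem_inter hxs this)]
      · rw [Set.indicator_of_notMem hxs, Set.indicator_of_notMem fun h => hxs h.1]
    · rintro x ⟨i, hi⟩
      refine Set.indicator_of_notMem (fun h => hi (h.2 i trivial)) _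
  · refine lintegral_congr fun x => ?_
    by_cases hx : x ∈ s ∩ Set.univ.pi fun _ => D
    · simp [Set.indicator_of_mem hx]
    · simp [Set.indicator_of_notMem hx]

/-- The expectation of a factorial sum of complex functions. -/
theorem integrable_factorialSum [IsFiniteMeasure P] (hDm : MeasurableSet D)
    (hl : IsIntensityFunction P X k lamk) {g : Fin k → (Fin d → ℝ) → ℂ}
    (hint : Integrable (fun x => (∏ i, g i (x i)) * (lamk x : ℂ))
      (Measure.pi fun _ : Fin k => volume.restrict D)) :
    Integrable (fun w => factorialSum (pointsIn hX hD w) g) P ∧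
    ∫ w, factorialSum (pointsIn hX hD w) g ∂P =
      ∫ x, (∏ i, g i (x i)) * (lamk x : ℂ) ∂(Measure.pi fun _ : Fin k => volume.restrict D) := by
  let κ : ProbabilityTheory.Kernel Ω (Fin k → Fin d → ℝ) :=
    ⟨factorialMeasure hX hD k, measurable_factorialMeasure hX hD hDm k⟩
  have hκ : ((κ.comp (ProbabilityTheory.Kernel.const Unit P)) ()) =
      (Measure.pi fun _ : Fin k => volume.restrict D).withDensity
        fun x => ENNReal.ofReal (lamk x) := by
    rw [ProbabilityTheory.Kernel.comp_apply, ProbabilityTheory.Kernel.const_apply]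
    exact bind_factorialMeasure hX hD hDm hl
  have hi : Integrable (fun x => ∏ i, g i (x i))
      (κ.comp (ProbabilityTheory.Kernel.const Unit P) ()) := by
    rw [hκ, integrable_withDensity_iff_integrable_smul' hl.measurable.ennreal_ofReal
      (ae_of_all _ fun _ => ENNReal.ofReal_lt_top)]
    refine hint.congr (ae_of_all _ fun x => ?_)
    simp [ENNReal.toReal_ofReal (hl.nonneg x), mul_comm]
  have h1 := hi.integral_comp
  have h2 := ProbabilityTheory.Kernel.integral_comp hi
  rw [ProbabilityTheory.Kernel.const_apply] at h1 h2
  have h3 : ∀ w, ∫ x, ∏ i, g i (x i) ∂κ w = factorialSum (pointsIn hX hD w) g :=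
    fun w => integral_factorialMeasure hX hD k w g
  simp only [h3] at h1 h2
  refine ⟨h1, h2.symm.trans ?_⟩
  rw [hκ, integral_withDensity_eq_integral_toReal_smul hl.measurable.ennreal_ofReal
      (ae_of_all _ fun _ => ENNReal.ofReal_lt_top)]
  refine integral_congr_ae (ae_of_all _ fun x => ?_)
  simp [ENNReal.toReal_ofReal (hl.nonneg x), mul_comm]

end moments
/-! ### Integrals over powers of a measure space -/

section piIntegrals
variable {E : Type*} [MeasurableSpace E] {μ : Measure E}

/-- The integral `∫ g₁(x₁) ⋯ gₖ(xₖ) F(x) μ(dx₁) ⋯ μ(dxₖ)`. -/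
noncomputable def multiIntegral {k : ℕ} (μ : Measure E) (F : (Fin k → E) → ℝ)
    (g : Fin k → E → ℂ) : ℂ :=
  ∫ x, (∏ i, g i (x i)) * (F x : ℂ) ∂(Measure.pi fun _ => μ)

theorem integrable_prod_mul {k : ℕ} {F : (Fin k → E) → ℝ} {g : Fin k → E → ℂ}
    (hF : Integrable F (Measure.pi fun _ => μ)) (hg : ∀ i, Measurable (g i))
    (hb : ∀ i, ∃ M, ∀ x, ‖g i x‖ ≤ M) :
    Integrable (fun x => (∏ i, g i (x i)) * (F x : ℂ)) (Measure.pi fun _ => μ) := by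
  choose M hM using hb
  refine hF.ofReal.bdd_mul (c := ∏ i, M i) ?_ (ae_of_all _ fun x => ?_)
  · exact (Finset.measurable_prod _ fun i _ =>
      (hg i).comp (measurable_pi_apply i)).aestronglyMeasurable
  · rw [norm_prod]
    exact Finset.prod_le_prod (fun _ _ => norm_nonneg _) fun i _ => hM i _

theorem multiIntegral_add {k : ℕ} {F G : (Fin k → E) → ℝ} {g : Fin k → E → ℂ}
    (hF : Integrable F (Measure.pi fun _ => μ)) (hG : Integrable G (Measure.pi fun _ => μ))
    (hg : ∀ i, Measurable (g i)) (hb : ∀ i, ∃ M, ∀ x, ‖g i x‖ ≤ M) :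
    multiIntegral μ (F + G) g = multiIntegral μ F g + multiIntegral μ G g := by
  rw [multiIntegral, multiIntegral, multiIntegral, ← integral_add (integrable_prod_mul hF hg hb)
    (integrable_prod_mul hG hg hb)]
  congr 1
  ext x
  rw [Pi.add_apply]
  push_cast; ring

theorem norm_multiIntegral_le {k : ℕ} {F : (Fin k → E) → ℝ} {g : Fin k → E → ℂ} {M : Fin k → ℝ}
    (hF : Integrable F (Measure.pi fun _ => μ)) (hb : ∀ i x, ‖g i x‖ ≤ M i) :
    ‖multiIntegral μ F g‖ ≤ (∏ i, M i) * ∫ x, |F x| ∂(Measure.pi fun _ => μ) := by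
  rw [← integral_const_mul]
  refine norm_integral_le_of_norm_le (hF.abs.const_mul _) (ae_of_all _ fun x => ?_)
  rw [norm_mul, norm_prod, Complex.norm_real, Real.norm_eq_abs]
  gcongr
  exact hb _ _

variable [SigmaFinite μ]

theorem integral_mul_removeNth {n : ℕ} (i : Fin (n + 1)) (g : E → ℂ) (F : (Fin n → E) → ℂ) :
    ∫ x : Fin (n + 1) → E, g (x i) * F (i.removeNth x) ∂(Measure.pi fun _ => μ) =
      (∫ y, g y ∂μ) * ∫ x, F x ∂(Measure.pi fun _ => μ) := by
  rw [← integral_prod_mul]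
  exact (measurePreserving_piFinSuccAbove (fun _ : Fin (n + 1) => μ) i).integral_comp'
    (fun z : E × (Fin n → E) => g z.1 * F z.2)

theorem integrable_comp_removeNth [IsFiniteMeasure μ] {n : ℕ} (i : Fin (n + 1))
    {F : (Fin n → E) → ℝ} (hF : Integrable F (Measure.pi fun _ => μ)) :
    Integrable (fun x : Fin (n + 1) → E => F (i.removeNth x)) (Measure.pi fun _ => μ) := by
  have h := (measurePreserving_piFinSuccAbove (fun _ : Fin (n + 1) => μ) i).integrable_comp_emb
    (MeasurableEquiv.measurableEmbedding _) (g := fun z : E × (Fin n → E) => F z.2)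
  exact h.2 (hF.comp_snd μ)

/-- Splitting the coordinates into two groups preserves the product measure. -/
theorem measurePreserving_sumArrow {a b n : ℕ} (e : Fin a ⊕ Fin b ≃ Fin n) :
    MeasurePreserving (fun x : Fin n → E =>
      ((fun j => x (e (Sum.inl j)), fun j => x (e (Sum.inr j))) : (Fin a → E) × (Fin b → E)))
      (Measure.pi fun _ => μ)
      ((Measure.pi fun _ => μ).prod (Measure.pi fun _ => μ)) :=
  (measurePreserving_sumPiEquivProdPi (fun _ : Fin a ⊕ Fin b => μ)).comp
    (measurePreserving_piCongrLeft (fun _ : Fin n => μ) e).symm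

theorem integral_mul_sum {a b n : ℕ} (e : Fin a ⊕ Fin b ≃ Fin n) (F : (Fin a → E) → ℂ)
    (G : (Fin b → E) → ℂ) :
    ∫ x : Fin n → E, F (fun j => x (e (Sum.inl j))) * G (fun j => x (e (Sum.inr j)))
      ∂(Measure.pi fun _ => μ) =
      (∫ x, F x ∂(Measure.pi fun _ => μ)) * ∫ x, G x ∂(Measure.pi fun _ => μ) := by
  rw [← integral_prod_mul]
  have := ((MeasurableEquiv.piCongrLeft (fun _ => E) e).symm.trans
    (MeasurableEquiv.sumPiEquivProdPi fun _ : Fin a ⊕ Fin b => E)).measurableEmbedding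
  exact (measurePreserving_sumArrow (μ := μ) e).integral_comp this fun z => F z.1 * G z.2

theorem integrable_mul_sum {a b n : ℕ} (e : Fin a ⊕ Fin b ≃ Fin n) {F : (Fin a → E) → ℝ}
    {G : (Fin b → E) → ℝ} (hF : Integrable F (Measure.pi fun _ => μ))
    (hG : Integrable G (Measure.pi fun _ => μ)) :
    Integrable (fun x : Fin n → E => F (fun j => x (e (Sum.inl j))) *
      G (fun j => x (e (Sum.inr j)))) (Measure.pi fun _ => μ) := by
  have := ((MeasurableEquiv.piCongrLeft (fun _ => E) e).symm.trans
    (MeasurableEquiv.sumPiEquivProdPi fun _ : Fin a ⊕ Fin b => E)).measurableEmbedding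
  exact ((measurePreserving_sumArrow (μ := μ) e).integrable_comp_emb this).2 (hF.mul_prod hG)

theorem multiIntegral_const_zero (c : ℝ) (g : Fin 0 → E → ℂ) :
    multiIntegral μ (fun _ => c) g = c := by
  have : (Measure.pi fun _ : Fin 0 => μ).real Set.univ = 1 := by
    rw [Measure.real, Measure.pi_univ]; simp
  simp [multiIntegral, this]

theorem multiIntegral_removeNth {n : ℕ} (i : Fin (n + 1)) (F : (Fin n → E) → ℝ)
    (g : Fin (n + 1) → E → ℂ) :
    multiIntegral μ (fun x => F (i.removeNth x)) g =
      (∫ y, g i y ∂μ) * multiIntegral μ F (fun j => g (i.succAbove j)) := by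
  rw [multiIntegral, multiIntegral, ← integral_mul_removeNth]
  congr 1
  ext x
  rw [Fin.prod_univ_succAbove _ i, mul_assoc]
  rfl

theorem multiIntegral_sum {a b n : ℕ} (e : Fin a ⊕ Fin b ≃ Fin n) (F : (Fin a → E) → ℝ)
    (G : (Fin b → E) → ℝ) (g : Fin n → E → ℂ) :
    multiIntegral μ (fun x => F (fun j => x (e (Sum.inl j))) * G (fun j => x (e (Sum.inr j)))) g =
      multiIntegral μ F (fun j => g (e (Sum.inl j))) *
      multiIntegral μ G (fun j => g (e (Sum.inr j))) := by
  rw [multiIntegral, multiIntegral, multiIntegral, ← integral_mul_sum e]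
  congr 1
  ext x
  rw [← e.prod_comp, Fintype.prod_sum_type]
  push_cast; ring

end piIntegrals

/-! ### Intensities expanded in cumulant intensities -/

/-- The first-order intensity is a constant at most `G`, and the cumulant intensities of orders two
to four satisfy `∫ |γₙ(x₁,…,xₙ)| dx₁ ⋯ dxₙ₋₁ ≤ G` for every `xₙ`. -/
structure CumulantBound {d : ℕ} (lam : (n : ℕ) → (Fin n → Fin d → ℝ) → ℝ) (G : ℝ) : Prop where
  const : ∀ x, lam 1 x = firstIntensity lam
  nonneg : 0 ≤ firstIntensity lam
  le : firstIntensity lam ≤ G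
  measurable : ∀ m : ℕ, 1 ≤ m → m + 1 ≤ 4 → Measurable (cumulantIntensity lam (m + 1))
  lintegral_le : ∀ m : ℕ, 1 ≤ m → m + 1 ≤ 4 → ∀ y : Fin d → ℝ, ∫⁻ u : Fin m → Fin d → ℝ,
      ‖cumulantIntensity lam (m + 1) (Fin.snoc u y)‖ₑ ≤ ENNReal.ofReal G

section
variable {d : ℕ} {lam : (n : ℕ) → (Fin n → Fin d → ℝ) → ℝ} {G : ℝ}

theorem CumulantBound.lintegral_pi_le (hG : CumulantBound lam G) {m : ℕ} (h1 : 1 ≤ m)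
    (h4 : m + 1 ≤ 4) (D : Set (Fin d → ℝ)) :
    ∫⁻ x, ‖cumulantIntensity lam (m + 1) x‖ₑ
      ∂(Measure.pi fun _ : Fin (m + 1) => volume.restrict D) ≤ ENNReal.ofReal G * volume D := by
  have hm := (hG.measurable m h1 h4).enorm
  have h := (measurePreserving_piFinSuccAbove (fun _ : Fin (m + 1) => volume.restrict D)
    (Fin.last m)).symm
  rw [← h.lintegral_comp hm, lintegral_prod _ (by exact (hm.comp h.measurable).aemeasurable)]
  calc _ ≤ ∫⁻ y in D, ENNReal.ofReal G := by
        refine lintegral_mono fun y => ?_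
        refine le_trans ?_ (hG.lintegral_le m h1 h4 y)
        rw [← Measure.restrict_pi_pi]
        refine (setLIntegral_le_lintegral _ _).trans (le_of_eq ?_)
        refine lintegral_congr fun u => ?_
        simp [MeasurableEquiv.piFinSuccAbove, Fin.insertNthEquiv]
    _ = _ := by simp

theorem CumulantBound.integrable_cumulant (hG : CumulantBound lam G) {m : ℕ} (h1 : 1 ≤ m)
    (h4 : m + 1 ≤ 4) {D : Set (Fin d → ℝ)} (hD : volume D ≠ ⊤) :
    Integrable (cumulantIntensity lam (m + 1))
      (Measure.pi fun _ : Fin (m + 1) => volume.restrict D) :=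
  ⟨(hG.measurable m h1 h4).aestronglyMeasurable,
    (hG.lintegral_pi_le h1 h4 D).trans_lt (ENNReal.mul_lt_top ENNReal.ofReal_lt_top hD.lt_top)⟩

theorem CumulantBound.integral_abs_le (hG : CumulantBound lam G) {m : ℕ} (h1 : 1 ≤ m)
    (h4 : m + 1 ≤ 4) {D : Set (Fin d → ℝ)} (hD : volume D ≠ ⊤) :
    ∫ x, |cumulantIntensity lam (m + 1) x|
      ∂(Measure.pi fun _ : Fin (m + 1) => volume.restrict D) ≤ G * volume.real D := by
  simp only [← Real.norm_eq_abs]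
  rw [integral_norm_eq_lintegral_enorm (hG.measurable m h1 h4).aestronglyMeasurable]
  have := ENNReal.toReal_mono (ENNReal.mul_ne_top ENNReal.ofReal_ne_top hD)
    (hG.lintegral_pi_le h1 h4 D)
  rwa [ENNReal.toReal_mul, ENNReal.toReal_ofReal (hG.nonneg.trans hG.le)] at this

/-- `∫∫_{D×D} f(x) g(y) γ₂(x, y) dx dy + λ ∫_D f g`, the covariance of the sums of `f` and `g` over
the points in `D`. It is bilinear, without a complex conjugate. -/
noncomputable def covForm (lam : (n : ℕ) → (Fin n → Fin d → ℝ) → ℝ) (D : Set (Fin d → ℝ))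
    (f g : (Fin d → ℝ) → ℂ) : ℂ :=
  multiIntegral (volume.restrict D) (cumulantIntensity lam 2) ![f, g] +
    firstIntensity lam * ∫ x in D, f x * g x

theorem CumulantBound.two (hG : CumulantBound lam G) (x : Fin 2 → Fin d → ℝ) :
    lam 2 x = cumulantIntensity lam 2 x + firstIntensity lam ^ 2 := by
  rw [cumulantIntensity_two, hG.const, hG.const]; ring

/-- `λ₃` in terms of `γ₃` and functions of two of the points; the constant `-2λ³` is attached to the
function that does not depend on the middle point. -/
theorem CumulantBound.three (hG : CumulantBound lam G) (x : Fin 3 → Fin d → ℝ) :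
    lam 3 x = cumulantIntensity lam 3 x +
      (firstIntensity lam * lam 2 (Fin.removeNth 0 x) +
      ((firstIntensity lam * lam 2 (Fin.removeNth 1 x) - 2 * firstIntensity lam ^ 3) +
      firstIntensity lam * lam 2 (Fin.removeNth 2 x))) := by
  have h0 : Fin.removeNth 0 x = ![x 1, x 2] := by ext j : 1; fin_cases j <;> rfl
  have h1 : Fin.removeNth 1 x = ![x 0, x 2] := by ext j : 1; fin_cases j <;> rfl
  have h2 : Fin.removeNth 2 x = ![x 0, x 1] := by ext j : 1; fin_cases j <;> rfl
  rw [cumulantIntensity_three, h0, h1, h2]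
  simp only [hG.const]
  ring

/-- The splitting of `{0,1,2,3}` into `{0,1}` and `{2,3}`. -/
def pairing₁ : Fin 2 ⊕ Fin 2 ≃ Fin 4 := finSumFinEquiv

/-- The splitting of `{0,1,2,3}` into `{0,2}` and `{1,3}`. -/
def pairing₂ : Fin 2 ⊕ Fin 2 ≃ Fin 4 := pairing₁.trans (Equiv.swap 1 2)

/-- The splitting of `{0,1,2,3}` into `{0,3}` and `{1,2}`. -/
def pairing₃ : Fin 2 ⊕ Fin 2 ≃ Fin 4 := pairing₁.trans ((Equiv.swap 1 3).trans (Equiv.swap 1 2))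

variable (lam) in
/-- The part of the fourth-order intensity given by a splitting into two pairs. -/
def pairProduct (e : Fin 2 ⊕ Fin 2 ≃ Fin 4) (x : Fin 4 → Fin d → ℝ) : ℝ :=
  lam 2 (fun j => x (e (Sum.inl j))) * lam 2 (fun j => x (e (Sum.inr j)))

variable (lam) in
/-- For each `i`, the terms of the fourth-order intensity that belong to partitions with the
singleton block `{i}`, as a function of the other three points; a partition with several singletons
is counted for the smallest one. -/
def singletonPart (i : Fin 4) (y : Fin 3 → Fin d → ℝ) : ℝ :=
  (![fun y => firstIntensity lam * lam 3 y + (-2 * firstIntensity lam ^ 2) *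
        (lam 2 (Fin.removeNth 0 y) + lam 2 (Fin.removeNth 1 y) + lam 2 (Fin.removeNth 2 y)) +
        6 * firstIntensity lam ^ 4,
      fun y => firstIntensity lam * lam 3 y + (-2 * firstIntensity lam ^ 2) *
        (lam 2 (Fin.removeNth 1 y) + lam 2 (Fin.removeNth 2 y)),
      fun y => firstIntensity lam * lam 3 y + (-2 * firstIntensity lam ^ 2) *
        lam 2 (Fin.removeNth 2 y),
      fun y => firstIntensity lam * lam 3 y] : Fin 4 → (Fin 3 → Fin d → ℝ) → ℝ) i y

theorem CumulantBound.four (hG : CumulantBound lam G) (x : Fin 4 → Fin d → ℝ) :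
    lam 4 x = cumulantIntensity lam 4 x +
      (singletonPart lam 0 (Fin.removeNth 0 x) + (singletonPart lam 1 (Fin.removeNth 1 x) +
      (singletonPart lam 2 (Fin.removeNth 2 x) + (singletonPart lam 3 (Fin.removeNth 3 x) +
      (pairProduct lam pairing₁ x + (pairProduct lam pairing₂ x +
        pairProduct lam pairing₃ x)))))) := by
  have a0 : Fin.removeNth 0 x = ![x 1, x 2, x 3] := by ext j : 1; fin_cases j <;> rfl
  have a1 : Fin.removeNth 1 x = ![x 0, x 2, x 3] := by ext j : 1; fin_cases j <;> rfl
  have a2 : Fin.removeNth 2 x = ![x 0, x 1, x 3] := by ext j : 1; fin_cases j <;> rfl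
  have a3 : Fin.removeNth 3 x = ![x 0, x 1, x 2] := by ext j : 1; fin_cases j <;> rfl
  have b0 : ∀ p q r : Fin d → ℝ, Fin.removeNth 0 ![p, q, r] = ![q, r] := by
    intros; ext j : 1; fin_cases j <;> rfl
  have b1 : ∀ p q r : Fin d → ℝ, Fin.removeNth 1 ![p, q, r] = ![p, r] := by
    intros; ext j : 1; fin_cases j <;> rfl
  have b2 : ∀ p q r : Fin d → ℝ, Fin.removeNth 2 ![p, q, r] = ![p, q] := by
    intros; ext j : 1; fin_cases j <;> rfl
  have p1 : pairProduct lam pairing₁ x = lam 2 ![x 0, x 1] * lam 2 ![x 2, x 3] := by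
    rw [pairProduct]; congr 2 <;> (ext j : 1; fin_cases j <;> rfl)
  have p2 : pairProduct lam pairing₂ x = lam 2 ![x 0, x 2] * lam 2 ![x 1, x 3] := by
    rw [pairProduct]; congr 2 <;> (ext j : 1; fin_cases j <;> rfl)
  have p3 : pairProduct lam pairing₃ x = lam 2 ![x 0, x 3] * lam 2 ![x 1, x 2] := by
    rw [pairProduct]; congr 2 <;> (ext j : 1; fin_cases j <;> rfl)
  rw [cumulantIntensity_four, p1, p2, p3, a0, a1, a2, a3]
  simp only [singletonPart, Matrix.cons_val, b0, b1, b2, hG.const]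
  ring

theorem CumulantBound.integrable_one (hG : CumulantBound lam G) {D : Set (Fin d → ℝ)}
    (hD : volume D ≠ ⊤) :
    Integrable (lam 1) (Measure.pi fun _ : Fin 1 => volume.restrict D) := by
  have : IsFiniteMeasure (volume.restrict D) := isFiniteMeasure_restrict.2 hD
  rw [funext hG.const]
  exact integrable_const _

theorem CumulantBound.integrable_two (hG : CumulantBound lam G) {D : Set (Fin d → ℝ)}
    (hD : volume D ≠ ⊤) :
    Integrable (lam 2) (Measure.pi fun _ : Fin 2 => volume.restrict D) := by
  have : IsFiniteMeasure (volume.restrict D) := isFiniteMeasure_restrict.2 hD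
  rw [funext hG.two]
  exact (hG.integrable_cumulant (m := 1) (by norm_num) (by norm_num) hD).add (integrable_const _)

theorem CumulantBound.integrable_three (hG : CumulantBound lam G) {D : Set (Fin d → ℝ)}
    (hD : volume D ≠ ⊤) :
    Integrable (lam 3) (Measure.pi fun _ : Fin 3 => volume.restrict D) := by
  have : IsFiniteMeasure (volume.restrict D) := isFiniteMeasure_restrict.2 hD
  rw [funext hG.three]
  have h2 := fun i : Fin 3 => integrable_comp_removeNth i (hG.integrable_two hD)
  exact (hG.integrable_cumulant (m := 2) (by norm_num) (by norm_num) hD).add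
    (((h2 0).const_mul _).add ((((h2 1).const_mul _).sub (integrable_const _)).add
      ((h2 2).const_mul _)))

theorem CumulantBound.integrable_singletonPart (hG : CumulantBound lam G) {D : Set (Fin d → ℝ)}
    (hD : volume D ≠ ⊤) (i : Fin 4) :
    Integrable (singletonPart lam i) (Measure.pi fun _ : Fin 3 => volume.restrict D) := by
  have : IsFiniteMeasure (volume.restrict D) := isFiniteMeasure_restrict.2 hD
  have h2 := fun i : Fin 3 => integrable_comp_removeNth i (hG.integrable_two hD)
  have h3 := (hG.integrable_three hD).const_mul (firstIntensity lam)
  fin_cases i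
  · exact (h3.add ((((h2 0).add (h2 1)).add (h2 2)).const_mul _)).add (integrable_const _)
  · exact h3.add (((h2 1).add (h2 2)).const_mul _)
  · exact h3.add ((h2 2).const_mul _)
  · exact h3

theorem CumulantBound.integrable_pairProduct (hG : CumulantBound lam G) {D : Set (Fin d → ℝ)}
    (hD : volume D ≠ ⊤) (e : Fin 2 ⊕ Fin 2 ≃ Fin 4) :
    Integrable (pairProduct lam e) (Measure.pi fun _ : Fin 4 => volume.restrict D) :=
  integrable_mul_sum e (hG.integrable_two hD) (hG.integrable_two hD)

theorem CumulantBound.integrable_four (hG : CumulantBound lam G) {D : Set (Fin d → ℝ)}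
    (hD : volume D ≠ ⊤) :
    Integrable (lam 4) (Measure.pi fun _ : Fin 4 => volume.restrict D) := by
  have : IsFiniteMeasure (volume.restrict D) := isFiniteMeasure_restrict.2 hD
  rw [funext hG.four]
  have h1 := fun i : Fin 4 => integrable_comp_removeNth i (hG.integrable_singletonPart hD i)
  have h2 := hG.integrable_pairProduct hD
  exact (hG.integrable_cumulant (m := 3) (by norm_num) (by norm_num) hD).add
    ((h1 0).add ((h1 1).add ((h1 2).add ((h1 3).add ((h2 _).add ((h2 _).add (h2 _)))))))

section expansion
variable {D : Set (Fin d → ℝ)}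

theorem CumulantBound.multiIntegral_one (hG : CumulantBound lam G) (f : (Fin d → ℝ) → ℂ) :
    multiIntegral (volume.restrict D) (lam 1) ![f] = firstIntensity lam * ∫ x in D, f x := by
  have h := multiIntegral_removeNth (μ := volume.restrict D) 0
    (fun _ : Fin 0 → Fin d → ℝ => firstIntensity lam) ![f]
  rw [funext hG.const, h, multiIntegral_const_zero, mul_comm]
  rfl

theorem CumulantBound.multiIntegral_two (hG : CumulantBound lam G) (hD : volume D ≠ ⊤)
    {f g : (Fin d → ℝ) → ℂ} (hf : Measurable f) (hg : Measurable g) (hfb : ∃ M, ∀ x, ‖f x‖ ≤ M)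
    (hgb : ∃ M, ∀ x, ‖g x‖ ≤ M) :
    multiIntegral (volume.restrict D) (lam 2) ![f, g] =
      multiIntegral (volume.restrict D) (cumulantIntensity lam 2) ![f, g] +
      (firstIntensity lam * ∫ x in D, f x) * (firstIntensity lam * ∫ x in D, g x) := by
  have : IsFiniteMeasure (volume.restrict D) := isFiniteMeasure_restrict.2 hD
  have key : lam 2 = cumulantIntensity lam 2 + fun _ => firstIntensity lam ^ 2 := funext hG.two
  rw [key, multiIntegral_add
    (hG.integrable_cumulant (m := 1) (by norm_num) (by norm_num) hD) (integrable_const _)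
    (by simp [Fin.forall_fin_two, hf, hg]) (by simp [Fin.forall_fin_two, hfb, hgb])]
  congr 1
  have h := multiIntegral_removeNth (μ := volume.restrict D) 0
    (fun _ : Fin 1 → Fin d → ℝ => firstIntensity lam ^ 2) ![f, g]
  have h' := multiIntegral_removeNth (μ := volume.restrict D) 0
    (fun _ : Fin 0 → Fin d → ℝ => firstIntensity lam ^ 2) ![g]
  rw [h]
  have : (fun j : Fin 1 => (![f, g] : Fin 2 → (Fin d → ℝ) → ℂ) (Fin.succAbove 0 j)) = ![g] := by
    ext j : 1; fin_cases j; rfl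
  rw [this, h', multiIntegral_const_zero]
  simp only [Matrix.cons_val]
  push_cast
  ring

/-- Of the terms with a singleton block, only the one isolating the argument of `f` survives, since
`g` and `h` have integral zero. -/
theorem CumulantBound.multiIntegral_three (hG : CumulantBound lam G) (hD : volume D ≠ ⊤)
    {f g h : (Fin d → ℝ) → ℂ} (hf : Measurable f) (hg : Measurable g) (hh : Measurable h)
    (hfb : ∃ M, ∀ x, ‖f x‖ ≤ M) (hgb : ∃ M, ∀ x, ‖g x‖ ≤ M) (hhb : ∃ M, ∀ x, ‖h x‖ ≤ M)
    (hg0 : ∫ x in D, g x = 0) (hh0 : ∫ x in D, h x = 0) :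
    multiIntegral (volume.restrict D) (lam 3) ![f, g, h] =
      multiIntegral (volume.restrict D) (cumulantIntensity lam 3) ![f, g, h] +
      (firstIntensity lam * ∫ x in D, f x) *
        multiIntegral (volume.restrict D) (cumulantIntensity lam 2) ![g, h] := by
  have : IsFiniteMeasure (volume.restrict D) := isFiniteMeasure_restrict.2 hD
  have h2 := fun i : Fin 3 => integrable_comp_removeNth i (hG.integrable_two hD)
  have hm : ∀ i, Measurable ((![f, g, h] : Fin 3 → (Fin d → ℝ) → ℂ) i) := by
    simp [Fin.forall_fin_succ, hf, hg, hh]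
  have hb : ∀ i, ∃ M, ∀ x, ‖(![f, g, h] : Fin 3 → (Fin d → ℝ) → ℂ) i x‖ ≤ M := by
    simp [Fin.forall_fin_succ, hfb, hgb, hhb]
  have i0 := (h2 0).const_mul (firstIntensity lam)
  have i1 : Integrable (fun x : Fin 3 → Fin d → ℝ => firstIntensity lam * lam 2 (Fin.removeNth 1 x)
      - 2 * firstIntensity lam ^ 3) (Measure.pi fun _ => volume.restrict D) :=
    ((h2 1).const_mul (firstIntensity lam)).sub (integrable_const (2 * firstIntensity lam ^ 3))
  have i2 := (h2 2).const_mul (firstIntensity lam)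
  have key : lam 3 = cumulantIntensity lam 3 +
      ((fun x => firstIntensity lam * lam 2 (Fin.removeNth 0 x)) +
      ((fun x => firstIntensity lam * lam 2 (Fin.removeNth 1 x) - 2 * firstIntensity lam ^ 3) +
      fun x => firstIntensity lam * lam 2 (Fin.removeNth 2 x))) := funext hG.three
  rw [key, multiIntegral_add
    (hG.integrable_cumulant (m := 2) (by norm_num) (by norm_num) hD) (i0.add (i1.add i2)) hm hb,
    multiIntegral_add i0 (i1.add i2) hm hb, multiIntegral_add i1 i2 hm hb,
    multiIntegral_removeNth 0 (fun y => firstIntensity lam * lam 2 y),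
    multiIntegral_removeNth 1 (fun y => firstIntensity lam * lam 2 y - 2 * firstIntensity lam ^ 3),
    multiIntegral_removeNth 2 (fun y => firstIntensity lam * lam 2 y)]
  have e : (fun j : Fin 2 => (![f, g, h] : Fin 3 → (Fin d → ℝ) → ℂ) (Fin.succAbove 0 j)) =
      ![g, h] := by
    ext j : 1; fin_cases j <;> rfl
  have hmul : multiIntegral (volume.restrict D) (fun y => firstIntensity lam * lam 2 y) ![g, h] =
      firstIntensity lam * multiIntegral (volume.restrict D) (lam 2) ![g, h] := by
    rw [multiIntegral, multiIntegral, ← integral_const_mul]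
    congr 1; ext x; push_cast; ring
  rw [e, hmul, hG.multiIntegral_two hD hg hh hgb hhb]
  simp only [Matrix.cons_val, hg0, hh0]
  ring

/-- For functions with integral zero, only the full block and the three pairings contribute. -/
theorem CumulantBound.multiIntegral_four (hG : CumulantBound lam G) (hD : volume D ≠ ⊤)
    {g : Fin 4 → (Fin d → ℝ) → ℂ} (hg : ∀ i, Measurable (g i)) (hb : ∀ i, ∃ M, ∀ x, ‖g i x‖ ≤ M)
    (h0 : ∀ i, ∫ x in D, g i x = 0) :
    multiIntegral (volume.restrict D) (lam 4) g =
      multiIntegral (volume.restrict D) (cumulantIntensity lam 4) g +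
      (multiIntegral (volume.restrict D) (cumulantIntensity lam 2) ![g 0, g 1] *
        multiIntegral (volume.restrict D) (cumulantIntensity lam 2) ![g 2, g 3] +
      (multiIntegral (volume.restrict D) (cumulantIntensity lam 2) ![g 0, g 2] *
        multiIntegral (volume.restrict D) (cumulantIntensity lam 2) ![g 1, g 3] +
      multiIntegral (volume.restrict D) (cumulantIntensity lam 2) ![g 0, g 3] *
        multiIntegral (volume.restrict D) (cumulantIntensity lam 2) ![g 1, g 2])) := by
  have : IsFiniteMeasure (volume.restrict D) := isFiniteMeasure_restrict.2 hD
  have h1 := fun i : Fin 4 => integrable_comp_removeNth i (hG.integrable_singletonPart hD i)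
  have h2 := hG.integrable_pairProduct hD
  have h4 := hG.integrable_cumulant (m := 3) (by norm_num) (by norm_num) hD
  have hz : ∀ i, multiIntegral (volume.restrict D)
      (fun x => singletonPart lam i (Fin.removeNth i x)) g = 0 := by
    intro i
    rw [multiIntegral_removeNth, h0, zero_mul]
  have hp : ∀ e, multiIntegral (volume.restrict D) (pairProduct lam e) g =
      multiIntegral (volume.restrict D) (cumulantIntensity lam 2)
        ![g (e (Sum.inl 0)), g (e (Sum.inl 1))] *
      multiIntegral (volume.restrict D) (cumulantIntensity lam 2)
        ![g (e (Sum.inr 0)), g (e (Sum.inr 1))] := by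
    intro e
    have hv : ∀ u : Fin 2 → (Fin d → ℝ) → ℂ, u = ![u 0, u 1] := fun u => by
      ext j : 1; fin_cases j <;> rfl
    have := multiIntegral_sum (μ := volume.restrict D) e (lam 2) (lam 2) g
    rw [hv fun j => g (e (Sum.inl j)), hv fun j => g (e (Sum.inr j)),
      hG.multiIntegral_two hD (hg _) (hg _) (hb _) (hb _),
      hG.multiIntegral_two hD (hg _) (hg _) (hb _) (hb _)] at this
    simp only [h0, mul_zero, add_zero] at this
    exact this
  have q3 := (h2 pairing₂).add (h2 pairing₃)
  have q2 := (h2 pairing₁).add q3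
  have key : lam 4 = cumulantIntensity lam 4 +
      ((fun x => singletonPart lam 0 (Fin.removeNth 0 x)) +
      ((fun x => singletonPart lam 1 (Fin.removeNth 1 x)) +
      ((fun x => singletonPart lam 2 (Fin.removeNth 2 x)) +
      ((fun x => singletonPart lam 3 (Fin.removeNth 3 x)) +
      (pairProduct lam pairing₁ + (pairProduct lam pairing₂ + pairProduct lam pairing₃)))))) :=
    funext hG.four
  rw [key, multiIntegral_add h4 ((h1 0).add ((h1 1).add ((h1 2).add ((h1 3).add q2))))
      hg hb,
    multiIntegral_add (h1 0) ((h1 1).add ((h1 2).add ((h1 3).add q2))) hg hb,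
    multiIntegral_add (h1 1) ((h1 2).add ((h1 3).add q2)) hg hb,
    multiIntegral_add (h1 2) ((h1 3).add q2) hg hb,
    multiIntegral_add (h1 3) q2 hg hb, multiIntegral_add (h2 pairing₁) q3 hg hb,
    multiIntegral_add (h2 pairing₂) (h2 pairing₃) hg hb, hz, hz, hz, hz, hp, hp, hp]
  simp only [zero_add]
  rfl

end expansion
end
/-! ### Second and fourth moments of centered linear statistics -/

section fourthMoment
variable {Ω : Type*} [MeasurableSpace Ω] {P : Measure Ω} [IsFiniteMeasure P] {d : ℕ}
  {X : Ω → Set (Fin d → ℝ)} (hX : IsSimplePointProcess X) {D : Set (Fin d → ℝ)}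
  (hD : Bornology.IsBounded D) (hDm : MeasurableSet D)
  {lam : (n : ℕ) → (Fin n → Fin d → ℝ) → ℝ} {G : ℝ} (hG : CumulantBound lam G)
  (hlam : ∀ n : ℕ, 1 ≤ n → n ≤ 4 → IsIntensityFunction P X n (lam n))

include hG hDm hlam in
theorem integral_factorialSum {k : ℕ} (h1 : 1 ≤ k) (h4 : k ≤ 4)
    {g : Fin k → (Fin d → ℝ) → ℂ} (hg : ∀ i, Measurable (g i)) (hb : ∀ i, ∃ M, ∀ x, ‖g i x‖ ≤ M) :
    Integrable (fun w => factorialSum (pointsIn hX hD w) g) P ∧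
      ∫ w, factorialSum (pointsIn hX hD w) g ∂P =
        multiIntegral (volume.restrict D) (lam k) g := by
  have hfin : volume D ≠ ⊤ := hD.measure_lt_top.ne
  refine integrable_factorialSum hX hD hDm (hlam k h1 h4) (integrable_prod_mul ?_ hg hb)
  interval_cases k
  · exact hG.integrable_one hfin
  · exact hG.integrable_two hfin
  · exact hG.integrable_three hfin
  · exact hG.integrable_four hfin

include hG hDm hlam in
/-- The covariance of two centered linear statistics. -/
theorem integral_sum_mul_sum {a b : (Fin d → ℝ) → ℂ} (ha : Measurable a) (hb : Measurable b)
    {M : ℝ} (haM : ∀ x, ‖a x‖ ≤ M) (hbM : ∀ x, ‖b x‖ ≤ M) (ha0 : ∫ x in D, a x = 0) :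
    Integrable (fun w => (∑ x ∈ pointsIn hX hD w, a x) * ∑ x ∈ pointsIn hX hD w, b x) P ∧
    ∫ w, (∑ x ∈ pointsIn hX hD w, a x) * ∑ x ∈ pointsIn hX hD w, b x ∂P = covForm lam D a b := by
  have hfin : volume D ≠ ⊤ := hD.measure_lt_top.ne
  have hM : 0 ≤ M := (norm_nonneg _).trans (haM 0)
  have habM : ∀ x, ‖(a * b) x‖ ≤ M * M := fun x => by
    rw [Pi.mul_apply, norm_mul]; gcongr <;> simp [haM, hbM]
  obtain ⟨i2, e2⟩ := integral_factorialSum hX hD hDm hG hlam (k := 2) (g := ![a, b])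
    (by norm_num) (by norm_num)
    (by simp [Fin.forall_fin_succ, ha, hb])
    (by rw [Fin.forall_fin_two]; exact ⟨⟨M, haM⟩, ⟨M, hbM⟩⟩)
  obtain ⟨i1, e1⟩ := integral_factorialSum hX hD hDm hG hlam (k := 1) (g := ![a * b])
    (by norm_num) (by norm_num)
    (by simp [ha.mul hb])
    (by intro i; fin_cases i; exact ⟨_, habM⟩)
  have key : (fun w => (∑ x ∈ pointsIn hX hD w, a x) * ∑ x ∈ pointsIn hX hD w, b x) =
      fun w => factorialSum (pointsIn hX hD w) ![a, b] +
        factorialSum (pointsIn hX hD w) ![a * b] := by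
    ext w
    rw [← factorialSum_one _ b, sum_mul_factorialSum_one]
  rw [key]
  refine ⟨i2.add i1, ?_⟩
  rw [integral_add i2 i1, e2, e1, hG.multiIntegral_one,
    hG.multiIntegral_two hfin ha hb ⟨M, haM⟩ ⟨M, hbM⟩, ha0, covForm]
  simp

include hG hDm hlam in
/-- The fourth mixed moment of centered linear statistics is the sum over the three pairings of
products of covariances, as for Gaussian variables, up to a term of the order of the volume. -/
theorem norm_integral_sum_mul_sum_mul_sum_mul_sum_sub_le {a b c e : (Fin d → ℝ) → ℂ}
    (ha : Measurable a) (hb : Measurable b) (hc : Measurable c) (he : Measurable e) {M : ℝ}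
    (haM : ∀ x, ‖a x‖ ≤ M) (hbM : ∀ x, ‖b x‖ ≤ M) (hcM : ∀ x, ‖c x‖ ≤ M) (heM : ∀ x, ‖e x‖ ≤ M)
    (ha0 : ∫ x in D, a x = 0) (hb0 : ∫ x in D, b x = 0) (hc0 : ∫ x in D, c x = 0)
    (he0 : ∫ x in D, e x = 0) :
    Integrable (fun w => (∑ x ∈ pointsIn hX hD w, a x) * ((∑ x ∈ pointsIn hX hD w, b x) *
      ((∑ x ∈ pointsIn hX hD w, c x) * ∑ x ∈ pointsIn hX hD w, e x))) P ∧
    ‖∫ w, (∑ x ∈ pointsIn hX hD w, a x) * ((∑ x ∈ pointsIn hX hD w, b x) *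
      ((∑ x ∈ pointsIn hX hD w, c x) * ∑ x ∈ pointsIn hX hD w, e x)) ∂P -
      (covForm lam D a b * covForm lam D c e + covForm lam D a c * covForm lam D b e +
        covForm lam D a e * covForm lam D b c)‖ ≤ 15 * (M ^ 4 * (G * volume.real D)) := by
  have hfin : volume D ≠ ⊤ := hD.measure_lt_top.ne
  have hM : 0 ≤ M := (norm_nonneg _).trans (haM 0)
  have mulM : ∀ {f g : (Fin d → ℝ) → ℂ} {p q : ℝ}, (∀ x, ‖f x‖ ≤ p) → (∀ x, ‖g x‖ ≤ q) →
      ∀ x, ‖(f * g) x‖ ≤ p * q := fun {f g p q} hf hg x => by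
    rw [Pi.mul_apply, norm_mul]
    exact mul_le_mul (hf x) (hg x) (norm_nonneg _) ((norm_nonneg _).trans (hf x))
  -- Bounds for the cumulant integrals of products of the four functions, each bounded by `M`.
  have K1 : ∀ {f : (Fin d → ℝ) → ℂ} {p : ℝ}, (∀ x, ‖f x‖ ≤ p) → p = M ^ 4 →
      ‖(firstIntensity lam : ℂ) * ∫ x in D, f x‖ ≤ M ^ 4 * (G * volume.real D) := by
    intro f p hf hp
    rw [norm_mul, Complex.norm_real, Real.norm_of_nonneg hG.nonneg]
    have := norm_setIntegral_le_of_norm_le_const (μ := volume) (s := D) hfin.lt_top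
      (fun x _ => hf x)
    rw [hp] at this
    calc _ ≤ G * (M ^ 4 * volume.real D) :=
          mul_le_mul hG.le this (norm_nonneg _) (hG.nonneg.trans hG.le)
      _ = _ := by ring
  have K2 : ∀ {f g : (Fin d → ℝ) → ℂ} {p q : ℝ}, (∀ x, ‖f x‖ ≤ p) → (∀ x, ‖g x‖ ≤ q) →
      p * q = M ^ 4 →
      ‖multiIntegral (volume.restrict D) (cumulantIntensity lam 2) ![f, g]‖ ≤
        M ^ 4 * (G * volume.real D) := by
    intro f g p q hf hg hp
    refine (norm_multiIntegral_le (M := ![p, q]) (hG.integrable_cumulant (m := 1) (by norm_num)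
      (by norm_num) hfin) (by rw [Fin.forall_fin_two]; exact ⟨hf, hg⟩)).trans ?_
    rw [Fin.prod_univ_two]
    simp only [Matrix.cons_val]
    rw [hp]
    gcongr
    exact hG.integral_abs_le (m := 1) (by norm_num) (by norm_num) hfin
  have K3 : ∀ {f g h : (Fin d → ℝ) → ℂ} {p q r : ℝ}, (∀ x, ‖f x‖ ≤ p) → (∀ x, ‖g x‖ ≤ q) →
      (∀ x, ‖h x‖ ≤ r) → p * q * r = M ^ 4 →
      ‖multiIntegral (volume.restrict D) (cumulantIntensity lam 3) ![f, g, h]‖ ≤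
        M ^ 4 * (G * volume.real D) := by
    intro f g h p q r hf hg hh hp
    refine (norm_multiIntegral_le (M := ![p, q, r]) (hG.integrable_cumulant (m := 2) (by norm_num)
      (by norm_num) hfin)
      (by rw [Fin.forall_fin_succ, Fin.forall_fin_two]; exact ⟨hf, hg, hh⟩)).trans ?_
    rw [Fin.prod_univ_three]
    simp only [Matrix.cons_val]
    rw [hp]
    gcongr
    exact hG.integral_abs_le (m := 2) (by norm_num) (by norm_num) hfin
  have K4 : ‖multiIntegral (volume.restrict D) (cumulantIntensity lam 4) ![a, b, c, e]‖ ≤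
        M ^ 4 * (G * volume.real D) := by
    refine (norm_multiIntegral_le (M := fun _ => M) (hG.integrable_cumulant (m := 3) (by norm_num)
      (by norm_num) hfin) (by simp [Fin.forall_fin_succ, haM, hbM, hcM, heM])).trans ?_
    rw [Fin.prod_const]
    gcongr
    exact hG.integral_abs_le (m := 3) (by norm_num) (by norm_num) hfin
  -- Expectations of the factorial sums. Only products of the given functions may have a nonzero
  -- integral. Two of them occur together only at order two, where `λ² ∫ ab ∫ ce` completes the
  -- product `C(a, b) C(c, e)`.
  have E1 : ∀ {f : (Fin d → ℝ) → ℂ} {p : ℝ}, Measurable f → (∀ x, ‖f x‖ ≤ p) →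
      Integrable (fun w => factorialSum (pointsIn hX hD w) ![f]) P ∧
      ∫ w, factorialSum (pointsIn hX hD w) ![f] ∂P = firstIntensity lam * ∫ x in D, f x := by
    intro f p hf hp
    rw [← hG.multiIntegral_one]
    exact integral_factorialSum hX hD hDm hG hlam (k := 1) (by norm_num) (by norm_num)
      (by rw [Fin.forall_fin_one]; exact hf) (by rw [Fin.forall_fin_one]; exact ⟨_, hp⟩)
  have E2 : ∀ {f g : (Fin d → ℝ) → ℂ} {p q : ℝ}, Measurable f → Measurable g → (∀ x, ‖f x‖ ≤ p) →
      (∀ x, ‖g x‖ ≤ q) →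
      Integrable (fun w => factorialSum (pointsIn hX hD w) ![f, g]) P ∧
      ∫ w, factorialSum (pointsIn hX hD w) ![f, g] ∂P =
        multiIntegral (volume.restrict D) (cumulantIntensity lam 2) ![f, g] +
      (firstIntensity lam * ∫ x in D, f x) * (firstIntensity lam * ∫ x in D, g x) := by
    intro f g p q hf hg hp hq
    rw [← hG.multiIntegral_two hfin hf hg ⟨_, hp⟩ ⟨_, hq⟩]
    exact integral_factorialSum hX hD hDm hG hlam (k := 2) (by norm_num) (by norm_num)
      (by rw [Fin.forall_fin_two]; exact ⟨hf, hg⟩)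
      (by rw [Fin.forall_fin_two]; exact ⟨⟨_, hp⟩, ⟨_, hq⟩⟩)
  have E3 : ∀ {f g h : (Fin d → ℝ) → ℂ} {p q r : ℝ}, Measurable f → Measurable g → Measurable h →
      (∀ x, ‖f x‖ ≤ p) → (∀ x, ‖g x‖ ≤ q) → (∀ x, ‖h x‖ ≤ r) → ∫ x in D, g x = 0 →
      ∫ x in D, h x = 0 →
      Integrable (fun w => factorialSum (pointsIn hX hD w) ![f, g, h]) P ∧
      ∫ w, factorialSum (pointsIn hX hD w) ![f, g, h] ∂P =
        multiIntegral (volume.restrict D) (cumulantIntensity lam 3) ![f, g, h] +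
      (firstIntensity lam * ∫ x in D, f x) *
        multiIntegral (volume.restrict D) (cumulantIntensity lam 2) ![g, h] := by
    intro f g h p q r hf hg hh hp hq hr hg0 hh0
    rw [← hG.multiIntegral_three hfin hf hg hh ⟨_, hp⟩ ⟨_, hq⟩ ⟨_, hr⟩ hg0 hh0]
    exact integral_factorialSum hX hD hDm hG hlam (k := 3) (by norm_num) (by norm_num)
      (by rw [Fin.forall_fin_succ, Fin.forall_fin_two]; exact ⟨hf, hg, hh⟩)
      (by rw [Fin.forall_fin_succ, Fin.forall_fin_two]; exact ⟨⟨_, hp⟩, ⟨_, hq⟩, ⟨_, hr⟩⟩)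
  have hm4 : ∀ i, Measurable ((![a, b, c, e] : Fin 4 → (Fin d → ℝ) → ℂ) i) := by
    simp [Fin.forall_fin_succ, ha, hb, hc, he]
  have hb4 : ∀ i, ∃ M, ∀ x, ‖(![a, b, c, e] : Fin 4 → (Fin d → ℝ) → ℂ) i x‖ ≤ M := by
    intro i; refine ⟨M, ?_⟩; revert i
    simp [Fin.forall_fin_succ, haM, hbM, hcM, heM]
  have h04 : ∀ i, ∫ x in D, (![a, b, c, e] : Fin 4 → (Fin d → ℝ) → ℂ) i x = 0 := by
    simp [Fin.forall_fin_succ, ha0, hb0, hc0, he0]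
  obtain ⟨i1, e1⟩ := integral_factorialSum hX hD hDm hG hlam (k := 4) (by norm_num) (by norm_num)
    hm4 hb4
  rw [hG.multiIntegral_four hfin hm4 hb4 h04] at e1
  simp only [Matrix.cons_val] at e1
  obtain ⟨i2, e2⟩ := E3 (ha.mul hb) hc he (mulM haM hbM) hcM heM hc0 he0
  obtain ⟨i3, e3⟩ := E3 (ha.mul hc) hb he (mulM haM hcM) hbM heM hb0 he0
  obtain ⟨i4, e4⟩ := E3 (ha.mul he) hb hc (mulM haM heM) hbM hcM hb0 hc0
  obtain ⟨i5, e5⟩ := E3 (hb.mul hc) ha he (mulM hbM hcM) haM heM ha0 he0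
  obtain ⟨i6, e6⟩ := E3 (hb.mul he) ha hc (mulM hbM heM) haM hcM ha0 hc0
  obtain ⟨i7, e7⟩ := E3 (hc.mul he) ha hb (mulM hcM heM) haM hbM ha0 hb0
  obtain ⟨i8, e8⟩ := E2 (ha.mul (hb.mul hc)) he (mulM haM (mulM hbM hcM)) heM
  obtain ⟨i9, e9⟩ := E2 hc (ha.mul (hb.mul he)) hcM (mulM haM (mulM hbM heM))
  obtain ⟨i10, e10⟩ := E2 hb (ha.mul (hc.mul he)) hbM (mulM haM (mulM hcM heM))
  obtain ⟨i11, e11⟩ := E2 ha (hb.mul (hc.mul he)) haM (mulM hbM (mulM hcM heM))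
  obtain ⟨i12, e12⟩ := E2 (hb.mul hc) (ha.mul he) (mulM hbM hcM) (mulM haM heM)
  obtain ⟨i13, e13⟩ := E2 (ha.mul hc) (hb.mul he) (mulM haM hcM) (mulM hbM heM)
  obtain ⟨i14, e14⟩ := E2 (ha.mul hb) (hc.mul he) (mulM haM hbM) (mulM hcM heM)
  obtain ⟨i15, e15⟩ := E1 (ha.mul (hb.mul (hc.mul he))) (mulM haM (mulM hbM (mulM hcM heM)))
  rw [he0] at e8
  rw [hc0] at e9
  rw [hb0] at e10
  rw [ha0] at e11
  have hswap : ∀ (S : Finset (Fin d → ℝ)) (f g h : (Fin d → ℝ) → ℂ),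
      factorialSum S ![g, f, h] = factorialSum S ![f, g, h] := by
    intro S f g h
    rw [← factorialSum_comp_perm S ![f, g, h] (Equiv.swap 0 1)]
    congr 1; ext j : 1; fin_cases j <;> rfl
  have hrot : ∀ (S : Finset (Fin d → ℝ)) (f g h : (Fin d → ℝ) → ℂ),
      factorialSum S ![g, h, f] = factorialSum S ![f, g, h] := by
    intro S f g h
    rw [← factorialSum_comp_perm S ![f, g, h] (finRotate 3)]
    congr 1; ext j : 1; fin_cases j <;> rfl
  have key : (fun w => (∑ x ∈ pointsIn hX hD w, a x) * ((∑ x ∈ pointsIn hX hD w, b x) *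
      ((∑ x ∈ pointsIn hX hD w, c x) * ∑ x ∈ pointsIn hX hD w, e x))) =
      (fun w => factorialSum (pointsIn hX hD w) ![a, b, c, e]) +
      (fun w => factorialSum (pointsIn hX hD w) ![a * b, c, e]) +
      (fun w => factorialSum (pointsIn hX hD w) ![a * c, b, e]) +
      (fun w => factorialSum (pointsIn hX hD w) ![a * e, b, c]) +
      (fun w => factorialSum (pointsIn hX hD w) ![b * c, a, e]) +
      (fun w => factorialSum (pointsIn hX hD w) ![b * e, a, c]) +
      (fun w => factorialSum (pointsIn hX hD w) ![c * e, a, b]) +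
      (fun w => factorialSum (pointsIn hX hD w) ![a * (b * c), e]) +
      (fun w => factorialSum (pointsIn hX hD w) ![c, a * (b * e)]) +
      (fun w => factorialSum (pointsIn hX hD w) ![b, a * (c * e)]) +
      (fun w => factorialSum (pointsIn hX hD w) ![a, b * (c * e)]) +
      (fun w => factorialSum (pointsIn hX hD w) ![b * c, a * e]) +
      (fun w => factorialSum (pointsIn hX hD w) ![a * c, b * e]) +
      (fun w => factorialSum (pointsIn hX hD w) ![a * b, c * e]) +
      (fun w => factorialSum (pointsIn hX hD w) ![a * (b * (c * e))]) := by
    ext w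
    rw [sum_mul_sum_mul_sum_mul_sum]
    simp only [Pi.add_apply]
    rw [hswap _ (a * c), hrot _ (a * e), hswap _ (b * c), hrot _ (b * e), hrot _ (c * e)]
    ring
  rw [key]
  have j2 := i1.add i2
  have j3 := j2.add i3
  have j4 := j3.add i4
  have j5 := j4.add i5
  have j6 := j5.add i6
  have j7 := j6.add i7
  have j8 := j7.add i8
  have j9 := j8.add i9
  have j10 := j9.add i10
  have j11 := j10.add i11
  have j12 := j11.add i12
  have j13 := j12.add i13
  have j14 := j13.add i14
  have j15 := j14.add i15
  refine ⟨j15, ?_⟩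
  rw [integral_add' j14 i15, integral_add' j13 i14, integral_add' j12 i13, integral_add' j11 i12,
    integral_add' j10 i11, integral_add' j9 i10, integral_add' j8 i9, integral_add' j7 i8,
    integral_add' j6 i7, integral_add' j5 i6, integral_add' j4 i5, integral_add' j3 i4,
    integral_add' j2 i3, integral_add' i1 i2, e1, e2, e3, e4, e5, e6, e7, e8, e9, e10, e11, e12,
    e13, e14, e15]
  have hbound := norm_add_le_of_le (norm_add_le_of_le (norm_add_le_of_le (norm_add_le_of_le
    (norm_add_le_of_le (norm_add_le_of_le (norm_add_le_of_le (norm_add_le_of_le (norm_add_le_of_le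
    (norm_add_le_of_le (norm_add_le_of_le (norm_add_le_of_le (norm_add_le_of_le (norm_add_le_of_le
    K4 (K3 (mulM haM hbM) hcM heM (by ring))) (K3 (mulM haM hcM) hbM heM (by ring)))
    (K3 (mulM haM heM) hbM hcM (by ring))) (K3 (mulM hbM hcM) haM heM (by ring)))
    (K3 (mulM hbM heM) haM hcM (by ring))) (K3 (mulM hcM heM) haM hbM (by ring)))
    (K2 (mulM haM (mulM hbM hcM)) heM (by ring))) (K2 hcM (mulM haM (mulM hbM heM)) (by ring)))
    (K2 hbM (mulM haM (mulM hcM heM)) (by ring))) (K2 haM (mulM hbM (mulM hcM heM)) (by ring)))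
    (K2 (mulM hbM hcM) (mulM haM heM) (by ring))) (K2 (mulM haM hcM) (mulM hbM heM) (by ring)))
    (K2 (mulM haM hbM) (mulM hcM heM) (by ring)))
    (K1 (mulM haM (mulM hbM (mulM hcM heM))) (by ring))
  refine (le_of_eq ?_).trans (hbound.trans (le_of_eq (by ring)))
  congr 1
  simp only [covForm, Pi.mul_apply]
  ring

end fourthMoment
/-! ### The covariance operator of a second-order stationary process -/

section stationary
variable {Ω : Type*} [MeasurableSpace Ω] {P : Measure Ω} {d : ℕ} {X : Ω → Set (Fin d → ℝ)}
  {lam : (n : ℕ) → (Fin n → Fin d → ℝ) → ℝ}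

theorem measurable_cumulantIntensity
    (hlam : ∀ n : ℕ, 1 ≤ n → n ≤ 4 → Measurable (lam n)) {n : ℕ} (hn : n ≤ 4) :
    Measurable (cumulantIntensity lam n) := by
  refine Finset.measurable_sum _ fun p _ => Measurable.const_mul ?_ _
  refine Finset.measurable_prod _ fun B hB => ?_
  refine (hlam B.card (Finset.card_pos.2 (p.nonempty_of_mem_parts hB)) ?_).comp
    (measurable_pi_lambda _ fun j => measurable_pi_apply _)
  exact ((Finset.card_le_univ B).trans_eq (Fintype.card_fin n)).trans hn

theorem exists_cumulantBound
    (hlam : ∀ n : ℕ, 1 ≤ n → n ≤ 4 → IsIntensityFunction P X n (lam n))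
    (hstat : IsStationaryOfOrder 2 lam) (hcum : CumulantsIntegrable 4 lam) :
    ∃ G, CumulantBound lam G := by
  let S : ℕ → ENNReal := fun m => ⨆ y : Fin d → ℝ, ∫⁻ u : Fin m → Fin d → ℝ,
      ‖cumulantIntensity lam (m + 1) (Fin.snoc u y)‖ₑ
  have hS : ∀ m, 1 ≤ m → m + 1 ≤ 4 → S m ≠ ⊤ := fun m h1 h4 => (hcum m h1 h4).ne
  refine ⟨firstIntensity lam + ∑ m ∈ Finset.Icc 1 3, (S m).toReal, ?_, ?_, ?_, ?_, ?_⟩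
  · intro x
    rw [hstat 0 (by norm_num) x, firstIntensity, reduced]
    congr 1
  · exact (hlam 1 le_rfl (by norm_num)).nonneg _
  · exact le_add_of_nonneg_right (Finset.sum_nonneg fun _ _ => ENNReal.toReal_nonneg)
  · exact fun m _ h4 => measurable_cumulantIntensity (fun n h1 h4 => (hlam n h1 h4).measurable) h4
  · intro m h1 h4 y
    have h5 : (S m).toReal ≤ firstIntensity lam + ∑ m ∈ Finset.Icc 1 3, (S m).toReal :=
      (Finset.single_le_sum (f := fun m => (S m).toReal) (fun _ _ => ENNReal.toReal_nonneg)
        (Finset.mem_Icc.2 ⟨h1, by omega⟩)).trans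
        (le_add_of_nonneg_left ((hlam 1 le_rfl (by norm_num)).nonneg _))
    refine le_trans ?_ (ENNReal.ofReal_le_ofReal h5)
    rw [ENNReal.ofReal_toReal (hS m h1 h4)]
    exact le_iSup (fun y : Fin d → ℝ => ∫⁻ u : Fin m → Fin d → ℝ,
      ‖cumulantIntensity lam (m + 1) (Fin.snoc u y)‖ₑ) y

theorem cumulantIntensity_two_eq {G : ℝ} (hG : CumulantBound lam G)
    (hstat : IsStationaryOfOrder 2 lam) (x : Fin 2 → Fin d → ℝ) :
    cumulantIntensity lam 2 x = cumulant2Red lam (x 0 - x 1) := by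
  rw [cumulant2Red, reduced, cumulantIntensity_two, cumulantIntensity_two]
  simp only [hG.const]
  congr 1
  rw [hstat 1 le_rfl x, reduced]
  congr 1
  ext i : 1
  fin_cases i <;> rfl

theorem lintegral_cumulant2Red_le {G : ℝ} (hG : CumulantBound lam G) :
    ∫⁻ u, ‖cumulant2Red lam u‖ₑ ≤ ENNReal.ofReal G := by
  have h := hG.lintegral_le 1 le_rfl (by norm_num) 0
  have h' := (volume_preserving_funUnique (Fin 1) (Fin d → ℝ)).symm.lintegral_comp_emb
    (MeasurableEquiv.measurableEmbedding _)
    (fun u => ‖cumulantIntensity lam (1 + 1) (Fin.snoc u 0)‖ₑ)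
  exact (h'.trans_le h)

theorem measurable_cumulant2Red {G : ℝ} (hG : CumulantBound lam G) :
    Measurable (cumulant2Red lam) := by
  refine (hG.measurable 1 le_rfl (by norm_num)).comp (measurable_pi_lambda _ fun i => ?_)
  fin_cases i
  · exact measurable_id
  · exact measurable_const

theorem integrable_cumulant2Red {G : ℝ} (hG : CumulantBound lam G) :
    Integrable (cumulant2Red lam) :=
  ⟨(measurable_cumulant2Red hG).aestronglyMeasurable,
    (lintegral_cumulant2Red_le hG).trans_lt ENNReal.ofReal_lt_top⟩

theorem integral_abs_cumulant2Red_le {G : ℝ} (hG : CumulantBound lam G) :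
    ∫ u, |cumulant2Red lam u| ≤ G := by
  simp only [← Real.norm_eq_abs]
  rw [integral_norm_eq_lintegral_enorm (measurable_cumulant2Red hG).aestronglyMeasurable]
  have := ENNReal.toReal_mono ENNReal.ofReal_ne_top (lintegral_cumulant2Red_le hG)
  rwa [ENNReal.toReal_ofReal (hG.nonneg.trans hG.le)] at this

variable (lam) in
/-- The covariance operator `f ↦ λ f + ∫ f(· + u) γ_{2,red}(u) du`. -/
noncomputable def covOp (f : (Fin d → ℝ) → ℂ) (t : Fin d → ℝ) : ℂ :=
  firstIntensity lam * f t + ∫ u, f (t + u) * (cumulant2Red lam u : ℂ)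

theorem norm_covOp_le {G : ℝ} (hG : CumulantBound lam G) {f : (Fin d → ℝ) → ℂ} {M : ℝ}
    (hM : ∀ x, ‖f x‖ ≤ M) (t : Fin d → ℝ) : ‖covOp lam f t‖ ≤ 2 * G * M := by
  have hM0 : 0 ≤ M := (norm_nonneg _).trans (hM 0)
  have h1 : ‖(firstIntensity lam : ℂ) * f t‖ ≤ G * M := by
    rw [norm_mul, Complex.norm_real, Real.norm_of_nonneg hG.nonneg]
    exact mul_le_mul hG.le (hM t) (norm_nonneg _) (hG.nonneg.trans hG.le)
  have h2 : ‖∫ u, f (t + u) * (cumulant2Red lam u : ℂ)‖ ≤ M * G := by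
    refine (norm_integral_le_of_norm_le ((integrable_cumulant2Red hG).abs.const_mul M)
      (ae_of_all _ fun u => ?_)).trans ?_
    · rw [norm_mul, Complex.norm_real, Real.norm_eq_abs]
      exact mul_le_mul_of_nonneg_right (hM _) (abs_nonneg _)
    · rw [integral_const_mul]
      exact mul_le_mul_of_nonneg_left (integral_abs_cumulant2Red_le hG) hM0
  calc _ ≤ G * M + M * G := norm_add_le_of_le h1 h2
    _ = _ := by ring

theorem measurable_covOp {G : ℝ} (hG : CumulantBound lam G) {f : (Fin d → ℝ) → ℂ}
    (hf : Measurable f) : Measurable (covOp lam f) := by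
  refine (hf.const_mul _).add ?_
  have h : Measurable fun z : (Fin d → ℝ) × (Fin d → ℝ) =>
      f (z.1 + z.2) * (cumulant2Red lam z.2 : ℂ) :=
    (hf.comp (measurable_fst.add measurable_snd)).mul
      (Complex.measurable_ofReal.comp ((measurable_cumulant2Red hG).comp measurable_snd))
  exact h.stronglyMeasurable.integral_prod_right'.measurable

theorem covForm_eq_integral_covOp {G : ℝ} (hG : CumulantBound lam G)
    (hstat : IsStationaryOfOrder 2 lam) {D : Set (Fin d → ℝ)} (hD : volume D ≠ ⊤)
    {f g : (Fin d → ℝ) → ℂ} (hf : Measurable f) (hg : Measurable g)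
    {M N : ℝ} (hfM : ∀ x, ‖f x‖ ≤ M) (hgN : ∀ x, ‖g x‖ ≤ N) (hf0 : ∀ x, x ∉ D → f x = 0) :
    covForm lam D f g = ∫ t in D, covOp lam f t * g t := by
  have : IsFiniteMeasure (volume.restrict D) := isFiniteMeasure_restrict.2 hD
  have hint : Integrable (fun x : Fin 2 → Fin d → ℝ =>
      (∏ i, (![f, g] : Fin 2 → (Fin d → ℝ) → ℂ) i (x i)) * (cumulantIntensity lam 2 x : ℂ))
      (Measure.pi fun _ => volume.restrict D) :=
    integrable_prod_mul (hG.integrable_cumulant (m := 1) (by norm_num) (by norm_num) hD)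
      (by rw [Fin.forall_fin_two]; exact ⟨hf, hg⟩)
      (by rw [Fin.forall_fin_two]; exact ⟨⟨M, hfM⟩, ⟨N, hgN⟩⟩)
  have hmp := (measurePreserving_finTwoArrow (volume.restrict D)).symm
  have hint' := (hmp.integrable_comp_emb (MeasurableEquiv.measurableEmbedding _)).2 hint
  have e1 : multiIntegral (volume.restrict D) (cumulantIntensity lam 2) ![f, g] =
      ∫ t in D, (∫ u, f (t + u) * (cumulant2Red lam u : ℂ)) * g t := by
    rw [multiIntegral, ← hmp.integral_comp (MeasurableEquiv.measurableEmbedding _),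
      integral_prod_symm (fun z => (∏ i, (![f, g] : Fin 2 → (Fin d → ℝ) → ℂ) i
        (MeasurableEquiv.finTwoArrow.symm z i)) *
        (cumulantIntensity lam 2 (MeasurableEquiv.finTwoArrow.symm z) : ℂ)) hint']
    refine integral_congr_ae (ae_of_all _ fun t => ?_)
    have e2 : ∀ s, (∏ i, (![f, g] : Fin 2 → (Fin d → ℝ) → ℂ) i
        (MeasurableEquiv.finTwoArrow.symm (s, t) i)) *
        (cumulantIntensity lam 2 (MeasurableEquiv.finTwoArrow.symm (s, t)) : ℂ) =
        f s * (cumulant2Red lam (s - t) : ℂ) * g t := by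
      intro s
      rw [cumulantIntensity_two_eq hG hstat, Fin.prod_univ_two]
      simp [MeasurableEquiv.finTwoArrow]
      ring
    simp only [e2]
    rw [integral_mul_const, setIntegral_eq_integral_of_forall_compl_eq_zero
      (fun s hs => by rw [hf0 s hs, zero_mul]),
      ← integral_add_left_eq_self (fun s => f s * (cumulant2Red lam (s - t) : ℂ)) t]
    simp
  rw [covForm, e1, ← integral_const_mul, ← integral_add]
  · refine integral_congr_ae (ae_of_all _ fun t => ?_)
    simp only [covOp]; ring
  · have hm : Measurable fun z : (Fin d → ℝ) × (Fin d → ℝ) =>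
      f (z.1 + z.2) * (cumulant2Red lam z.2 : ℂ) :=
      (hf.comp (measurable_fst.add measurable_snd)).mul
      (Complex.measurable_ofReal.comp ((measurable_cumulant2Red hG).comp measurable_snd))
    refine Integrable.of_bound (C := M * G * N)
      (hm.stronglyMeasurable.integral_prod_right'.measurable.mul hg).aestronglyMeasurable
      (ae_of_all _ fun t => ?_)
    have h2 : ‖∫ u, f (t + u) * (cumulant2Red lam u : ℂ)‖ ≤ M * G := by
      refine (norm_integral_le_of_norm_le ((integrable_cumulant2Red hG).abs.const_mul M)
        (ae_of_all _ fun u => ?_)).trans ?_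
      · rw [norm_mul, Complex.norm_real, Real.norm_eq_abs]
        exact mul_le_mul_of_nonneg_right (hfM _) (abs_nonneg _)
      · rw [integral_const_mul]
        exact mul_le_mul_of_nonneg_left (integral_abs_cumulant2Red_le hG)
          ((norm_nonneg _).trans (hfM 0))
    rw [norm_mul]
    exact mul_le_mul h2 (hgN t) (norm_nonneg _) ((norm_nonneg _).trans h2)
  · refine Integrable.of_bound (C := G * (M * N))
      ((hf.mul hg).const_mul _).aestronglyMeasurable (ae_of_all _ fun t => ?_)
    rw [norm_mul, norm_mul, Complex.norm_real, Real.norm_of_nonneg hG.nonneg]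
    exact mul_le_mul hG.le (mul_le_mul (hfM t) (hgN t) (norm_nonneg _)
      ((norm_nonneg _).trans (hfM 0))) (by positivity) (hG.nonneg.trans hG.le)

end stationary
/-! ### Characters and a Gaussian-weighted Bessel inequality -/

section expNeg
variable {d : ℕ}

theorem continuous_expNeg : Continuous fun z : (Fin d → ℝ) × (Fin d → ℝ) => expNeg z.1 z.2 := by
  unfold expNeg dotProduct
  fun_prop

theorem norm_expNeg (x ω : Fin d → ℝ) : ‖expNeg x ω‖ = 1 := by
  have : -Complex.I * ((x ⬝ᵥ ω : ℝ) : ℂ) = ((-(x ⬝ᵥ ω) : ℝ) : ℂ) * Complex.I := by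
    push_cast; ring
  rw [expNeg, this, Complex.norm_exp_ofReal_mul_I]

theorem expNeg_add_right (x ω θ : Fin d → ℝ) : expNeg x (ω + θ) = expNeg x ω * expNeg x θ := by
  rw [expNeg, expNeg, expNeg, ← Complex.exp_add, dotProduct_add]
  push_cast; ring_nf

theorem expNeg_add_left (x y ω : Fin d → ℝ) : expNeg (x + y) ω = expNeg x ω * expNeg y ω := by
  rw [expNeg, expNeg, expNeg, ← Complex.exp_add, add_dotProduct]
  push_cast; ring_nf

theorem expNeg_mul_conj (x y ω : Fin d → ℝ) :
    expNeg x ω * (starRingEnd ℂ) (expNeg y ω) = expNeg (x - y) ω := by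
  rw [expNeg, expNeg, expNeg, ← Complex.exp_conj, ← Complex.exp_add, sub_dotProduct]
  simp; ring_nf

theorem measurable_expNeg_left (ω : Fin d → ℝ) : Measurable fun x => expNeg x ω :=
  (continuous_expNeg.comp (continuous_id.prodMk continuous_const)).measurable

end expNeg

section gaussian
variable {d : ℕ}

/-- The unnormalized Gaussian `exp(-a |x|²)`. -/
noncomputable def gaussFun (a : ℝ) (x : Fin d → ℝ) : ℝ := Real.exp (-a * ∑ i, x i ^ 2)

theorem gaussFun_nonneg (a : ℝ) (x : Fin d → ℝ) : 0 ≤ gaussFun a x := Real.exp_nonneg _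

theorem gaussFun_eq_prod (a : ℝ) (x : Fin d → ℝ) :
    gaussFun a x = ∏ i, Real.exp (-a * x i ^ 2) := by
  rw [gaussFun, Finset.mul_sum, Real.exp_sum]

theorem continuous_gaussFun (a : ℝ) : Continuous (gaussFun a : (Fin d → ℝ) → ℝ) := by
  unfold gaussFun; fun_prop

theorem integrable_gaussFun {a : ℝ} (ha : 0 < a) :
    Integrable (gaussFun a : (Fin d → ℝ) → ℝ) := by
  simp only [funext (gaussFun_eq_prod a)]
  exact Integrable.fintype_prod (f := fun _ y => Real.exp (-a * y ^ 2))
    fun _ => integrable_exp_neg_mul_sq ha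

theorem integral_gaussFun (a : ℝ) :
    ∫ x : Fin d → ℝ, gaussFun a x = Real.sqrt (Real.pi / a) ^ d := by
  simp only [gaussFun_eq_prod]
  rw [integral_fintype_prod_volume_eq_prod (f := fun _ (y : ℝ) => Real.exp (-a * y ^ 2))]
  simp only [integral_gaussian, Finset.prod_const, Finset.card_univ, Fintype.card_fin]

/-- The Fourier transform of a translated Gaussian has a Gaussian as its modulus. -/
theorem norm_integral_gaussFun_mul_expNeg {a : ℝ} (ha : 0 < a) (ω u : Fin d → ℝ) :
    ‖∫ θ, (gaussFun a (ω - θ) : ℂ) * expNeg u θ‖ =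
      Real.sqrt (Real.pi / a) ^ d * gaussFun (4 * a)⁻¹ u := by
  have h1 : ∫ θ, (gaussFun a (ω - θ) : ℂ) * expNeg u θ =
      expNeg u ω * ∫ θ, (gaussFun a θ : ℂ) * expNeg u θ := by
    rw [← integral_add_left_eq_self _ ω, ← integral_const_mul]
    refine integral_congr_ae (ae_of_all _ fun θ => ?_)
    have : gaussFun a (ω - (ω + θ)) = gaussFun a θ := by simp [gaussFun]
    simp only [this, expNeg_add_right]; ring
  have h2 : ∫ θ, (gaussFun a θ : ℂ) * expNeg u θ =
      (Real.pi / a : ℂ) ^ (Fintype.card (Fin d) / 2 : ℂ) *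
        Complex.exp ((∑ i, (-Complex.I * (u i : ℂ)) ^ 2) / (4 * a)) := by
    rw [← GaussianFourier.integral_cexp_neg_mul_sum_add (by simpa using ha)]
    refine integral_congr_ae (ae_of_all _ fun θ => ?_)
    simp only [gaussFun, expNeg, dotProduct]
    rw [Complex.ofReal_exp, ← Complex.exp_add]
    congr 1
    push_cast
    rw [Finset.mul_sum (a := -Complex.I)]
    simp only [mul_assoc]
  have h3 : ((∑ i, (-Complex.I * (u i : ℂ)) ^ 2) / (4 * a) : ℂ) =
      ((-(4 * a)⁻¹ * ∑ i, u i ^ 2 : ℝ) : ℂ) := by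
    push_cast
    simp only [mul_pow, neg_sq, Complex.I_sq, ← Finset.mul_sum]
    ring
  rw [h1, h2, h3, norm_mul, norm_mul, norm_expNeg, one_mul, ← Complex.ofReal_exp,
    Complex.norm_real, Real.norm_of_nonneg (Real.exp_nonneg _), gaussFun]
  congr 1
  rw [← Complex.ofReal_div, Complex.norm_cpow_eq_rpow_re_of_pos (by positivity),
    Real.sqrt_eq_rpow, ← Real.rpow_natCast, ← Real.rpow_mul (by positivity)]
  congr 1
  simp
  ring

/-- A weighted form of Bessel's inequality: the squared Fourier transform of a function `v` on `D`,
integrated against a Gaussian, is at most `(2π)^d ‖v‖_∞² |D|`, whatever the width of the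
Gaussian. -/
theorem integral_gaussFun_mul_norm_sq_le {a : ℝ} (ha : 0 < a) (ω : Fin d → ℝ)
    {D : Set (Fin d → ℝ)} (hD : volume D ≠ ⊤) {v : (Fin d → ℝ) → ℂ} (hv : Measurable v) {B : ℝ}
    (hB : ∀ x, ‖v x‖ ≤ B) :
    ∫ θ, gaussFun a (ω - θ) * ‖∫ t in D, v t * expNeg t θ‖ ^ 2 ≤
      (2 * Real.pi) ^ d * (B ^ 2 * volume.real D) := by
  have : IsFiniteMeasure (volume.restrict D) := isFiniteMeasure_restrict.2 hD
  set μ := (volume : Measure (Fin d → ℝ)).restrict D with hμ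
  have hB0 : 0 ≤ B := (norm_nonneg _).trans (hB 0)
  let k : (Fin d → ℝ) × (Fin d → ℝ) → ℂ := fun z => v z.1 * (starRingEnd ℂ) (v z.2)
  have hk : Measurable k := (hv.comp measurable_fst).mul
    (Complex.continuous_conj.measurable.comp (hv.comp measurable_snd))
  have hkB : ∀ z, ‖k z‖ ≤ B ^ 2 := fun z => by
    simp only [k, norm_mul, RCLike.norm_conj]
    rw [sq]; gcongr <;> exact hB _
  have hsq : ∀ θ, ((‖∫ t, v t * expNeg t θ ∂μ‖ ^ 2 : ℝ) : ℂ) =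
      ∫ z, k z * expNeg (z.1 - z.2) θ ∂(μ.prod μ) := by
    intro θ
    have h1 : ∀ z : (Fin d → ℝ) × (Fin d → ℝ), k z * expNeg (z.1 - z.2) θ =
        (v z.1 * expNeg z.1 θ) * (starRingEnd ℂ) (v z.2 * expNeg z.2 θ) := by
      intro z
      rw [← expNeg_mul_conj, map_mul]; simp only [k]; ring
    simp only [h1]
    rw [integral_prod_mul (fun t => v t * expNeg t θ)
      (fun s => (starRingEnd ℂ) (v s * expNeg s θ)), integral_conj, Complex.mul_conj,
      Complex.normSq_eq_norm_sq]
  have hgi : Integrable (fun θ : Fin d → ℝ => gaussFun a (ω - θ)) :=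
    (integrable_gaussFun ha).comp_sub_left ω
  have hint : Integrable (Function.uncurry fun (θ : Fin d → ℝ) (z : (Fin d → ℝ) × (Fin d → ℝ)) =>
      (gaussFun a (ω - θ) : ℂ) * (k z * expNeg (z.1 - z.2) θ)) (volume.prod (μ.prod μ)) := by
    have h1 := (hgi.ofReal (𝕜 := ℂ)).comp_fst (μ.prod μ)
    refine (h1.bdd_mul (c := B ^ 2) (f := fun q : (Fin d → ℝ) × (Fin d → ℝ) × (Fin d → ℝ) =>
      k q.2 * expNeg (q.2.1 - q.2.2) q.1) ?_ (ae_of_all _ fun q => ?_)).congr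
      (ae_of_all _ fun q => ?_)
    · have h2 : Continuous fun q : (Fin d → ℝ) × (Fin d → ℝ) × (Fin d → ℝ) =>
          expNeg (q.2.1 - q.2.2) q.1 :=
        continuous_expNeg.comp (((continuous_fst.comp continuous_snd).sub
          (continuous_snd.comp continuous_snd)).prodMk continuous_fst)
      exact ((hk.comp measurable_snd).mul h2.measurable).aestronglyMeasurable
    · rw [norm_mul, norm_expNeg, mul_one]; exact hkB _
    · simp only [Function.uncurry]; exact mul_comm _ _
  have hgc : ∀ z : (Fin d → ℝ) × (Fin d → ℝ),
      ‖∫ θ, (gaussFun a (ω - θ) : ℂ) * (k z * expNeg (z.1 - z.2) θ)‖ ≤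
      B ^ 2 * (Real.sqrt (Real.pi / a) ^ d * gaussFun (4 * a)⁻¹ (z.1 - z.2)) := by
    intro z
    have h1 : ∀ θ, (gaussFun a (ω - θ) : ℂ) * (k z * expNeg (z.1 - z.2) θ) =
        k z * ((gaussFun a (ω - θ) : ℂ) * expNeg (z.1 - z.2) θ) := fun θ => by ring
    simp only [h1]
    rw [integral_const_mul, norm_mul, norm_integral_gaussFun_mul_expNeg ha]
    refine mul_le_mul_of_nonneg_right (hkB z) ?_
    have := gaussFun_nonneg (4 * a)⁻¹ (z.1 - z.2)
    positivity
  have hpos : 0 < (4 * a)⁻¹ := by positivity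
  have hgi2 : ∀ t : Fin d → ℝ, Integrable fun s => gaussFun (4 * a)⁻¹ (t - s) :=
    fun t => (integrable_gaussFun hpos).comp_sub_left t
  have hle1 : ∀ x : Fin d → ℝ, gaussFun (4 * a)⁻¹ x ≤ 1 := fun x => by
    rw [gaussFun, Real.exp_le_one_iff]
    have : 0 ≤ ∑ i, x i ^ 2 := Finset.sum_nonneg fun _ _ => sq_nonneg _
    nlinarith
  have hint2 : Integrable (fun z : (Fin d → ℝ) × (Fin d → ℝ) => gaussFun (4 * a)⁻¹ (z.1 - z.2))
      (μ.prod μ) := by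
    refine Integrable.of_bound (C := 1) ((continuous_gaussFun _).comp
      (continuous_fst.sub continuous_snd)).aestronglyMeasurable (ae_of_all _ fun z => ?_)
    change ‖gaussFun _ (z.1 - z.2)‖ ≤ 1
    rw [Real.norm_of_nonneg (gaussFun_nonneg _ _)]
    exact hle1 _
  have hint3 : Integrable (fun z : (Fin d → ℝ) × (Fin d → ℝ) =>
      B ^ 2 * (Real.sqrt (Real.pi / a) ^ d * gaussFun (4 * a)⁻¹ (z.1 - z.2))) (μ.prod μ) :=
    (hint2.const_mul _).const_mul _
  have hswap : ((∫ θ, gaussFun a (ω - θ) * ‖∫ t, v t * expNeg t θ ∂μ‖ ^ 2 : ℝ) : ℂ) =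
      ∫ z, (∫ θ, (gaussFun a (ω - θ) : ℂ) * (k z * expNeg (z.1 - z.2) θ)) ∂(μ.prod μ) := by
    rw [← integral_integral_swap hint, ← integral_complex_ofReal]
    refine integral_congr_ae (ae_of_all _ fun θ => ?_)
    simp only
    rw [integral_const_mul, ← hsq]
    push_cast; rfl
  have hnorm : ∫ θ, gaussFun a (ω - θ) * ‖∫ t, v t * expNeg t θ ∂μ‖ ^ 2 ≤
      ∫ z, B ^ 2 * (Real.sqrt (Real.pi / a) ^ d * gaussFun (4 * a)⁻¹ (z.1 - z.2)) ∂(μ.prod μ) := by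
    refine (Real.le_norm_self _).trans ?_
    rw [← Complex.norm_real, hswap]
    exact norm_integral_le_of_norm_le hint3 (ae_of_all _ hgc)
  refine hnorm.trans ?_
  rw [integral_const_mul, integral_const_mul, integral_prod _ hint2]
  have hinner : ∀ t, ∫ s, gaussFun (4 * a)⁻¹ (t - s) ∂μ ≤ Real.sqrt (Real.pi / (4 * a)⁻¹) ^ d := by
    intro t
    rw [← integral_gaussFun, ← integral_sub_left_eq_self (gaussFun (4 * a)⁻¹) volume t]
    exact setIntegral_le_integral (hgi2 t) (ae_of_all _ fun s => gaussFun_nonneg _ _)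
  have houter : ∫ t, ∫ s, gaussFun (4 * a)⁻¹ (t - s) ∂μ ∂μ ≤
      Real.sqrt (Real.pi / (4 * a)⁻¹) ^ d * volume.real D := by
    refine (Real.le_norm_self _).trans ?_
    have := norm_integral_le_of_norm_le_const (μ := μ)
      (f := fun t => ∫ s, gaussFun (4 * a)⁻¹ (t - s) ∂μ)
      (C := Real.sqrt (Real.pi / (4 * a)⁻¹) ^ d) (ae_of_all _ fun t => by
        rw [Real.norm_of_nonneg (integral_nonneg fun s => gaussFun_nonneg _ _)]
        exact hinner t)
    simpa [hμ, Measure.real] using this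
  have hconst : Real.sqrt (Real.pi / a) ^ d * Real.sqrt (Real.pi / (4 * a)⁻¹) ^ d =
      (2 * Real.pi) ^ d := by
    rw [← mul_pow, ← Real.sqrt_mul (by positivity)]
    congr 1
    rw [show Real.pi / a * (Real.pi / (4 * a)⁻¹) = (2 * Real.pi) ^ 2 by field_simp; ring]
    exact Real.sqrt_sq (by positivity)
  calc _ ≤ B ^ 2 * (Real.sqrt (Real.pi / a) ^ d *
        (Real.sqrt (Real.pi / (4 * a)⁻¹) ^ d * volume.real D)) := by gcongr
    _ = (Real.sqrt (Real.pi / a) ^ d * Real.sqrt (Real.pi / (4 * a)⁻¹) ^ d) *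
        (B ^ 2 * volume.real D) := by ring
    _ = _ := by rw [hconst]

end gaussian
/-! ### The centered taper -/

section taper
variable {d : ℕ} {h : (Fin d → ℝ) → ℝ} {A : Fin d → ℝ}

theorem measurableSet_unitCube : MeasurableSet (unitCube d) := measurableSet_Icc

theorem measurableSet_window : MeasurableSet (window A) := measurableSet_Icc

theorem isBounded_window : Bornology.IsBounded (window A) := Metric.isBounded_Icc _ _

theorem volume_window_ne_top : volume (window A) ≠ ⊤ := isBounded_window.measure_lt_top.ne

/-- A function that is continuous on the unit cube and vanishes outside is measurable. -/
theorem measurable_of_continuousOn_unitCube {f : (Fin d → ℝ) → ℝ}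
    (hc : ContinuousOn f (unitCube d)) (h0 : ∀ x, x ∉ unitCube d → f x = 0) : Measurable f := by
  have h1 : f = (unitCube d).indicator f := by
    ext x
    by_cases hx : x ∈ unitCube d
    · rw [Set.indicator_of_mem hx]
    · rw [Set.indicator_of_notMem hx, h0 x hx]
  classical
  rw [h1, ← Set.piecewise_eq_indicator]
  exact hc.measurable_piecewise continuousOn_const measurableSet_unitCube

theorem exists_le_of_continuousOn_unitCube {f : (Fin d → ℝ) → ℝ}
    (hc : ContinuousOn f (unitCube d)) (h0 : ∀ x, x ∉ unitCube d → f x = 0) :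
    ∃ M, 0 ≤ M ∧ ∀ x, |f x| ≤ M := by
  obtain ⟨M, hM⟩ := (isCompact_Icc : IsCompact (unitCube d)).exists_bound_of_continuousOn hc
  refine ⟨max M 0, le_max_right _ _, fun x => ?_⟩
  by_cases hx : x ∈ unitCube d
  · exact (hM x hx).trans (le_max_left _ _)
  · rw [h0 x hx, abs_zero]; exact le_max_right _ _

theorem windowVol_eq_prod (hA : ∀ i, 0 < A i) : windowVol A = ∏ i, A i := by
  rw [windowVol, window, Measure.real, Real.volume_Icc_pi_toReal]
  · congr 1; ext i; ring
  · intro i; have := hA i; simp only; linarith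

theorem windowVol_pos (hA : ∀ i, 0 < A i) : 0 < windowVol A := by
  rw [windowVol_eq_prod hA]; exact Finset.prod_pos fun i _ => hA i

theorem div_mem_unitCube_iff (hA : ∀ i, 0 < A i) (x : Fin d → ℝ) :
    x / A ∈ unitCube d ↔ x ∈ window A := by
  simp only [unitCube, window, Set.mem_Icc, Pi.le_def, Pi.div_apply]
  refine and_congr (forall_congr' fun i => ?_) (forall_congr' fun i => ?_)
  · rw [le_div_iff₀ (hA i)]; constructor <;> intro h <;> linarith
  · rw [div_le_iff₀ (hA i)]; constructor <;> intro h <;> linarith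

theorem integral_comp_div {F : Type*} [NormedAddCommGroup F] [NormedSpace ℝ F]
    (hA : ∀ i, 0 < A i) (f : (Fin d → ℝ) → F) :
    ∫ x, f (x / A) = windowVol A • ∫ x, f x := by
  let e : (Fin d → ℝ) ≃ᵐ (Fin d → ℝ) := MeasurableEquiv.piCongrRight fun i =>
    (Homeomorph.mulRight₀ (A i)⁻¹ (inv_pos.2 (hA i)).ne').toMeasurableEquiv
  have he : ∀ x, e x = x / A := fun x => by
    ext i
    rw [Pi.div_apply, div_eq_mul_inv]
    rfl
  have hdet : (Matrix.diagonal fun i => (A i)⁻¹).det = (windowVol A)⁻¹ := by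
    rw [Matrix.det_diagonal, windowVol_eq_prod hA, Finset.prod_inv_distrib]
  have hpos := windowVol_pos hA
  have hmap : Measure.map e volume = ENNReal.ofReal (windowVol A) • volume := by
    have h1 := Real.map_matrix_volume_pi_eq_smul_volume_pi
      (M := Matrix.diagonal fun i => (A i)⁻¹) (by rw [hdet]; exact (inv_pos.2 hpos).ne')
    rw [hdet, inv_inv, abs_of_pos hpos] at h1
    rw [← h1]
    congr 1
    ext x i
    rw [he, Matrix.toLin'_apply, Matrix.mulVec_diagonal, Pi.div_apply, div_eq_inv_mul]
  have h2 := integral_map_equiv (μ := volume) e f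
  simp only [he] at h2
  rw [← h2, hmap, integral_smul_measure, ENNReal.toReal_ofReal hpos.le]

theorem IsTaper.measurable (hh : IsTaper h) : Measurable h :=
  measurable_of_continuousOn_unitCube hh.continuousOn hh.support

theorem IsTaper.measurable_comp_div (hh : IsTaper h) (A : Fin d → ℝ) :
    Measurable fun x : Fin d → ℝ => h (x / A) :=
  hh.measurable.comp (measurable_pi_lambda _ fun i => (measurable_pi_apply i).div_const _)

theorem IsTaper.comp_div_eq_zero (hh : IsTaper h) (hA : ∀ i, 0 < A i) {x : Fin d → ℝ}
    (hx : x ∉ window A) : h (x / A) = 0 :=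
  hh.support _ fun hc => hx ((div_mem_unitCube_iff hA x).1 hc)

theorem IsTaper.setIntegral_comp_div (hh : IsTaper h) (hA : ∀ i, 0 < A i) :
    ∫ x in window A, h (x / A) = windowVol A * taperMoment h 1 := by
  rw [setIntegral_eq_integral_of_forall_compl_eq_zero fun x hx => hh.comp_div_eq_zero hA hx,
    integral_comp_div hA, smul_eq_mul, taperMoment,
    setIntegral_eq_integral_of_forall_compl_eq_zero fun x hx => by rw [hh.support x hx, pow_one]]
  simp only [pow_one]

theorem windowMoment_one (h : (Fin d → ℝ) → ℝ) (A : Fin d → ℝ) (θ : Fin d → ℝ) :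
    windowMoment h A 1 θ = ∫ x in window A, (h (x / A) : ℂ) * expNeg x θ := by
  simp [windowMoment]

/-- The ratio `∫ h(x/A) exp(-i xᵀθ) dx / ∫ h(x/A) dx`, the coefficient by which the feasible
transform is centered. -/
noncomputable def centerCoef (h : (Fin d → ℝ) → ℝ) (A : Fin d → ℝ) (θ : Fin d → ℝ) : ℂ :=
  (((taperMoment h 1)⁻¹ * (windowVol A)⁻¹ : ℝ) : ℂ) * windowMoment h A 1 θ

/-- The function whose sum over the points of the process is the feasible centered transform. -/
noncomputable def centeredTaper (h : (Fin d → ℝ) → ℝ) (A : Fin d → ℝ) (θ x : Fin d → ℝ) : ℂ :=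
  (dftNorm h A : ℂ) * (h (x / A) : ℂ) * (expNeg x θ - centerCoef h A θ)

theorem dftNorm_nonneg (hh : IsTaper h) (hA : ∀ i, 0 < A i) : 0 ≤ dftNorm h A := by
  have h1 := hh.moment_pos 2 (by norm_num)
  have h2 := windowVol_pos hA
  rw [dftNorm]; positivity

theorem dftNorm_sq (hh : IsTaper h) (hA : ∀ i, 0 < A i) :
    dftNorm h A ^ 2 = ((2 * Real.pi) ^ d)⁻¹ * (taperMoment h 2)⁻¹ * (windowVol A)⁻¹ := by
  have h1 := hh.moment_pos 2 (by norm_num)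
  have h2 := windowVol_pos hA
  have key : ∀ x : ℝ, 0 < x → (x ^ (-(1 : ℝ) / 2)) ^ 2 = x⁻¹ := fun x hx => by
    rw [← Real.rpow_natCast, ← Real.rpow_mul hx.le, ← Real.rpow_neg_one]; norm_num
  rw [dftNorm, mul_pow, mul_pow, key _ h1, key _ h2]
  congr 2
  rw [← Real.rpow_natCast, ← Real.rpow_mul (by positivity), ← Real.rpow_natCast,
    ← Real.rpow_neg (by positivity)]
  congr 1
  push_cast; ring

theorem integrableOn_taper (hh : IsTaper h) : IntegrableOn (fun x => h (x / A)) (window A) := by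
  obtain ⟨M, -, hM⟩ := exists_le_of_continuousOn_unitCube hh.continuousOn hh.support
  have : IsFiniteMeasure (volume.restrict (window A)) :=
    isFiniteMeasure_restrict.2 volume_window_ne_top
  exact Integrable.of_bound (hh.measurable_comp_div A).aestronglyMeasurable M
    (ae_of_all _ fun x => hM _)

theorem norm_centerCoef_le (hh : IsTaper h) (hA : ∀ i, 0 < A i) (θ : Fin d → ℝ) :
    ‖centerCoef h A θ‖ ≤ 1 := by
  have h1 := hh.moment_pos 1 le_rfl
  have h2 := windowVol_pos hA
  have h3 : ‖windowMoment h A 1 θ‖ ≤ windowVol A * taperMoment h 1 := by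
    rw [← hh.setIntegral_comp_div hA, windowMoment_one]
    refine norm_integral_le_of_norm_le (integrableOn_taper hh) (ae_of_all _ fun x => ?_)
    rw [norm_mul, norm_expNeg, mul_one, Complex.norm_real, Real.norm_of_nonneg (hh.nonneg _)]
  rw [centerCoef, norm_mul, Complex.norm_real, Real.norm_of_nonneg (by positivity)]
  calc _ ≤ (taperMoment h 1)⁻¹ * (windowVol A)⁻¹ * (windowVol A * taperMoment h 1) := by gcongr
    _ = 1 := by field_simp

theorem continuous_centerCoef (hh : IsTaper h) : Continuous (centerCoef h A) := by
  unfold centerCoef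
  refine continuous_const.mul ?_
  simp only [funext (windowMoment_one h A)]
  refine continuous_of_dominated (bound := fun x => h (x / A)) (fun θ => ?_) (fun θ => ?_)
    (integrableOn_taper hh) (ae_of_all _ fun x => ?_)
  · exact ((Complex.measurable_ofReal.comp (hh.measurable_comp_div A)).mul
      (measurable_expNeg_left θ)).aestronglyMeasurable
  · refine ae_of_all _ fun x => ?_
    rw [norm_mul, norm_expNeg, mul_one, Complex.norm_real, Real.norm_of_nonneg (hh.nonneg _)]
  · exact continuous_const.mul (continuous_expNeg.comp (continuous_const.prodMk continuous_id))

theorem continuous_centeredTaper (hh : IsTaper h) (x : Fin d → ℝ) :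
    Continuous fun θ => centeredTaper h A θ x :=
  continuous_const.mul ((continuous_expNeg.comp (continuous_const.prodMk continuous_id)).sub
    (continuous_centerCoef hh))

theorem measurable_centeredTaper (hh : IsTaper h) (θ : Fin d → ℝ) :
    Measurable (centeredTaper h A θ) :=
  ((Complex.measurable_ofReal.comp (hh.measurable_comp_div A)).const_mul _).mul
    ((measurable_expNeg_left θ).sub_const _)

theorem centeredTaper_eq_zero (hh : IsTaper h) (hA : ∀ i, 0 < A i) (θ : Fin d → ℝ)
    {x : Fin d → ℝ} (hx : x ∉ window A) : centeredTaper h A θ x = 0 := by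
  rw [centeredTaper, hh.comp_div_eq_zero hA hx]; simp

theorem norm_centeredTaper_le (hh : IsTaper h) (hA : ∀ i, 0 < A i) {M : ℝ} (hM : ∀ x, |h x| ≤ M)
    (θ x : Fin d → ℝ) : ‖centeredTaper h A θ x‖ ≤ 2 * dftNorm h A * M := by
  have h1 : ‖expNeg x θ - centerCoef h A θ‖ ≤ 1 + 1 :=
    (norm_sub_le _ _).trans (add_le_add (norm_expNeg x θ).le (norm_centerCoef_le hh hA θ))
  have h2 := dftNorm_nonneg hh hA
  have hM0 : 0 ≤ M := (abs_nonneg _).trans (hM 0)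
  rw [centeredTaper, norm_mul, norm_mul, Complex.norm_real, Complex.norm_real,
    Real.norm_of_nonneg h2]
  calc _ ≤ dftNorm h A * M * (1 + 1) := by gcongr; exact hM _
    _ = _ := by ring

theorem integrableOn_taper_mul_expNeg (hh : IsTaper h) (θ : Fin d → ℝ) :
    IntegrableOn (fun x => (h (x / A) : ℂ) * expNeg x θ) (window A) := by
  refine (integrableOn_taper (A := A) hh).mono' ((Complex.measurable_ofReal.comp
    (hh.measurable_comp_div A)).mul (measurable_expNeg_left θ)).aestronglyMeasurable
    (ae_of_all _ fun x => ?_)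
  rw [norm_mul, norm_expNeg, mul_one, Complex.norm_real, Real.norm_of_nonneg (hh.nonneg _)]

/-- The estimated intensity centers the transform exactly. -/
theorem setIntegral_centeredTaper (hh : IsTaper h) (hA : ∀ i, 0 < A i) (θ : Fin d → ℝ) :
    ∫ x in window A, centeredTaper h A θ x = 0 := by
  have h1 := (hh.moment_pos 1 le_rfl).ne'
  have h2 := (windowVol_pos hA).ne'
  have e : ∀ x, centeredTaper h A θ x = (dftNorm h A : ℂ) * ((h (x / A) : ℂ) * expNeg x θ) -
      (dftNorm h A : ℂ) * centerCoef h A θ * (h (x / A) : ℂ) := fun x => by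
    rw [centeredTaper]; ring
  have i1 : Integrable (fun x => (dftNorm h A : ℂ) * ((h (x / A) : ℂ) * expNeg x θ))
      (volume.restrict (window A)) := (integrableOn_taper_mul_expNeg hh θ).const_mul _
  have i2 : Integrable (fun x => (dftNorm h A : ℂ) * centerCoef h A θ * (h (x / A) : ℂ))
      (volume.restrict (window A)) := (Integrable.ofReal (integrableOn_taper hh)).const_mul _
  simp only [e]
  rw [integral_sub i1 i2, integral_const_mul, integral_const_mul,
    ← windowMoment_one, integral_complex_ofReal, hh.setIntegral_comp_div hA, centerCoef]
  have h1' : ((taperMoment h 1 : ℝ) : ℂ) ≠ 0 := Complex.ofReal_ne_zero.2 h1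
  have h2' : ((windowVol A : ℝ) : ℂ) ≠ 0 := Complex.ofReal_ne_zero.2 h2
  push_cast
  field_simp
  ring

theorem centeredDft_eq_sum {S : Set (Fin d → ℝ)} (hS : (S ∩ window A).Finite) (θ : Fin d → ℝ) :
    centeredDft h A S θ = ∑ x ∈ hS.toFinset, centeredTaper h A θ x := by
  rw [centeredDft, dft, intensityEstimator, biasFactor, finsum_mem_eq_finite_toFinset_sum _ hS,
    finsum_mem_eq_finite_toFinset_sum _ hS]
  simp only [centeredTaper, centerCoef]
  push_cast
  rw [Finset.mul_sum, Finset.mul_sum, Finset.sum_mul, ← Finset.sum_sub_distrib]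
  refine Finset.sum_congr rfl fun x _ => ?_
  ring

end taper
/-! ### Averages over a frequency window -/

section kernel
variable {d : ℕ} {W : (Fin d → ℝ) → ℝ} {b : ℝ}

theorem IsSmoothingKernel.measurable (hW : IsSmoothingKernel W) : Measurable W :=
  measurable_of_continuousOn_unitCube hW.continuousOn hW.support

theorem scaledKernel_nonneg (hW : IsSmoothingKernel W) (hb : 0 < b) (x : Fin d → ℝ) :
    0 ≤ scaledKernel W b x := mul_nonneg (by positivity) (hW.nonneg _)

theorem measurable_scaledKernel_sub (hW : IsSmoothingKernel W) (ω : Fin d → ℝ) :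
    Measurable fun θ => scaledKernel W b (ω - θ) := by
  unfold scaledKernel
  have h1 : Measurable fun θ : Fin d → ℝ => b⁻¹ • (ω - θ) :=
    Continuous.measurable (by fun_prop)
  exact (hW.measurable.comp h1).const_mul _

theorem integral_scaledKernel_smul {F : Type*} [NormedAddCommGroup F] [NormedSpace ℝ F]
    (hb : 0 < b) (W : (Fin d → ℝ) → ℝ) (ω : Fin d → ℝ) (f : (Fin d → ℝ) → F) :
    ∫ θ, scaledKernel W b (ω - θ) • f θ = ∫ v, W v • f (ω - b • v) := by
  have h1 := integral_sub_left_eq_self (fun θ => scaledKernel W b (ω - θ) • f θ) volume ω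
  simp only [sub_sub_cancel] at h1
  have h2 := Measure.integral_comp_smul volume
    (fun x : Fin d → ℝ => scaledKernel W b x • f (ω - x)) b
  have h3 : 0 < b ^ d := pow_pos hb d
  simp only [Module.finrank_fin_fun, abs_of_pos (inv_pos.2 h3)] at h2
  have h4 : ∫ v, scaledKernel W b (b • v) • f (ω - b • v) =
      (b ^ d)⁻¹ • ∫ v, W v • f (ω - b • v) := by
    rw [← integral_smul]
    refine integral_congr_ae (ae_of_all _ fun v => ?_)
    simp only [scaledKernel, smul_smul, inv_mul_cancel₀ hb.ne', one_smul]
  rw [h4] at h2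
  have := smul_right_injective F (inv_pos.2 h3).ne' h2
  rw [← h1]; exact this.symm

/-- The probability measure with density `W_b(ω - ·)`. -/
noncomputable def kernelMeasure (W : (Fin d → ℝ) → ℝ) (b : ℝ) (ω : Fin d → ℝ) :
    Measure (Fin d → ℝ) :=
  volume.withDensity fun θ => ENNReal.ofReal (scaledKernel W b (ω - θ))

theorem integral_kernelMeasure {F : Type*} [NormedAddCommGroup F] [NormedSpace ℝ F]
    (hW : IsSmoothingKernel W) (hb : 0 < b) (ω : Fin d → ℝ) (f : (Fin d → ℝ) → F) :
    ∫ θ, f θ ∂(kernelMeasure W b ω) = ∫ θ, scaledKernel W b (ω - θ) • f θ := by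
  rw [kernelMeasure, integral_withDensity_eq_integral_toReal_smul
    (measurable_scaledKernel_sub hW ω).ennreal_ofReal (ae_of_all _ fun _ => ENNReal.ofReal_lt_top)]
  simp only [ENNReal.toReal_ofReal (scaledKernel_nonneg hW hb _)]

theorem isProbabilityMeasure_kernelMeasure (hW : IsSmoothingKernel W) (hb : 0 < b)
    (ω : Fin d → ℝ) : IsProbabilityMeasure (kernelMeasure W b ω) := by
  have h1 : ∫ θ, scaledKernel W b (ω - θ) = 1 := by
    have := integral_scaledKernel_smul hb W ω (fun _ => (1 : ℝ))
    simpa [hW.integral_eq_one] using this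
  have hint : Integrable fun θ => scaledKernel W b (ω - θ) := by
    by_contra hc
    rw [integral_undef hc] at h1
    exact zero_ne_one h1
  refine ⟨?_⟩
  rw [kernelMeasure, withDensity_apply _ MeasurableSet.univ, Measure.restrict_univ,
    ← ofReal_integral_eq_lintegral_ofReal hint (ae_of_all _ fun _ => scaledKernel_nonneg hW hb _),
    h1, ENNReal.ofReal_one]

/-- The kernel is dominated by a Gaussian: on the cube, `|x|² ≤ d/4`. -/
theorem scaledKernel_le_gaussFun (hb : 0 < b) (hW : IsSmoothingKernel W) {M : ℝ}
    (hM : ∀ x, |W x| ≤ M) (x : Fin d → ℝ) :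
    scaledKernel W b x ≤ (b ^ d)⁻¹ * (M * Real.exp (d / 4)) * gaussFun (b ^ 2)⁻¹ x := by
  have hM0 : 0 ≤ M := (abs_nonneg _).trans (hM 0)
  rw [scaledKernel, mul_assoc]
  refine mul_le_mul_of_nonneg_left ?_ (by positivity)
  by_cases hx : b⁻¹ • x ∈ unitCube d
  · have h1 : (b ^ 2)⁻¹ * ∑ i, x i ^ 2 ≤ d / 4 := by
      rw [Finset.mul_sum]
      calc ∑ i, (b ^ 2)⁻¹ * x i ^ 2 ≤ ∑ _i : Fin d, (1 / 4 : ℝ) := by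
            refine Finset.sum_le_sum fun i _ => ?_
            have h2 := hx.1 i
            have h3 := hx.2 i
            simp only [Pi.smul_apply, smul_eq_mul] at h2 h3
            rw [← inv_pow, ← mul_pow]
            nlinarith
        _ = d / 4 := by simp; ring
    calc W (b⁻¹ • x) ≤ M * 1 := by rw [mul_one]; exact (le_abs_self _).trans (hM _)
      _ ≤ M * (Real.exp (d / 4) * gaussFun (b ^ 2)⁻¹ x) := by
          refine mul_le_mul_of_nonneg_left ?_ hM0
          rw [gaussFun, ← Real.exp_add]
          exact Real.one_le_exp (by linarith)
      _ = _ := by ring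
  · rw [hW.support _ hx]
    have := gaussFun_nonneg (b ^ 2)⁻¹ x
    positivity

/-- Averaging the squared Fourier transform of a bounded function `v` on `D` over a frequency
window of width `b` costs at most a factor `b^{-d}`. -/
theorem exists_integral_norm_sq_le (hW : IsSmoothingKernel W) : ∃ C, 0 ≤ C ∧ ∀ b : ℝ, 0 < b →
    ∀ (ω : Fin d → ℝ) (D : Set (Fin d → ℝ)), volume D ≠ ⊤ → ∀ v : (Fin d → ℝ) → ℂ,
    Measurable v → ∀ B : ℝ, (∀ x, ‖v x‖ ≤ B) →
    ∫ θ, ‖∫ t in D, v t * expNeg t θ‖ ^ 2 ∂(kernelMeasure W b ω) ≤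
      C * (b ^ d)⁻¹ * (B ^ 2 * volume.real D) := by
  obtain ⟨M, hM0, hM⟩ := exists_le_of_continuousOn_unitCube hW.continuousOn hW.support
  refine ⟨M * Real.exp (d / 4) * (2 * Real.pi) ^ d, by positivity, fun b hb ω D hD v hv B hB => ?_⟩
  have hB0 : 0 ≤ B := (norm_nonneg _).trans (hB 0)
  have : IsFiniteMeasure (volume.restrict D) := isFiniteMeasure_restrict.2 hD
  have hmeas : Measurable fun θ => ‖∫ t in D, v t * expNeg t θ‖ ^ 2 := by
    have h1 : Measurable fun z : (Fin d → ℝ) × (Fin d → ℝ) => v z.2 * expNeg z.2 z.1 :=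
      (hv.comp measurable_snd).mul
        (continuous_expNeg.comp (continuous_snd.prodMk continuous_fst)).measurable
    exact (h1.stronglyMeasurable.integral_prod_right'.measurable.norm).pow_const 2
  have hint : Integrable fun θ =>
      gaussFun (b ^ 2)⁻¹ (ω - θ) * ‖∫ t in D, v t * expNeg t θ‖ ^ 2 := by
    refine ((integrable_gaussFun (by positivity)).comp_sub_left ω).mul_bdd
      (c := (B * volume.real D) ^ 2) hmeas.aestronglyMeasurable (ae_of_all _ fun θ => ?_)
    rw [norm_pow, norm_norm]
    gcongr
    exact norm_setIntegral_le_of_norm_le_const hD.lt_top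
      fun x _ => by rw [norm_mul, norm_expNeg, mul_one]; exact hB x
  rw [integral_kernelMeasure hW hb]
  calc _ ≤ ∫ θ, (b ^ d)⁻¹ * (M * Real.exp (d / 4)) *
        (gaussFun (b ^ 2)⁻¹ (ω - θ) * ‖∫ t in D, v t * expNeg t θ‖ ^ 2) := by
        refine integral_mono_of_nonneg (ae_of_all _ fun θ =>
          mul_nonneg (scaledKernel_nonneg hW hb _) (sq_nonneg _)) (hint.const_mul _)
          (ae_of_all _ fun θ => ?_)
        simp only [smul_eq_mul]
        rw [← mul_assoc]
        exact mul_le_mul_of_nonneg_right (scaledKernel_le_gaussFun hb hW hM _) (sq_nonneg _)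
    _ ≤ (b ^ d)⁻¹ * (M * Real.exp (d / 4)) * ((2 * Real.pi) ^ d * (B ^ 2 * volume.real D)) := by
        rw [integral_const_mul]
        refine mul_le_mul_of_nonneg_left ?_ (by positivity)
        exact integral_gaussFun_mul_norm_sq_le (by positivity) ω hD hv hB
    _ = _ := by ring

variable {h : (Fin d → ℝ) → ℝ}

/-- The centering coefficient is small on average over a frequency window. -/
theorem exists_integral_centerCoef_sq_le (hW : IsSmoothingKernel W) (hh : IsTaper h) :
    ∃ C, 0 ≤ C ∧ ∀ b : ℝ, 0 < b → ∀ (ω A : Fin d → ℝ), (∀ i, 0 < A i) →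
    ∫ θ, ‖centerCoef h A θ‖ ^ 2 ∂(kernelMeasure W b ω) ≤ C * ((windowVol A)⁻¹ * (b ^ d)⁻¹) := by
  obtain ⟨C, hC0, hC⟩ := exists_integral_norm_sq_le hW
  obtain ⟨M, hM0, hM⟩ := exists_le_of_continuousOn_unitCube hh.continuousOn hh.support
  have h1 := hh.moment_pos 1 le_rfl
  refine ⟨(taperMoment h 1)⁻¹ ^ 2 * C * M ^ 2, by positivity, fun b hb ω A hA => ?_⟩
  have h2 := windowVol_pos hA
  have h3 := hC b hb ω (window A) volume_window_ne_top (fun x => (h (x / A) : ℂ))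
    (Complex.measurable_ofReal.comp (hh.measurable_comp_div A)) M
    (fun x => by rw [Complex.norm_real]; exact hM _)
  have h4 : ∀ θ, ‖centerCoef h A θ‖ ^ 2 = ((taperMoment h 1)⁻¹ * (windowVol A)⁻¹) ^ 2 *
      ‖∫ t in window A, (h (t / A) : ℂ) * expNeg t θ‖ ^ 2 := fun θ => by
    rw [centerCoef, norm_mul, Complex.norm_real, Real.norm_of_nonneg (by positivity), mul_pow,
      windowMoment_one]
  simp only [h4]
  rw [integral_const_mul]
  calc _ ≤ ((taperMoment h 1)⁻¹ * (windowVol A)⁻¹) ^ 2 *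
        (C * (b ^ d)⁻¹ * (M ^ 2 * windowVol A)) := by
        refine mul_le_mul_of_nonneg_left h3 (by positivity)
    _ = _ := by field_simp

variable {lam : (n : ℕ) → (Fin n → Fin d → ℝ) → ℝ} {G : ℝ}

/-- The powers of the volume cancel because `κ²` is of the order `V⁻¹`. -/
theorem secondOrder_constant {V κ k C C' B M : ℝ} (hV : V ≠ 0) (hκ : κ ^ 2 = k * V⁻¹) :
    2 * κ ^ 2 * (C * B * ((2 * G * (2 * κ * M) * M) ^ 2 * V) +
      (2 * G * (2 * κ * M) * M * V) ^ 2 * (C' * (V⁻¹ * B))) =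
    2 * k * (C + C') * (16 * G ^ 2 * k * M ^ 4) * (V⁻¹ * B) := by
  have h1 : (2 * G * (2 * κ * M) * M) ^ 2 = 16 * G ^ 2 * M ^ 4 * (k * V⁻¹) := by
    rw [← hκ]; ring
  have h2 : (2 * G * (2 * κ * M) * M * V) ^ 2 = 16 * G ^ 2 * M ^ 4 * (k * V⁻¹) * V ^ 2 := by
    rw [← h1]; ring
  rw [h1, h2, hκ]
  field_simp

/-- The covariances of the centered transform with any linear statistic of the same size are square
summable over a frequency window, up to the factor `|D|⁻¹ b^{-d}`. -/
theorem exists_integral_covForm_sq_le (hW : IsSmoothingKernel W) (hh : IsTaper h)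
    (hG : CumulantBound lam G) (hstat : IsStationaryOfOrder 2 lam) {M : ℝ} (hM : ∀ x, |h x| ≤ M) :
    ∃ C, 0 ≤ C ∧ ∀ b : ℝ, 0 < b → ∀ (ω A : Fin d → ℝ), (∀ i, 0 < A i) →
    ∀ f : (Fin d → ℝ) → ℂ, Measurable f → (∀ x, ‖f x‖ ≤ 2 * dftNorm h A * M) →
    (∀ x, x ∉ window A → f x = 0) →
    ∫ θ, ‖covForm lam (window A) f (centeredTaper h A θ)‖ ^ 2 ∂(kernelMeasure W b ω) ≤
      C * ((windowVol A)⁻¹ * (b ^ d)⁻¹) := by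
  obtain ⟨C, hC0, hC⟩ := exists_integral_norm_sq_le hW
  obtain ⟨C', hC0', hC'⟩ := exists_integral_centerCoef_sq_le hW hh
  have hM0 : 0 ≤ M := (abs_nonneg _).trans (hM 0)
  have hG0 : 0 ≤ G := hG.nonneg.trans hG.le
  have m2 := hh.moment_pos 2 (by norm_num)
  set k := ((2 * Real.pi) ^ d)⁻¹ * (taperMoment h 2)⁻¹ with hk
  have hk0 : 0 ≤ k := by positivity
  refine ⟨2 * k * (C + C') * (16 * G ^ 2 * k * M ^ 4), by positivity,
    fun b hb ω A hA f hf hfM hf0 => ?_⟩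
  have := isProbabilityMeasure_kernelMeasure hW hb ω
  have hV := windowVol_pos hA
  have hκ := dftNorm_sq hh hA
  have hκ0 := dftNorm_nonneg hh hA
  set κ := dftNorm h A with hκdef
  set U := 2 * G * (2 * κ * M) with hU
  have hu : ∀ t, ‖covOp lam f t‖ ≤ U := norm_covOp_le hG hfM
  have hum := measurable_covOp hG hf
  let v : (Fin d → ℝ) → ℂ := fun t => covOp lam f t * (h (t / A) : ℂ)
  have hv : Measurable v := hum.mul (Complex.measurable_ofReal.comp (hh.measurable_comp_div A))
  have hU0 : 0 ≤ U := by positivity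
  have hvB : ∀ t, ‖v t‖ ≤ U * M := fun t => by
    simp only [v]
    rw [norm_mul, Complex.norm_real]
    exact mul_le_mul (hu t) (hM _) (norm_nonneg _) hU0
  have hfin : IsFiniteMeasure (volume.restrict (window A)) :=
    isFiniteMeasure_restrict.2 volume_window_ne_top
  have hi1 : Integrable v (volume.restrict (window A)) :=
    Integrable.of_bound hv.aestronglyMeasurable _ (ae_of_all _ hvB)
  have hi2 : ∀ θ, Integrable (fun t => v t * expNeg t θ) (volume.restrict (window A)) := fun θ =>
    Integrable.of_bound (hv.mul (measurable_expNeg_left θ)).aestronglyMeasurable (U * M)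
      (ae_of_all _ fun t => by rw [norm_mul, norm_expNeg, mul_one]; exact hvB t)
  have hcov : ∀ θ, covForm lam (window A) f (centeredTaper h A θ) =
      (κ : ℂ) * ((∫ t in window A, v t * expNeg t θ) -
        centerCoef h A θ * ∫ t in window A, v t) := by
    intro θ
    rw [covForm_eq_integral_covOp hG hstat volume_window_ne_top hf (measurable_centeredTaper hh θ)
      hfM (norm_centeredTaper_le hh hA hM θ) hf0, ← integral_const_mul,
      ← integral_sub (hi2 θ) (hi1.const_mul _), ← integral_const_mul]
    refine integral_congr_ae (ae_of_all _ fun t => ?_)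
    simp only [centeredTaper, v]
    ring
  have hvint : ‖∫ t in window A, v t‖ ≤ U * M * windowVol A :=
    norm_setIntegral_le_of_norm_le_const volume_window_ne_top.lt_top fun t _ => hvB t
  have hpt : ∀ θ, ‖covForm lam (window A) f (centeredTaper h A θ)‖ ^ 2 ≤
      2 * κ ^ 2 * (‖∫ t in window A, v t * expNeg t θ‖ ^ 2 +
        (U * M * windowVol A) ^ 2 * ‖centerCoef h A θ‖ ^ 2) := by
    intro θ
    rw [hcov, norm_mul, Complex.norm_real, Real.norm_of_nonneg hκ0, mul_pow]
    have h1 : ‖(∫ t in window A, v t * expNeg t θ) - centerCoef h A θ * ∫ t in window A, v t‖ ≤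
        ‖∫ t in window A, v t * expNeg t θ‖ + ‖centerCoef h A θ‖ * (U * M * windowVol A) := by
      refine (norm_sub_le _ _).trans (add_le_add le_rfl ?_)
      rw [norm_mul]
      exact mul_le_mul_of_nonneg_left hvint (norm_nonneg _)
    have h2 := pow_le_pow_left₀ (norm_nonneg _) h1 2
    have h3 := add_sq_le (a := ‖∫ t in window A, v t * expNeg t θ‖)
      (b := ‖centerCoef h A θ‖ * (U * M * windowVol A))
    calc _ ≤ κ ^ 2 * _ := mul_le_mul_of_nonneg_left (h2.trans h3) (sq_nonneg _)
      _ = _ := by ring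
  have hm1 : Measurable fun θ => ‖∫ t in window A, v t * expNeg t θ‖ ^ 2 := by
    have h1 : Measurable fun z : (Fin d → ℝ) × (Fin d → ℝ) => v z.2 * expNeg z.2 z.1 :=
      (hv.comp measurable_snd).mul
        (continuous_expNeg.comp (continuous_snd.prodMk continuous_fst)).measurable
    exact (h1.stronglyMeasurable.integral_prod_right'.measurable.norm).pow_const 2
  have hj1 : Integrable (fun θ => ‖∫ t in window A, v t * expNeg t θ‖ ^ 2)
      (kernelMeasure W b ω) := by
    refine Integrable.of_bound hm1.aestronglyMeasurable ((U * M * windowVol A) ^ 2)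
      (ae_of_all _ fun θ => ?_)
    rw [norm_pow, norm_norm]
    refine pow_le_pow_left₀ (norm_nonneg _) ?_ 2
    exact norm_setIntegral_le_of_norm_le_const volume_window_ne_top.lt_top
      fun x _ => by rw [norm_mul, norm_expNeg, mul_one]; exact hvB x
  have hj2 : Integrable (fun θ => ‖centerCoef h A θ‖ ^ 2) (kernelMeasure W b ω) := by
    refine Integrable.of_bound ((continuous_centerCoef hh).norm.pow 2).aestronglyMeasurable 1
      (ae_of_all _ fun θ => ?_)
    rw [norm_pow, norm_norm]
    exact pow_le_one₀ (norm_nonneg _) (norm_centerCoef_le hh hA θ)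
  have hj3 : Integrable (fun θ => (U * M * windowVol A) ^ 2 * ‖centerCoef h A θ‖ ^ 2)
      (kernelMeasure W b ω) := hj2.const_mul _
  have hle1 : ∫ θ, ‖covForm lam (window A) f (centeredTaper h A θ)‖ ^ 2 ∂(kernelMeasure W b ω) ≤
      ∫ θ, 2 * κ ^ 2 * (‖∫ t in window A, v t * expNeg t θ‖ ^ 2 +
        (U * M * windowVol A) ^ 2 * ‖centerCoef h A θ‖ ^ 2) ∂(kernelMeasure W b ω) :=
    integral_mono_of_nonneg (ae_of_all _ fun θ => sq_nonneg _)
      ((hj1.add hj3).const_mul (2 * κ ^ 2)) (ae_of_all _ hpt)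
  rw [integral_const_mul, integral_add hj1 hj3, integral_const_mul] at hle1
  have b1 := hC b hb ω (window A) volume_window_ne_top v hv (U * M) hvB
  have b2 := hC' b hb ω A hA
  refine (hle1.trans (mul_le_mul_of_nonneg_left
    (add_le_add b1 (mul_le_mul_of_nonneg_left b2 (sq_nonneg _))) (by positivity))).trans_eq ?_
  exact secondOrder_constant hV.ne' hκ

end kernel
/-! ### The variance of an average of random variables -/

section variance
variable {Ω Θ : Type*} [MeasurableSpace Ω] [MeasurableSpace Θ] {P : Measure Ω}
  [IsProbabilityMeasure P] {ρ : Measure Θ} [IsProbabilityMeasure ρ]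

/-- The variance of an average `∫ Y_θ ρ(dθ)` of nonnegative random variables is the double average
of their covariances. If these are at most `k θ η`, it suffices to bound the average of `k` over
`η`, uniformly in `θ`; no joint measurability of `k` is needed. -/
theorem integral_sq_average_sub_le {Y : Ω → Θ → ℝ} (hY : Measurable (Function.uncurry Y))
    (hY0 : ∀ w θ, 0 ≤ Y w θ) {C₁ C₂ K : ℝ} (h1 : ∀ θ, Integrable (fun w => Y w θ) P)
    (hC1 : ∀ θ, ∫ w, Y w θ ∂P ≤ C₁) (h2 : ∀ θ η, Integrable (fun w => Y w θ * Y w η) P)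
    (hC2 : ∀ θ η, ∫ w, Y w θ * Y w η ∂P ≤ C₂) (k : Θ → Θ → ℝ) (hk : ∀ θ, Integrable (k θ) ρ)
    (hle : ∀ θ η, ∫ w, Y w θ * Y w η ∂P - (∫ w, Y w θ ∂P) * ∫ w, Y w η ∂P ≤ k θ η)
    (hK : ∀ θ, ∫ η, k θ η ∂ρ ≤ K) :
    Integrable (fun w => (∫ θ, Y w θ ∂ρ - ∫ θ, ∫ w, Y w θ ∂P ∂ρ) ^ 2) P ∧
    ∫ w, (∫ θ, Y w θ ∂ρ - ∫ θ, ∫ w, Y w θ ∂P ∂ρ) ^ 2 ∂P ≤ K := by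
  have hmY : Measurable fun θ => ∫ w, Y w θ ∂P :=
    (hY.comp measurable_swap).stronglyMeasurable.integral_prod_right'.measurable
  have hYY : Measurable (Function.uncurry fun w (z : Θ × Θ) => Y w z.1 * Y w z.2) :=
    (hY.comp (measurable_fst.prodMk (measurable_fst.comp measurable_snd))).mul
      (hY.comp (measurable_fst.prodMk (measurable_snd.comp measurable_snd)))
  have hmYY : Measurable fun z : Θ × Θ => ∫ w, Y w z.1 * Y w z.2 ∂P :=
    (hYY.comp measurable_swap).stronglyMeasurable.integral_prod_right'.measurable
  have hE0 : ∀ θ, 0 ≤ ∫ w, Y w θ ∂P := fun θ => integral_nonneg fun w => hY0 w θ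
  have hEE0 : ∀ θ η, 0 ≤ ∫ w, Y w θ * Y w η ∂P := fun θ η =>
    integral_nonneg fun w => mul_nonneg (hY0 w θ) (hY0 w η)
  have i1 : Integrable (fun θ => ∫ w, Y w θ ∂P) ρ :=
    Integrable.of_bound hmY.aestronglyMeasurable C₁ (ae_of_all _ fun θ => by
      rw [Real.norm_of_nonneg (hE0 θ)]; exact hC1 θ)
  have i2 : Integrable (fun z : Θ × Θ => ∫ w, Y w z.1 * Y w z.2 ∂P) (ρ.prod ρ) :=
    Integrable.of_bound hmYY.aestronglyMeasurable C₂ (ae_of_all _ fun z => by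
      rw [Real.norm_of_nonneg (hEE0 _ _)]; exact hC2 _ _)
  have p1 : Integrable (Function.uncurry Y) (P.prod ρ) := by
    rw [integrable_prod_iff' hY.aestronglyMeasurable]
    refine ⟨ae_of_all _ h1, ?_⟩
    simpa only [Function.uncurry, Real.norm_of_nonneg (hY0 _ _)] using i1
  have p2 : Integrable (Function.uncurry fun w (z : Θ × Θ) => Y w z.1 * Y w z.2)
      (P.prod (ρ.prod ρ)) := by
    rw [integrable_prod_iff' hYY.aestronglyMeasurable]
    refine ⟨ae_of_all _ fun z => h2 z.1 z.2, ?_⟩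
    simpa only [Function.uncurry, Real.norm_of_nonneg (mul_nonneg (hY0 _ _) (hY0 _ _))] using i2
  set F : Ω → ℝ := fun w => ∫ θ, Y w θ ∂ρ with hF
  set m := ∫ θ, ∫ w, Y w θ ∂P ∂ρ with hm
  have hFi : Integrable F P := p1.integral_prod_left
  have hFm : ∫ w, F w ∂P = m := integral_integral_swap p1
  have hFsq : (fun w => F w ^ 2) = fun w => ∫ z, Y w z.1 * Y w z.2 ∂(ρ.prod ρ) := by
    ext w
    rw [integral_prod_mul (fun θ => Y w θ) (fun θ => Y w θ), sq]
  have hFsqi : Integrable (fun w => F w ^ 2) P := by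
    rw [hFsq]; exact p2.integral_prod_left
  have hFsqm : ∫ w, F w ^ 2 ∂P = ∫ z, (∫ w, Y w z.1 * Y w z.2 ∂P) ∂(ρ.prod ρ) := by
    rw [hFsq]; exact integral_integral_swap p2
  have hexp : (fun w => (F w - m) ^ 2) = fun w => F w ^ 2 - 2 * m * F w + m ^ 2 := by
    ext w; ring
  have hsub : Integrable (fun w => F w ^ 2 - 2 * m * F w) P := hFsqi.sub (hFi.const_mul _)
  rw [hexp]
  refine ⟨hsub.add (integrable_const _), ?_⟩
  rw [integral_add hsub (integrable_const _), integral_sub hFsqi (hFi.const_mul _),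
    integral_const_mul, hFm, integral_const, hFsqm]
  have hmm : m ^ 2 = ∫ z : Θ × Θ, (∫ w, Y w z.1 ∂P) * (∫ w, Y w z.2 ∂P) ∂(ρ.prod ρ) := by
    rw [integral_prod_mul (fun θ => ∫ w, Y w θ ∂P) (fun θ => ∫ w, Y w θ ∂P), sq]
  have i3 : Integrable (fun z : Θ × Θ => (∫ w, Y w z.1 ∂P) * (∫ w, Y w z.2 ∂P)) (ρ.prod ρ) :=
    i1.mul_prod i1
  have hcov : ∫ z : Θ × Θ, (∫ w, Y w z.1 * Y w z.2 ∂P) -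
      (∫ w, Y w z.1 ∂P) * (∫ w, Y w z.2 ∂P) ∂(ρ.prod ρ) ≤ K := by
    have i4 : Integrable (fun z : Θ × Θ => (∫ w, Y w z.1 * Y w z.2 ∂P) -
      (∫ w, Y w z.1 ∂P) * (∫ w, Y w z.2 ∂P)) (ρ.prod ρ) := i2.sub i3
    rw [integral_prod _ i4]
    calc _ ≤ ∫ _θ, K ∂ρ := by
          refine integral_mono_ae i4.integral_prod_left (integrable_const _) ?_
          filter_upwards [i4.prod_right_ae] with θ hθ
          exact (integral_mono hθ (hk θ) fun η => hle θ η).trans (hK θ)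
      _ = K := by simp
  rw [integral_sub i2 i3, ← hmm] at hcov
  simp only [probReal_univ, smul_eq_mul, one_mul]
  linarith

end variance

/-! ### Bounds for the covariance form -/

section covForm
variable {d : ℕ} {lam : (n : ℕ) → (Fin n → Fin d → ℝ) → ℝ} {G : ℝ}

theorem conj_covForm (D : Set (Fin d → ℝ)) (f g : (Fin d → ℝ) → ℂ) :
    (starRingEnd ℂ) (covForm lam D f g) =
      covForm lam D (fun x => (starRingEnd ℂ) (f x)) fun x => (starRingEnd ℂ) (g x) := by
  simp only [covForm, multiIntegral, Fin.prod_univ_two, Matrix.cons_val]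
  rw [map_add, map_mul, ← integral_conj, ← integral_conj, Complex.conj_ofReal]
  simp only [map_mul, Complex.conj_ofReal]

theorem norm_covForm_sub_le (hG : CumulantBound lam G) {D : Set (Fin d → ℝ)} (hD : volume D ≠ ⊤)
    {f g f' g' : (Fin d → ℝ) → ℂ} (hf : Measurable f) (hg : Measurable g) (hf' : Measurable f')
    (hg' : Measurable g') {M δ : ℝ} (hfM : ∀ x, ‖f x‖ ≤ M) (hgM : ∀ x, ‖g x‖ ≤ M)
    (hfM' : ∀ x, ‖f' x‖ ≤ M) (hgM' : ∀ x, ‖g' x‖ ≤ M)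
    (hδ : ∀ x y, ‖f x * g y - f' x * g' y‖ ≤ δ) :
    ‖covForm lam D f g - covForm lam D f' g'‖ ≤ 2 * G * δ * volume.real D := by
  have : IsFiniteMeasure (volume.restrict D) := isFiniteMeasure_restrict.2 hD
  have hG0 : 0 ≤ G := hG.nonneg.trans hG.le
  have hδ0 : 0 ≤ δ := (norm_nonneg _).trans (hδ 0 0)
  have hc := hG.integrable_cumulant (m := 1) (by norm_num) (by norm_num) hD
  have i1 := integrable_prod_mul (g := ![f, g]) hc (by rw [Fin.forall_fin_two]; exact ⟨hf, hg⟩)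
    (by rw [Fin.forall_fin_two]; exact ⟨⟨M, hfM⟩, ⟨M, hgM⟩⟩)
  have i2 := integrable_prod_mul (g := ![f', g']) hc (by rw [Fin.forall_fin_two]; exact ⟨hf', hg'⟩)
    (by rw [Fin.forall_fin_two]; exact ⟨⟨M, hfM'⟩, ⟨M, hgM'⟩⟩)
  have bd : ∀ {a c : (Fin d → ℝ) → ℂ}, Measurable a → Measurable c → (∀ x, ‖a x‖ ≤ M) →
      (∀ x, ‖c x‖ ≤ M) → Integrable (fun x => a x * c x) (volume.restrict D) := by
    intro a c ha hc haM hcM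
    refine Integrable.of_bound (ha.mul hc).aestronglyMeasurable (M * M) (ae_of_all _ fun x => ?_)
    rw [norm_mul]
    exact mul_le_mul (haM x) (hcM x) (norm_nonneg _) ((norm_nonneg _).trans (haM x))
  have e : covForm lam D f g - covForm lam D f' g' =
      (∫ x, ((∏ i, (![f, g] : Fin 2 → (Fin d → ℝ) → ℂ) i (x i)) * (cumulantIntensity lam 2 x : ℂ) -
        (∏ i, (![f', g'] : Fin 2 → (Fin d → ℝ) → ℂ) i (x i)) * (cumulantIntensity lam 2 x : ℂ))
          ∂(Measure.pi fun _ => volume.restrict D)) +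
      firstIntensity lam * ∫ x in D, (f x * g x - f' x * g' x) := by
    rw [integral_sub i1 i2, integral_sub (bd hf hg hfM hgM) (bd hf' hg' hfM' hgM')]
    simp only [covForm, multiIntegral]
    ring
  have b1 : ‖∫ x, ((∏ i, (![f, g] : Fin 2 → (Fin d → ℝ) → ℂ) i (x i)) *
        (cumulantIntensity lam 2 x : ℂ) -
        (∏ i, (![f', g'] : Fin 2 → (Fin d → ℝ) → ℂ) i (x i)) * (cumulantIntensity lam 2 x : ℂ))
          ∂(Measure.pi fun _ => volume.restrict D)‖ ≤ δ * (G * volume.real D) := by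
    refine (norm_integral_le_of_norm_le (hc.abs.const_mul δ) (ae_of_all _ fun x => ?_)).trans ?_
    · rw [← sub_mul, norm_mul, Complex.norm_real, Real.norm_eq_abs]
      refine mul_le_mul_of_nonneg_right ?_ (abs_nonneg _)
      simpa only [Fin.prod_univ_two, Matrix.cons_val] using hδ (x 0) (x 1)
    · rw [integral_const_mul]
      exact mul_le_mul_of_nonneg_left
        (hG.integral_abs_le (m := 1) (by norm_num) (by norm_num) hD) hδ0
  have b2 : ‖(firstIntensity lam : ℂ) * ∫ x in D, (f x * g x - f' x * g' x)‖ ≤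
      G * (δ * volume.real D) := by
    rw [norm_mul, Complex.norm_real, Real.norm_of_nonneg hG.nonneg]
    refine mul_le_mul hG.le ?_ (norm_nonneg _) hG0
    exact norm_setIntegral_le_of_norm_le_const hD.lt_top fun x _ => hδ x x
  rw [e]
  exact (norm_add_le_of_le b1 b2).trans_eq (by ring)

theorem norm_covForm_le (hG : CumulantBound lam G) {D : Set (Fin d → ℝ)} (hD : volume D ≠ ⊤)
    {f g : (Fin d → ℝ) → ℂ} (hf : Measurable f) (hg : Measurable g) {M : ℝ}
    (hfM : ∀ x, ‖f x‖ ≤ M) (hgM : ∀ x, ‖g x‖ ≤ M) :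
    ‖covForm lam D f g‖ ≤ 2 * G * M ^ 2 * volume.real D := by
  have hM0 : 0 ≤ M := (norm_nonneg _).trans (hfM 0)
  have h0 : covForm lam D (fun _ => 0) (fun _ => 0) = 0 := by
    simp [covForm, multiIntegral]
  have := norm_covForm_sub_le (f' := fun _ => 0) (g' := fun _ => 0) (δ := M ^ 2) hG hD hf hg
    measurable_const measurable_const hfM hgM (by simpa) (by simpa) (fun x y => by
      rw [zero_mul, sub_zero, norm_mul, sq]
      exact mul_le_mul (hfM x) (hgM y) (norm_nonneg _) hM0)
  rwa [h0, sub_zero] at this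

theorem continuous_covForm_centeredTaper {h : (Fin d → ℝ) → ℝ} {A : Fin d → ℝ} (hh : IsTaper h)
    (hA : ∀ i, 0 < A i) (hG : CumulantBound lam G) (hstat : IsStationaryOfOrder 2 lam)
    {f : (Fin d → ℝ) → ℂ} (hf : Measurable f) {N : ℝ} (hfN : ∀ x, ‖f x‖ ≤ N)
    (hf0 : ∀ x, x ∉ window A → f x = 0) :
    Continuous fun θ => covForm lam (window A) f (centeredTaper h A θ) := by
  obtain ⟨M, hM0, hM⟩ := exists_le_of_continuousOn_unitCube hh.continuousOn hh.support
  have hfin : IsFiniteMeasure (volume.restrict (window A)) :=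
    isFiniteMeasure_restrict.2 volume_window_ne_top
  have hg := fun θ => norm_centeredTaper_le hh hA hM θ
  have e := fun θ => covForm_eq_integral_covOp hG hstat volume_window_ne_top hf
    (measurable_centeredTaper hh θ) hfN (hg θ) hf0
  simp only [e]
  refine continuous_of_dominated (bound := fun _ => 2 * G * N * (2 * dftNorm h A * M))
    (fun θ => ((measurable_covOp hG hf).mul (measurable_centeredTaper hh θ)).aestronglyMeasurable)
    (fun θ => ae_of_all _ fun t => ?_) (integrable_const _)
    (ae_of_all _ fun t => continuous_const.mul (continuous_centeredTaper hh t))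
  rw [norm_mul]
  exact mul_le_mul (norm_covOp_le hG hfN t) (hg θ t) (norm_nonneg _)
    ((norm_nonneg _).trans (norm_covOp_le hG hfN t))

end covForm
/-! ### The variance of the kernel estimator -/

section estimatorVariance
variable {Ω : Type*} [MeasurableSpace Ω] {P : Measure Ω} {d : ℕ} {X : Ω → Set (Fin d → ℝ)}
  (hX : IsSimplePointProcess X)

theorem measurable_sum_pointsIn {D : Set (Fin d → ℝ)} (hD : Bornology.IsBounded D)
    (hDm : MeasurableSet D) {f : (Fin d → ℝ) → ℂ} (hf : Measurable f) :
    Measurable fun w => ∑ x ∈ pointsIn hX hD w, f x := by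
  let κ : ProbabilityTheory.Kernel Ω (Fin 1 → Fin d → ℝ) :=
    ⟨factorialMeasure hX hD 1, measurable_factorialMeasure hX hD hDm 1⟩
  have h1 : Measurable fun x : Fin 1 → Fin d → ℝ =>
      ∏ i, (![f] : Fin 1 → (Fin d → ℝ) → ℂ) i (x i) := by
    simp only [Finset.univ_unique, Finset.prod_singleton]
    exact hf.comp (measurable_pi_apply _)
  have h2 := (h1.stronglyMeasurable.integral_kernel (κ := κ)).measurable
  convert h2 using 2 with w
  rw [← factorialSum_one]
  exact (integral_factorialMeasure hX hD 1 w ![f]).symm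

variable {h : (Fin d → ℝ) → ℝ} {A : Fin d → ℝ}

theorem periodogram_eq_norm_sum_sq (w : Ω) (θ : Fin d → ℝ) :
    periodogram h A (X w) θ =
      ‖∑ x ∈ pointsIn hX (isBounded_window (A := A)) w, centeredTaper h A θ x‖ ^ 2 := by
  rw [periodogram, centeredDft_eq_sum (hX.finite_inter w _ isBounded_window)]
  rfl

include hX in
theorem continuous_periodogram (hh : IsTaper h) (w : Ω) : Continuous (periodogram h A (X w)) := by
  rw [funext (periodogram_eq_norm_sum_sq hX w)]
  exact (continuous_finsetSum _ fun x _ => continuous_centeredTaper hh x).norm.pow 2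

include hX in
theorem measurable_periodogram_left (hh : IsTaper h) (θ : Fin d → ℝ) :
    Measurable fun w => periodogram h A (X w) θ := by
  rw [funext fun w => periodogram_eq_norm_sum_sq hX w θ]
  exact (measurable_sum_pointsIn hX _ measurableSet_window
      (measurable_centeredTaper hh θ)).norm.pow_const 2

include hX in
theorem measurable_periodogram (hh : IsTaper h) :
    Measurable (Function.uncurry fun (w : Ω) => periodogram h A (X w)) := by
  have h1 := measurable_uncurry_of_continuous_of_measurable (α := Ω) (β := ℝ) (ι := Fin d → ℝ)
    (u := fun θ w => periodogram h A (X w) θ)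
    (fun w => continuous_periodogram hX hh w) (fun θ => measurable_periodogram_left hX hh θ)
  have h2 : Measurable (Prod.swap : Ω × (Fin d → ℝ) → _) := measurable_swap
  have e : (Function.uncurry fun (w : Ω) => periodogram h A (X w)) =
      (Function.uncurry fun θ w => periodogram h A (X w) θ) ∘ Prod.swap := by
    ext p; simp only [Function.uncurry, Function.comp, Prod.fst_swap, Prod.snd_swap]
  rw [e]
  exact h1.comp h2

variable [IsProbabilityMeasure P] {lam : (n : ℕ) → (Fin n → Fin d → ℝ) → ℝ} {G : ℝ}
  (hlam : ∀ n : ℕ, 1 ≤ n → n ≤ 4 → IsIntensityFunction P X n (lam n))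
  (hG : CumulantBound lam G) (hstat : IsStationaryOfOrder 2 lam)

theorem measurable_conj {f : (Fin d → ℝ) → ℂ} (hf : Measurable f) :
    Measurable fun x => (starRingEnd ℂ) (f x) :=
  Complex.continuous_conj.measurable.comp hf

theorem ofReal_norm_sq_sum (S : Finset (Fin d → ℝ)) (f : (Fin d → ℝ) → ℂ) :
    ((‖∑ x ∈ S, f x‖ ^ 2 : ℝ) : ℂ) = (∑ x ∈ S, f x) * ∑ x ∈ S, (starRingEnd ℂ) (f x) := by
  rw [← map_sum, Complex.mul_conj, Complex.normSq_eq_norm_sq]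

include hlam hG hX in
/-- The expected periodogram is the variance form at the centered taper. -/
theorem integral_periodogram (hh : IsTaper h) (hA : ∀ i, 0 < A i) (θ : Fin d → ℝ) :
    Integrable (fun w => periodogram h A (X w) θ) P ∧
    ((∫ w, periodogram h A (X w) θ ∂P : ℝ) : ℂ) = covForm lam (window A) (centeredTaper h A θ)
      fun x => (starRingEnd ℂ) (centeredTaper h A θ x) := by
  obtain ⟨M, hM0, hM⟩ := exists_le_of_continuousOn_unitCube hh.continuousOn hh.support
  have hg := norm_centeredTaper_le hh hA hM θ
  have hm := measurable_centeredTaper (A := A) hh θ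
  obtain ⟨h1, h2⟩ := integral_sum_mul_sum hX isBounded_window measurableSet_window hG hlam hm
    (measurable_conj hm) hg (by simpa using hg) (setIntegral_centeredTaper hh hA θ)
  simp only [← ofReal_norm_sq_sum, ← periodogram_eq_norm_sum_sq] at h1 h2
  refine ⟨?_, ?_⟩
  · have := h1.re
    simpa using this
  · rw [← h2, ← integral_complex_ofReal]

theorem setIntegral_conj_centeredTaper (hh : IsTaper h) (hA : ∀ i, 0 < A i) (θ : Fin d → ℝ) :
    ∫ x in window A, (starRingEnd ℂ) (centeredTaper h A θ x) = 0 := by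
  rw [integral_conj, setIntegral_centeredTaper hh hA, map_zero]

include hlam hG hX in
/-- Covariances of the periodogram at two frequencies. -/
theorem cov_periodogram_le (hh : IsTaper h) (hA : ∀ i, 0 < A i) {M : ℝ} (hM : ∀ x, |h x| ≤ M)
    (θ η : Fin d → ℝ) :
    Integrable (fun w => periodogram h A (X w) θ * periodogram h A (X w) η) P ∧
    ∫ w, periodogram h A (X w) θ * periodogram h A (X w) η ∂P -
        (∫ w, periodogram h A (X w) θ ∂P) * ∫ w, periodogram h A (X w) η ∂P ≤
      ‖covForm lam (window A) (centeredTaper h A θ) (centeredTaper h A η)‖ ^ 2 +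
      ‖covForm lam (window A) (fun x => (starRingEnd ℂ) (centeredTaper h A θ x))
        (centeredTaper h A η)‖ ^ 2 +
      15 * ((2 * dftNorm h A * M) ^ 4 * (G * windowVol A)) := by
  have hg := fun θ => norm_centeredTaper_le hh hA hM θ
  have hg' : ∀ θ x, ‖(starRingEnd ℂ) (centeredTaper h A θ x)‖ ≤ 2 * dftNorm h A * M :=
    fun θ x => by rw [RCLike.norm_conj]; exact hg θ x
  have hm := fun θ => measurable_centeredTaper (A := A) hh θ
  obtain ⟨h1, h2⟩ := norm_integral_sum_mul_sum_mul_sum_mul_sum_sub_le hX isBounded_window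
    measurableSet_window hG hlam (hm θ) (measurable_conj (hm θ)) (hm η) (measurable_conj (hm η))
    (hg θ) (hg' θ) (hg η) (hg' η) (setIntegral_centeredTaper hh hA θ)
    (setIntegral_conj_centeredTaper hh hA θ) (setIntegral_centeredTaper hh hA η)
    (setIntegral_conj_centeredTaper hh hA η)
  have e : ∀ w, (∑ x ∈ pointsIn hX (isBounded_window (A := A)) w, centeredTaper h A θ x) *
      ((∑ x ∈ pointsIn hX (isBounded_window (A := A)) w, (starRingEnd ℂ) (centeredTaper h A θ x)) *
      ((∑ x ∈ pointsIn hX (isBounded_window (A := A)) w, centeredTaper h A η x) *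
        ∑ x ∈ pointsIn hX (isBounded_window (A := A)) w, (starRingEnd ℂ) (centeredTaper h A η x))) =
      ((periodogram h A (X w) θ * periodogram h A (X w) η : ℝ) : ℂ) := by
    intro w
    rw [← mul_assoc, ← ofReal_norm_sq_sum, ← ofReal_norm_sq_sum, periodogram_eq_norm_sum_sq hX,
      periodogram_eq_norm_sum_sq hX]
    push_cast; ring
  simp only [e] at h1 h2
  refine ⟨by simpa using h1.re, ?_⟩
  have c1 := (integral_periodogram hX hlam hG hh hA θ).2
  have c2 := (integral_periodogram hX hlam hG hh hA η).2
  rw [integral_complex_ofReal, ← c1, ← c2] at h2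
  have n1 : ‖covForm lam (window A) (fun x => (starRingEnd ℂ) (centeredTaper h A θ x))
      fun x => (starRingEnd ℂ) (centeredTaper h A η x)‖ =
      ‖covForm lam (window A) (centeredTaper h A θ) (centeredTaper h A η)‖ := by
    rw [← conj_covForm, RCLike.norm_conj]
  have n2 : ‖covForm lam (window A) (centeredTaper h A θ)
      fun x => (starRingEnd ℂ) (centeredTaper h A η x)‖ =
      ‖covForm lam (window A) (fun x => (starRingEnd ℂ) (centeredTaper h A θ x))
        (centeredTaper h A η)‖ := by
    rw [← RCLike.norm_conj, conj_covForm]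
    simp only [Complex.conj_conj]
  set a := covForm lam (window A) (centeredTaper h A θ) (centeredTaper h A η)
  set a' := covForm lam (window A) (fun x => (starRingEnd ℂ) (centeredTaper h A θ x))
      fun x => (starRingEnd ℂ) (centeredTaper h A η x)
  set c := covForm lam (window A) (centeredTaper h A θ)
      fun x => (starRingEnd ℂ) (centeredTaper h A η x)
  set c' := covForm lam (window A) (fun x => (starRingEnd ℂ) (centeredTaper h A θ x))
        (centeredTaper h A η)
  set u := ∫ w, periodogram h A (X w) θ * periodogram h A (X w) η ∂P
  set v := ∫ w, periodogram h A (X w) θ ∂P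
  set v' := ∫ w, periodogram h A (X w) η ∂P
  have key : ((u - v * v' : ℝ) : ℂ) =
      ((u : ℂ) - (v * v' + a * a' + c * c')) + (a * a' + c * c') := by
    push_cast; ring
  have h3 : ‖((u - v * v' : ℝ) : ℂ)‖ ≤ 15 * ((2 * dftNorm h A * M) ^ 4 * (G * windowVol A)) +
      (‖a‖ ^ 2 + ‖c'‖ ^ 2) := by
    rw [key]
    refine norm_add_le_of_le h2 (norm_add_le_of_le ?_ ?_)
    · rw [norm_mul, n1, sq]
    · rw [norm_mul, n2, sq]
  rw [Complex.norm_real] at h3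
  linarith [Real.le_norm_self (u - v * v')]

variable {W : (Fin d → ℝ) → ℝ}

include hlam hG hX hstat in
/-- The variance of the kernel estimator is of the order `|D|⁻¹ b^{-d} + |D|⁻¹`. -/
theorem exists_integral_sq_kernelEstimator_sub_le (hW : IsSmoothingKernel W) (hh : IsTaper h) :
    ∃ C, ∀ b : ℝ, 0 < b → ∀ (ω A : Fin d → ℝ), (∀ i, 0 < A i) →
    Integrable (fun w => (kernelEstimator W h A b (X w) ω -
      ∫ θ, ∫ w, periodogram h A (X w) θ ∂P ∂(kernelMeasure W b ω)) ^ 2) P ∧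
    ∫ w, (kernelEstimator W h A b (X w) ω -
      ∫ θ, ∫ w, periodogram h A (X w) θ ∂P ∂(kernelMeasure W b ω)) ^ 2 ∂P ≤
      C * ((windowVol A)⁻¹ * (b ^ d)⁻¹ + (windowVol A)⁻¹) := by
  obtain ⟨M, hM0, hM⟩ := exists_le_of_continuousOn_unitCube hh.continuousOn hh.support
  obtain ⟨C, hC0, hC⟩ := exists_integral_covForm_sq_le hW hh hG hstat hM
  have hG0 : 0 ≤ G := hG.nonneg.trans hG.le
  have m2 := hh.moment_pos 2 (by norm_num)
  set k := ((2 * Real.pi) ^ d)⁻¹ * (taperMoment h 2)⁻¹ with hk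
  have hk0 : 0 ≤ k := by positivity
  refine ⟨2 * C + 240 * M ^ 4 * G * k ^ 2, fun b hb ω A hA => ?_⟩
  have := isProbabilityMeasure_kernelMeasure hW hb ω
  have hV := windowVol_pos hA
  have hκ := dftNorm_sq hh hA
  have hm := fun θ => measurable_centeredTaper (A := A) hh θ
  have hg := fun θ => norm_centeredTaper_le hh hA hM θ
  have hg' : ∀ θ x, ‖(starRingEnd ℂ) (centeredTaper h A θ x)‖ ≤ 2 * dftNorm h A * M :=
    fun θ x => by rw [RCLike.norm_conj]; exact hg θ x
  have hz := fun θ x (hx : x ∉ window A) => centeredTaper_eq_zero hh hA θ hx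
  have hz' : ∀ θ x, x ∉ window A → (starRingEnd ℂ) (centeredTaper h A θ x) = 0 :=
    fun θ x hx => by rw [hz θ x hx, map_zero]
  set N := 2 * dftNorm h A * M with hN
  set B := 2 * G * N ^ 2 * windowVol A with hB
  have bound : ∀ f g : (Fin d → ℝ) → ℂ, Measurable f → Measurable g → (∀ x, ‖f x‖ ≤ N) →
      (∀ x, ‖g x‖ ≤ N) → ‖covForm lam (window A) f g‖ ≤ B := fun f g hf hg hfN hgN =>
    norm_covForm_le hG volume_window_ne_top hf hg hfN hgN
  have hcontsq : ∀ f : (Fin d → ℝ) → ℂ, Measurable f → (∀ x, ‖f x‖ ≤ N) →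
      (∀ x, x ∉ window A → f x = 0) → Integrable (fun η =>
        ‖covForm lam (window A) f (centeredTaper h A η)‖ ^ 2) (kernelMeasure W b ω) := by
    intro f hf hfN hf0
    refine Integrable.of_bound (((continuous_covForm_centeredTaper hh hA hG hstat hf hfN
      hf0).norm.pow 2).aestronglyMeasurable) (B ^ 2) (ae_of_all _ fun η => ?_)
    rw [norm_pow, norm_norm]
    exact pow_le_pow_left₀ (norm_nonneg _) (bound _ _ hf (hm η) hfN (hg η)) 2
  have hE := fun θ => integral_periodogram hX hlam hG hh hA θ
  have hE1 : ∀ θ, ∫ w, periodogram h A (X w) θ ∂P ≤ B := fun θ => by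
    refine (Real.le_norm_self _).trans ?_
    rw [← Complex.norm_real, (hE θ).2]
    exact bound _ _ (hm θ) (measurable_conj (hm θ)) (hg θ) (hg' θ)
  have hE0 : ∀ θ, 0 ≤ ∫ w, periodogram h A (X w) θ ∂P := fun θ =>
    integral_nonneg fun w => sq_nonneg _
  have hcov := fun θ η => cov_periodogram_le hX hlam hG hh hA hM θ η
  have hB0 : 0 ≤ B := (hE0 0).trans (hE1 0)
  have hker : ∀ w, kernelEstimator W h A b (X w) ω =
      ∫ θ, periodogram h A (X w) θ ∂(kernelMeasure W b ω) := fun w => by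
    rw [integral_kernelMeasure hW hb]; rfl
  simp only [hker]
  have i1 := fun θ => hcontsq _ (hm θ) (hg θ) (hz θ)
  have i2 := fun θ => hcontsq _ (measurable_conj (hm θ)) (hg' θ) (hz' θ)
  refine (integral_sq_average_sub_le (measurable_periodogram hX hh) (fun w θ => sq_nonneg _)
    (fun θ => (hE θ).1) hE1 (fun θ η => (hcov θ η).1)
    (C₂ := B ^ 2 + B ^ 2 + 15 * (N ^ 4 * (G * windowVol A)) + B * B) (fun θ η => ?_)
    (fun θ η => ‖covForm lam (window A) (centeredTaper h A θ) (centeredTaper h A η)‖ ^ 2 +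
      ‖covForm lam (window A) (fun x => (starRingEnd ℂ) (centeredTaper h A θ x))
        (centeredTaper h A η)‖ ^ 2 + 15 * (N ^ 4 * (G * windowVol A)))
    (fun θ => ((i1 θ).add (i2 θ)).add (integrable_const _)) (fun θ η => (hcov θ η).2)
    (K := 2 * C * ((windowVol A)⁻¹ * (b ^ d)⁻¹) + 240 * M ^ 4 * G * k ^ 2 * (windowVol A)⁻¹)
    fun θ => ?_).imp_right fun hle => hle.trans ?_
  · have a1 := (hcov θ η).2
    have a2 := mul_le_mul (hE1 θ) (hE1 η) (hE0 η) hB0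
    have a3 := pow_le_pow_left₀ (norm_nonneg _) (bound _ _ (hm θ) (hm η) (hg θ) (hg η)) 2
    have a4 := pow_le_pow_left₀ (norm_nonneg _)
      (bound _ _ (measurable_conj (hm θ)) (hm η) (hg' θ) (hg η)) 2
    linarith
  · have j1 : Integrable (fun η => ‖covForm lam (window A) (centeredTaper h A θ)
        (centeredTaper h A η)‖ ^ 2 + ‖covForm lam (window A)
        (fun x => (starRingEnd ℂ) (centeredTaper h A θ x)) (centeredTaper h A η)‖ ^ 2)
        (kernelMeasure W b ω) := (i1 θ).add (i2 θ)
    rw [integral_add j1 (integrable_const _), integral_add (i1 θ) (i2 θ), integral_const]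
    have a1 := hC b hb ω A hA _ (hm θ) (hg θ) (hz θ)
    have a2 := hC b hb ω A hA _ (measurable_conj (hm θ)) (hg' θ) (hz' θ)
    have a3 : 15 * (N ^ 4 * (G * windowVol A)) = 240 * M ^ 4 * G * k ^ 2 * (windowVol A)⁻¹ := by
      have : N ^ 4 = 16 * (k * (windowVol A)⁻¹) ^ 2 * M ^ 4 := by
        rw [hN, hk, ← hκ]; ring
      rw [this]; field_simp; ring
    rw [a3, probReal_univ, one_smul]
    linarith
  · have b1 : 0 ≤ (windowVol A)⁻¹ * (b ^ d)⁻¹ := by positivity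
    have b2 : 0 ≤ (windowVol A)⁻¹ := by positivity
    have b3 : 0 ≤ 240 * M ^ 4 * G * k ^ 2 := by positivity
    nlinarith [mul_nonneg b3 b1, mul_nonneg hC0 b2]

end estimatorVariance
/-! ### The limit of the mean -/

section growing
variable {d : ℕ}

/-- As the volumes tend to infinity and the sides are comparable, every side tends to infinity. -/
theorem IsGrowingWindow.tendsto_atTop {A : ℕ → Fin d → ℝ} (hA : IsGrowingWindow A) (i : Fin d) :
    Tendsto (fun n => A n i) atTop atTop := by
  refine (tendsto_atTop_of_monotone (hA.mono i)).resolve_right ?_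
  rintro ⟨l, hl⟩
  have h1 : ∀ j, (fun n => A n j) =O[atTop] fun _ => (1 : ℝ) := fun j => by
    have h2 := (hA.comparable j i).mul (hl.isBigO_one ℝ)
    simp only [div_mul_cancel₀ _ (hA.pos _ i).ne', mul_one] at h2
    exact h2
  have h3 := Asymptotics.IsBigO.finsetProd (s := Finset.univ) fun j _ => h1 j
  simp only [← fun n => windowVol_eq_prod (hA.pos n), Finset.prod_const_one] at h3
  refine not_isBoundedUnder_of_tendsto_atTop hA.vol_tendsto (h3.isBoundedUnder_le.mono_le ?_)
  exact Eventually.of_forall fun n => Real.le_norm_self _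

end growing

section meanLimit
variable {d : ℕ} {lam : (n : ℕ) → (Fin n → Fin d → ℝ) → ℝ} {G : ℝ} {h : (Fin d → ℝ) → ℝ}

theorem IsTaper.integrable (hh : IsTaper h) : Integrable h := by
  obtain ⟨M, -, hM⟩ := exists_le_of_continuousOn_unitCube hh.continuousOn hh.support
  have h1 : IntegrableOn h (unitCube d) := by
    have : IsFiniteMeasure (volume.restrict (unitCube d)) :=
      isFiniteMeasure_restrict.2 (Metric.isBounded_Icc _ _).measure_lt_top.ne
    exact Integrable.of_bound hh.measurable.aestronglyMeasurable M (ae_of_all _ hM)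
  exact h1.integrable_of_forall_notMem_eq_zero hh.support

/-- The autocorrelation `∫ h(s + u/A) h(s) ds / H_{h,2}` of the taper. -/
noncomputable def taperCorr (h : (Fin d → ℝ) → ℝ) (A u : Fin d → ℝ) : ℝ :=
  (taperMoment h 2)⁻¹ * ∫ s, h (s + u / A) * h s

theorem measurable_taperCorr (hh : IsTaper h) (A : Fin d → ℝ) : Measurable (taperCorr h A) := by
  have h1 : Measurable fun z : (Fin d → ℝ) × (Fin d → ℝ) => h (z.2 + z.1 / A) * h z.2 := by
    refine (hh.measurable.comp (measurable_snd.add ?_)).mul (hh.measurable.comp measurable_snd)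
    exact measurable_pi_lambda _ fun i => ((measurable_pi_apply i).comp measurable_fst).div_const _
  exact h1.stronglyMeasurable.integral_prod_right'.measurable.const_mul _

theorem abs_taperCorr_le (hh : IsTaper h) {M : ℝ} (hM : ∀ x, |h x| ≤ M) (A u : Fin d → ℝ) :
    |taperCorr h A u| ≤ (taperMoment h 2)⁻¹ * (M * ∫ s, |h s|) := by
  have h2 := hh.moment_pos 2 (by norm_num)
  rw [taperCorr, abs_mul, abs_of_pos (inv_pos.2 h2)]
  refine mul_le_mul_of_nonneg_left ?_ (inv_pos.2 h2).le
  rw [← integral_const_mul, ← Real.norm_eq_abs]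
  refine norm_integral_le_of_norm_le (f := fun s => h (s + u / A) * h s)
    (hh.integrable.abs.const_mul M) (ae_of_all _ fun s => ?_)
  rw [norm_mul]
  exact mul_le_mul_of_nonneg_right (hM _) (norm_nonneg _)

/-- The taper is continuous off the boundary of the cube, a null set, so that its autocorrelation
at the vanishing lag `u/A` tends to one. -/
theorem tendsto_taperCorr (hh : IsTaper h) {A : ℕ → Fin d → ℝ} (hA : IsGrowingWindow A)
    (u : Fin d → ℝ) : Tendsto (fun n => taperCorr h (A n) u) atTop (𝓝 1) := by
  obtain ⟨M, -, hM⟩ := exists_le_of_continuousOn_unitCube hh.continuousOn hh.support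
  have h2 := hh.moment_pos 2 (by norm_num)
  have hu : Tendsto (fun n => u / A n) atTop (𝓝 0) := by
    rw [tendsto_pi_nhds]
    exact fun i => tendsto_const_nhds.div_atTop (hA.tendsto_atTop i)
  have hmom : taperMoment h 2 = ∫ s, h s * h s := by
    rw [taperMoment, setIntegral_eq_integral_of_forall_compl_eq_zero fun x hx => by
      rw [hh.support x hx, zero_pow two_ne_zero]]
    simp only [sq]
  have key : Tendsto (fun n => ∫ s, h (s + u / A n) * h s) atTop (𝓝 (∫ s, h s * h s)) := by
    refine tendsto_integral_of_dominated_convergence (fun s => M * |h s|) (fun n => ?_)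
      (hh.integrable.abs.const_mul M) (fun n => ae_of_all _ fun s => ?_) ?_
    · exact ((hh.measurable.comp (measurable_id.add_const _)).mul
        hh.measurable).aestronglyMeasurable
    · rw [norm_mul]
      exact mul_le_mul_of_nonneg_right (hM _) (norm_nonneg _)
    · have hfr : ∀ᵐ s, s ∉ frontier (unitCube d) :=
        measure_eq_zero_iff_ae_notMem.1 ((convex_Icc _ _).addHaar_frontier volume)
      filter_upwards [hfr] with s hs
      by_cases hc : s ∈ unitCube d
      · have hnhds : unitCube d ∈ 𝓝 s := by
          rw [mem_interior_iff_mem_nhds.symm]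
          by_contra hi
          exact hs ⟨subset_closure hc, hi⟩
        have h3 : Tendsto (fun n => s + u / A n) atTop (𝓝 s) := by
          simpa using tendsto_const_nhds.add hu
        exact (((hh.continuousOn.continuousAt hnhds).tendsto.comp h3).mul_const _)
      · simp [hh.support s hc]
  have := key.const_mul (taperMoment h 2)⁻¹
  rwa [← hmom, inv_mul_cancel₀ h2.ne'] at this

variable (lam h) in
/-- The spectral density with the cumulant intensity weighted by the autocorrelation of the taper:
the variance of the tapered transform. -/
noncomputable def taperedSpectrum (A θ : Fin d → ℝ) : ℂ :=
  ((((2 * Real.pi) ^ d)⁻¹ : ℝ) : ℂ) * (firstIntensity lam +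
    ∫ u, (cumulant2Red lam u : ℂ) * expNeg u θ * taperCorr h A u)

theorem aestronglyMeasurable_taperedSpectrum_integrand (hh : IsTaper h) (hG : CumulantBound lam G)
    (A θ : Fin d → ℝ) : AEStronglyMeasurable
      (fun u => (cumulant2Red lam u : ℂ) * expNeg u θ * taperCorr h A u) :=
  (((Complex.measurable_ofReal.comp (measurable_cumulant2Red hG)).mul
    (measurable_expNeg_left θ)).mul (Complex.measurable_ofReal.comp
      (measurable_taperCorr hh A))).aestronglyMeasurable

theorem norm_taperedSpectrum_integrand_le (hh : IsTaper h) {M : ℝ} (hM : ∀ x, |h x| ≤ M)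
    (A θ u : Fin d → ℝ) : ‖(cumulant2Red lam u : ℂ) * expNeg u θ * taperCorr h A u‖ ≤
      (taperMoment h 2)⁻¹ * (M * ∫ s, |h s|) * |cumulant2Red lam u| := by
  rw [norm_mul, norm_mul, norm_expNeg, mul_one, Complex.norm_real, Complex.norm_real, mul_comm]
  exact mul_le_mul_of_nonneg_right (abs_taperCorr_le hh hM A u) (abs_nonneg _)

theorem continuous_taperedSpectrum (hh : IsTaper h) (hG : CumulantBound lam G) (A : Fin d → ℝ) :
    Continuous (taperedSpectrum lam h A) := by
  obtain ⟨M, -, hM⟩ := exists_le_of_continuousOn_unitCube hh.continuousOn hh.support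
  refine continuous_const.mul (continuous_const.add ?_)
  refine continuous_of_dominated
    (aestronglyMeasurable_taperedSpectrum_integrand hh hG A)
    (fun θ => ae_of_all _ (norm_taperedSpectrum_integrand_le hh hM A θ))
    ((integrable_cumulant2Red hG).abs.const_mul _) (ae_of_all _ fun u => ?_)
  exact (continuous_const.mul (continuous_expNeg.comp
    (continuous_const.prodMk continuous_id))).mul continuous_const

theorem exists_norm_taperedSpectrum_le (hh : IsTaper h) (hG : CumulantBound lam G) :
    ∃ B, ∀ A θ, ‖taperedSpectrum lam h A θ‖ ≤ B := by
  obtain ⟨M, -, hM⟩ := exists_le_of_continuousOn_unitCube hh.continuousOn hh.support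
  refine ⟨((2 * Real.pi) ^ d)⁻¹ * (‖(firstIntensity lam : ℂ)‖ +
    ∫ u, (taperMoment h 2)⁻¹ * (M * ∫ s, |h s|) * |cumulant2Red lam u|), fun A θ => ?_⟩
  rw [taperedSpectrum, norm_mul, Complex.norm_real, Real.norm_of_nonneg (by positivity)]
  refine mul_le_mul_of_nonneg_left (norm_add_le_of_le le_rfl ?_) (by positivity)
  exact norm_integral_le_of_norm_le ((integrable_cumulant2Red hG).abs.const_mul _)
    (ae_of_all _ (norm_taperedSpectrum_integrand_le hh hM A θ))

theorem tendsto_taperedSpectrum (hh : IsTaper h) (hG : CumulantBound lam G)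
    {A : ℕ → Fin d → ℝ} (hA : IsGrowingWindow A) {θ : ℕ → Fin d → ℝ} {ω : Fin d → ℝ}
    (hθ : Tendsto θ atTop (𝓝 ω)) :
    Tendsto (fun n => taperedSpectrum lam h (A n) (θ n)) atTop (𝓝 (spectralDensity lam ω)) := by
  obtain ⟨M, -, hM⟩ := exists_le_of_continuousOn_unitCube hh.continuousOn hh.support
  let F : ℕ → (Fin d → ℝ) → ℂ := fun n u =>
    (cumulant2Red lam u : ℂ) * expNeg u (θ n) * taperCorr h (A n) u
  have hFm : ∀ n, AEStronglyMeasurable (F n) volume := fun n =>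
    aestronglyMeasurable_taperedSpectrum_integrand hh hG (A n) (θ n)
  have hFle : ∀ n u, ‖F n u‖ ≤ (taperMoment h 2)⁻¹ * (M * ∫ s, |h s|) * |cumulant2Red lam u| :=
    fun n u => norm_taperedSpectrum_integrand_le hh hM (A n) (θ n) u
  have hbd : Integrable fun u => (taperMoment h 2)⁻¹ * (M * ∫ s, |h s|) * |cumulant2Red lam u| :=
    (integrable_cumulant2Red hG).abs.const_mul _
  have hlim : ∀ u, Tendsto (fun n => F n u) atTop (𝓝 ((cumulant2Red lam u : ℂ) * expNeg u ω)) := by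
    intro u
    have hc : Continuous fun η : Fin d → ℝ => expNeg u η :=
      continuous_expNeg.comp (continuous_const.prodMk continuous_id)
    have h1 : Tendsto (fun n => expNeg u (θ n)) atTop (𝓝 (expNeg u ω)) :=
      (hc.tendsto ω).comp hθ
    have h2 : Tendsto (fun n => (taperCorr h (A n) u : ℂ)) atTop (𝓝 ((1 : ℝ) : ℂ)) :=
      (Complex.continuous_ofReal.tendsto _).comp (tendsto_taperCorr hh hA u)
    simpa using (h1.const_mul (cumulant2Red lam u : ℂ)).mul h2
  have key : Tendsto (fun n => ∫ u, F n u) atTop (𝓝 (∫ u, (cumulant2Red lam u : ℂ) * expNeg u ω)) :=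
    tendsto_integral_of_dominated_convergence _ hFm hbd (fun n => ae_of_all _ (hFle n))
      (ae_of_all _ hlim)
  have e : spectralDensity lam ω = ((((2 * Real.pi) ^ d)⁻¹ : ℝ) : ℂ) *
      (firstIntensity lam + ∫ u, (cumulant2Red lam u : ℂ) * expNeg u ω) := by
    rw [spectralDensity, invFourier, Complex.ofReal_mul, mul_add]
  rw [e]
  exact (tendsto_const_nhds.add key).const_mul _

variable {W : (Fin d → ℝ) → ℝ}

/-- The kernel average of the tapered spectrum converges to the spectral density. -/
theorem tendsto_integral_taperedSpectrum (hh : IsTaper h) (hG : CumulantBound lam G)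
    (hW : IsSmoothingKernel W) {A : ℕ → Fin d → ℝ} (hA : IsGrowingWindow A) {b : ℕ → ℝ}
    (hb : ∀ n, 0 < b n) (hb0 : Tendsto b atTop (𝓝 0)) (ω : Fin d → ℝ) :
    Tendsto (fun n => ∫ θ, taperedSpectrum lam h (A n) θ ∂(kernelMeasure W (b n) ω)) atTop
      (𝓝 (spectralDensity lam ω)) := by
  obtain ⟨B, hB⟩ := exists_norm_taperedSpectrum_le hh hG
  have hWi : Integrable W := by
    by_contra hc
    have := hW.integral_eq_one
    rw [integral_undef hc] at this
    exact zero_ne_one this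
  have e : ∀ n, ∫ θ, taperedSpectrum lam h (A n) θ ∂(kernelMeasure W (b n) ω) =
      ∫ v, W v • taperedSpectrum lam h (A n) (ω - b n • v) := fun n => by
    rw [integral_kernelMeasure hW (hb n), integral_scaledKernel_smul (hb n)]
  have e' : spectralDensity lam ω = ∫ v, W v • spectralDensity lam ω := by
    rw [integral_smul_const, hW.integral_eq_one, one_smul]
  simp only [e]
  rw [e']
  refine tendsto_integral_of_dominated_convergence (fun v => |W v| * B) (fun n => ?_)
    (hWi.abs.mul_const B) (fun n => ae_of_all _ fun v => ?_) (ae_of_all _ fun v => ?_)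
  · exact hWi.aestronglyMeasurable.smul ((continuous_taperedSpectrum hh hG (A n)).comp
      (by fun_prop : Continuous fun v : Fin d → ℝ => ω - b n • v)).aestronglyMeasurable
  · rw [norm_smul]
    exact mul_le_mul_of_nonneg_left (hB _ _) (norm_nonneg _)
  · refine (tendsto_taperedSpectrum hh hG hA ?_).const_smul (W v)
    simpa using tendsto_const_nhds.sub (hb0.smul_const v)

/-- The tapered character `(2π)^{-d/2} H_{h,2}^{-1/2} |D|^{-1/2} h(x/A) exp(-i xᵀθ)`. -/
noncomputable def taperedChar (h : (Fin d → ℝ) → ℝ) (A θ x : Fin d → ℝ) : ℂ :=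
  (dftNorm h A : ℂ) * (h (x / A) : ℂ) * expNeg x θ

theorem measurable_taperedChar (hh : IsTaper h) (A θ : Fin d → ℝ) :
    Measurable (taperedChar h A θ) :=
  ((Complex.measurable_ofReal.comp (hh.measurable_comp_div A)).const_mul _).mul
    (measurable_expNeg_left θ)

variable {A : Fin d → ℝ}

theorem norm_taperedChar_le (hh : IsTaper h) (hA : ∀ i, 0 < A i) {M : ℝ} (hM : ∀ x, |h x| ≤ M)
    (θ x : Fin d → ℝ) : ‖taperedChar h A θ x‖ ≤ dftNorm h A * M := by
  rw [taperedChar, norm_mul, norm_mul, norm_expNeg, mul_one, Complex.norm_real, Complex.norm_real,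
    Real.norm_of_nonneg (dftNorm_nonneg hh hA)]
  exact mul_le_mul_of_nonneg_left (hM _) (dftNorm_nonneg hh hA)

/-- Without centering, the variance of the tapered transform is exactly the tapered spectrum: the
volume in `∫ h((t + u)/A) h(t/A) dt = |D| ∫ h(s + u/A) h(s) ds` cancels against `κ²`. -/
theorem covForm_taperedChar (hh : IsTaper h) (hA : ∀ i, 0 < A i) (hG : CumulantBound lam G)
    (hstat : IsStationaryOfOrder 2 lam) (θ : Fin d → ℝ) :
    covForm lam (window A) (taperedChar h A θ) (fun x => (starRingEnd ℂ) (taperedChar h A θ x)) =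
      taperedSpectrum lam h A θ := by
  obtain ⟨M, hM0, hM⟩ := exists_le_of_continuousOn_unitCube hh.continuousOn hh.support
  have hm2 := hh.moment_pos 2 (by norm_num)
  have hV := windowVol_pos hA
  have hfin : IsFiniteMeasure (volume.restrict (window A)) :=
    isFiniteMeasure_restrict.2 volume_window_ne_top
  set κ := dftNorm h A with hκdef
  have hκ : κ ^ 2 * windowVol A = ((2 * Real.pi) ^ d)⁻¹ * (taperMoment h 2)⁻¹ := by
    rw [hκdef, dftNorm_sq hh hA, mul_assoc, inv_mul_cancel₀ hV.ne', mul_one]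
  have hp := norm_taperedChar_le hh hA hM θ
  have hpm := measurable_taperedChar hh A θ
  have hunit : ∀ t : Fin d → ℝ, expNeg t θ * (starRingEnd ℂ) (expNeg t θ) = 1 := fun t => by
    rw [Complex.mul_conj, Complex.normSq_eq_norm_sq, norm_expNeg]; simp
  let F : (Fin d → ℝ) → (Fin d → ℝ) → ℂ := fun t u =>
    ((κ ^ 2 : ℝ) : ℂ) * (((h ((t + u) / A) * h (t / A) : ℝ) : ℂ) *
      ((cumulant2Red lam u : ℂ) * expNeg u θ))
  have hpt : ∀ t, covOp lam (taperedChar h A θ) t * (starRingEnd ℂ) (taperedChar h A θ t) =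
      ((firstIntensity lam * κ ^ 2 * h (t / A) ^ 2 : ℝ) : ℂ) + ∫ u, F t u := by
    intro t
    rw [covOp, add_mul, ← integral_mul_const]
    congr 1
    · simp only [taperedChar, map_mul, Complex.conj_ofReal]
      push_cast
      linear_combination (firstIntensity lam : ℂ) * (κ : ℂ) ^ 2 * (h (t / A) : ℂ) ^ 2 * hunit t
    · refine integral_congr_ae (ae_of_all _ fun u => ?_)
      simp only [taperedChar, map_mul, Complex.conj_ofReal, expNeg_add_left, F]
      push_cast
      linear_combination (h ((t + u) / A) : ℂ) * (κ : ℂ) ^ 2 * (h (t / A) : ℂ) * expNeg u θ *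
        (cumulant2Red lam u : ℂ) * hunit t
  have hadd : ∀ t u : Fin d → ℝ, (t + u) / A = t / A + u / A := fun t u => by
    ext i; simp [add_div]
  have hFm : Measurable (Function.uncurry F) := by
    have m1 : Measurable fun z : (Fin d → ℝ) × (Fin d → ℝ) =>
        ((h ((z.1 + z.2) / A) * h (z.1 / A) : ℝ) : ℂ) :=
      Complex.measurable_ofReal.comp (((hh.measurable_comp_div A).comp
        (measurable_fst.add measurable_snd)).mul ((hh.measurable_comp_div A).comp measurable_fst))
    have m2 : Measurable fun u => (cumulant2Red lam u : ℂ) * expNeg u θ :=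
      (Complex.measurable_ofReal.comp (measurable_cumulant2Red hG)).mul (measurable_expNeg_left θ)
    exact (m1.mul (m2.comp measurable_snd)).const_mul _
  have hFi : Integrable (Function.uncurry F) ((volume.restrict (window A)).prod volume) := by
    refine Integrable.mono' ((integrable_const (κ ^ 2 * (M * M))).mul_prod
      (integrable_cumulant2Red hG).abs) hFm.aestronglyMeasurable (ae_of_all _ fun z => ?_)
    simp only [Function.uncurry, F]
    rw [norm_mul, norm_mul, norm_mul, norm_expNeg, mul_one, Complex.norm_real, Complex.norm_real,
      Complex.norm_real, Real.norm_of_nonneg (sq_nonneg κ), ← mul_assoc, norm_mul, Real.norm_eq_abs,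
      Real.norm_eq_abs, Real.norm_eq_abs]
    exact mul_le_mul_of_nonneg_right (mul_le_mul_of_nonneg_left
      (mul_le_mul (hM _) (hM _) (abs_nonneg _) hM0) (sq_nonneg κ)) (abs_nonneg _)
  have hinner : ∀ u, ∫ t in window A, F t u = ((((2 * Real.pi) ^ d)⁻¹ : ℝ) : ℂ) *
      ((cumulant2Red lam u : ℂ) * expNeg u θ * taperCorr h A u) := by
    intro u
    rw [integral_const_mul, integral_mul_const, integral_complex_ofReal,
      setIntegral_eq_integral_of_forall_compl_eq_zero fun t ht => by
        rw [hh.comp_div_eq_zero hA ht, mul_zero]]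
    simp only [hadd]
    rw [integral_comp_div hA fun s => h (s + u / A) * h s, smul_eq_mul, taperCorr]
    have hκ' : ((κ ^ 2 * windowVol A : ℝ) : ℂ) =
      ((((2 * Real.pi) ^ d)⁻¹ * (taperMoment h 2)⁻¹ : ℝ) : ℂ) := congrArg _ hκ
    push_cast at hκ' ⊢
    linear_combination (∫ s, h (s + u / A) * h s : ℝ) *
      ((cumulant2Red lam u : ℂ) * expNeg u θ) * hκ'
  have hsq : ∫ t in window A, firstIntensity lam * κ ^ 2 * h (t / A) ^ 2 =
      ((2 * Real.pi) ^ d)⁻¹ * firstIntensity lam := by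
    rw [integral_const_mul, setIntegral_eq_integral_of_forall_compl_eq_zero fun t ht => by
        rw [hh.comp_div_eq_zero hA ht, zero_pow two_ne_zero],
      integral_comp_div hA fun s => h s ^ 2, smul_eq_mul,
      ← setIntegral_eq_integral_of_forall_compl_eq_zero (s := unitCube d) fun t ht => by
        rw [hh.support t ht, zero_pow two_ne_zero]]
    change firstIntensity lam * κ ^ 2 * (windowVol A * taperMoment h 2) = _
    calc _ = firstIntensity lam * (κ ^ 2 * windowVol A) * taperMoment h 2 := by ring
      _ = _ := by rw [hκ]; field_simp
  have hi1 : Integrable (fun t => ((firstIntensity lam * κ ^ 2 * h (t / A) ^ 2 : ℝ) : ℂ))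
      (volume.restrict (window A)) := by
    refine Integrable.of_bound (Complex.measurable_ofReal.comp
      (((hh.measurable_comp_div A).pow_const 2).const_mul _)).aestronglyMeasurable
      (|firstIntensity lam * κ ^ 2| * M ^ 2) (ae_of_all _ fun t => ?_)
    rw [Complex.norm_real, norm_mul, norm_pow]
    exact mul_le_mul_of_nonneg_left (pow_le_pow_left₀ (norm_nonneg _) (hM _) 2) (abs_nonneg _)
  rw [covForm_eq_integral_covOp hG hstat volume_window_ne_top hpm (measurable_conj hpm) hp
    (fun x => by rw [RCLike.norm_conj]; exact hp x)
    (fun x hx => by rw [taperedChar, hh.comp_div_eq_zero hA hx]; simp)]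
  have hi2 : Integrable (fun t => ∫ u, F t u) (volume.restrict (window A)) :=
    hFi.integral_prod_left
  simp only [hpt]
  rw [integral_add hi1 hi2, integral_integral_swap hFi]
  simp only [hinner]
  rw [integral_complex_ofReal, hsq, integral_const_mul, taperedSpectrum, mul_add,
    Complex.ofReal_mul]

/-- Centering by the estimated intensity changes the variance of the transform by at most a multiple
of the centering coefficient. -/
theorem norm_covForm_centeredTaper_sub_le (hh : IsTaper h) (hA : ∀ i, 0 < A i)
    (hG : CumulantBound lam G) (hstat : IsStationaryOfOrder 2 lam) {M : ℝ} (hM : ∀ x, |h x| ≤ M)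
    (θ : Fin d → ℝ) :
    ‖covForm lam (window A) (centeredTaper h A θ)
      (fun x => (starRingEnd ℂ) (centeredTaper h A θ x)) - taperedSpectrum lam h A θ‖ ≤
      6 * G * M ^ 2 * (((2 * Real.pi) ^ d)⁻¹ * (taperMoment h 2)⁻¹) * ‖centerCoef h A θ‖ := by
  have hM0 : 0 ≤ M := (abs_nonneg _).trans (hM 0)
  have hκ0 := dftNorm_nonneg hh hA
  have hV := windowVol_pos hA
  have hg := norm_centeredTaper_le hh hA hM θ
  have hp := norm_taperedChar_le hh hA hM θ
  have hp' : ∀ x, ‖taperedChar h A θ x‖ ≤ 2 * dftNorm h A * M := fun x =>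
    (hp x).trans (by nlinarith [mul_nonneg hκ0 hM0])
  have hm := measurable_centeredTaper (A := A) hh θ
  have hpm := measurable_taperedChar hh A θ
  have hsub : ∀ x, ‖centeredTaper h A θ x - taperedChar h A θ x‖ ≤
      dftNorm h A * M * ‖centerCoef h A θ‖ := fun x => by
    have e : centeredTaper h A θ x - taperedChar h A θ x =
        (dftNorm h A : ℂ) * (h (x / A) : ℂ) * -centerCoef h A θ := by
      rw [centeredTaper, taperedChar]; ring
    rw [e, norm_mul, norm_mul, norm_neg, Complex.norm_real, Complex.norm_real,
      Real.norm_of_nonneg hκ0]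
    exact mul_le_mul_of_nonneg_right (mul_le_mul_of_nonneg_left (hM _) hκ0) (norm_nonneg _)
  rw [← covForm_taperedChar hh hA hG hstat θ]
  have key := norm_covForm_sub_le (δ := 3 * dftNorm h A ^ 2 * M ^ 2 * ‖centerCoef h A θ‖) hG
    (volume_window_ne_top (A := A)) hm (measurable_conj hm) hpm (measurable_conj hpm) hg
    (fun x => by rw [RCLike.norm_conj]; exact hg x) hp'
    (fun x => by rw [RCLike.norm_conj]; exact hp' x) (fun x y => ?_)
  · refine key.trans_eq ?_
    rw [dftNorm_sq hh hA]
    change 2 * G * _ * windowVol A = _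
    field_simp
    ring
  · have e : centeredTaper h A θ x * (starRingEnd ℂ) (centeredTaper h A θ y) -
        taperedChar h A θ x * (starRingEnd ℂ) (taperedChar h A θ y) =
        (centeredTaper h A θ x - taperedChar h A θ x) * (starRingEnd ℂ) (centeredTaper h A θ y) +
        taperedChar h A θ x * (starRingEnd ℂ) (centeredTaper h A θ y - taperedChar h A θ y) := by
      rw [map_sub]; ring
    rw [e]
    have n1 := mul_le_mul (hsub x) (hg y) (norm_nonneg _) (by positivity)
    have n2 := mul_le_mul (hp x) (hsub y) (norm_nonneg _) (by positivity)
    refine (norm_add_le _ _).trans ?_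
    rw [norm_mul, norm_mul, RCLike.norm_conj, RCLike.norm_conj]
    linarith

end meanLimit
/-! ### Consistency -/

section consistency
variable {Ω : Type*} [MeasurableSpace Ω] {P : Measure Ω} {d : ℕ} {X : Ω → Set (Fin d → ℝ)}
  {lam : (n : ℕ) → (Fin n → Fin d → ℝ) → ℝ} {G : ℝ} {h W : (Fin d → ℝ) → ℝ}

/-- On kernel average the centering coefficient is of the order `|D|^{-1/2} b^{-d/2}`. -/
theorem exists_integral_norm_centerCoef_le (hW : IsSmoothingKernel W) (hh : IsTaper h) :
    ∃ C, ∀ b : ℝ, 0 < b → ∀ (ω A : Fin d → ℝ), (∀ i, 0 < A i) →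
    ∫ θ, ‖centerCoef h A θ‖ ∂(kernelMeasure W b ω) ≤
      C * Real.sqrt ((windowVol A)⁻¹ * (b ^ d)⁻¹) := by
  obtain ⟨C, hC0, hC⟩ := exists_integral_centerCoef_sq_le (h := h) hW hh
  refine ⟨1 + C, fun b hb ω A hA => ?_⟩
  have := isProbabilityMeasure_kernelMeasure hW hb ω
  have hV := windowVol_pos hA
  set r := (windowVol A)⁻¹ * (b ^ d)⁻¹ with hr
  have hr0 : 0 < r := by positivity
  set s := Real.sqrt r with hs
  have hs0 : 0 < s := Real.sqrt_pos.2 hr0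
  have hss : s ^ 2 = r := Real.sq_sqrt hr0.le
  have hi : Integrable (fun θ => ‖centerCoef h A θ‖ ^ 2) (kernelMeasure W b ω) := by
    refine Integrable.of_bound ((continuous_centerCoef hh).norm.pow 2).aestronglyMeasurable 1
      (ae_of_all _ fun θ => ?_)
    rw [norm_pow, norm_norm]
    exact pow_le_one₀ (norm_nonneg _) (norm_centerCoef_le hh hA θ)
  -- The choice `s = √r` balances the two terms after averaging, as `|c|²` has average `O(r)`.
  have hpt : ∀ θ, ‖centerCoef h A θ‖ ≤ s + s⁻¹ * ‖centerCoef h A θ‖ ^ 2 := fun θ => by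
    have h1 : s * ‖centerCoef h A θ‖ ≤ s ^ 2 + ‖centerCoef h A θ‖ ^ 2 := by
      nlinarith [sq_nonneg (s - ‖centerCoef h A θ‖), sq_nonneg s, sq_nonneg ‖centerCoef h A θ‖]
    have h2 := mul_le_mul_of_nonneg_left h1 (inv_pos.2 hs0).le
    rw [← mul_assoc, inv_mul_cancel₀ hs0.ne', one_mul] at h2
    refine h2.trans_eq ?_
    field_simp
  have hj : Integrable (fun θ => s⁻¹ * ‖centerCoef h A θ‖ ^ 2) (kernelMeasure W b ω) :=
    hi.const_mul _
  have hle : ∫ θ, ‖centerCoef h A θ‖ ∂(kernelMeasure W b ω) ≤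
      ∫ θ, (s + s⁻¹ * ‖centerCoef h A θ‖ ^ 2) ∂(kernelMeasure W b ω) :=
    integral_mono_of_nonneg (ae_of_all _ fun θ => norm_nonneg _)
      ((integrable_const s).add hj) (ae_of_all _ hpt)
  rw [integral_add (integrable_const s) hj, integral_const_mul, integral_const, probReal_univ,
    one_smul] at hle
  have h3 := mul_le_mul_of_nonneg_left (hC b hb ω A hA) (inv_pos.2 hs0).le
  rw [← hr, ← hss] at h3
  have h4 : s⁻¹ * (C * s ^ 2) = C * s := by field_simp
  linarith

variable [IsProbabilityMeasure P]

/-- The mean of the kernel estimator converges to the spectral density. -/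
theorem tendsto_integral_integral_periodogram (hX : IsSimplePointProcess X)
    (hlam : ∀ n : ℕ, 1 ≤ n → n ≤ 4 → IsIntensityFunction P X n (lam n))
    (hG : CumulantBound lam G) (hstat : IsStationaryOfOrder 2 lam) (hh : IsTaper h)
    (hW : IsSmoothingKernel W) {A : ℕ → Fin d → ℝ} (hA : IsGrowingWindow A) {b : ℕ → ℝ}
    (hb : ∀ n, 0 < b n) (hb0 : Tendsto b atTop (𝓝 0))
    (hr : Tendsto (fun n => (windowVol (A n))⁻¹ * (b n ^ d)⁻¹) atTop (𝓝 0)) (ω : Fin d → ℝ) :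
    Tendsto (fun n => ((∫ θ, ∫ w, periodogram h (A n) (X w) θ ∂P ∂(kernelMeasure W (b n) ω) : ℝ) :
      ℂ)) atTop (𝓝 (spectralDensity lam ω)) := by
  obtain ⟨M, hM0, hM⟩ := exists_le_of_continuousOn_unitCube hh.continuousOn hh.support
  obtain ⟨C, hC⟩ := exists_integral_norm_centerCoef_le (h := h) hW hh
  obtain ⟨B, hB⟩ := exists_norm_taperedSpectrum_le (h := h) hh hG
  have hG0 : 0 ≤ G := hG.nonneg.trans hG.le
  have hm2 := hh.moment_pos 2 (by norm_num)
  set K := 6 * G * M ^ 2 * (((2 * Real.pi) ^ d)⁻¹ * (taperMoment h 2)⁻¹) with hK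
  have hK0 : 0 ≤ K := by positivity
  have hlim := tendsto_integral_taperedSpectrum hh hG hW hA hb hb0 ω
  have hsq : Tendsto (fun n => K * (C * Real.sqrt ((windowVol (A n))⁻¹ * (b n ^ d)⁻¹))) atTop
      (𝓝 0) := by
    simpa using ((Real.continuous_sqrt.tendsto 0).comp hr).const_mul C |>.const_mul K
  refine tendsto_of_tendsto_of_dist hlim (squeeze_zero (fun n => dist_nonneg) (fun n => ?_) hsq)
  have := isProbabilityMeasure_kernelMeasure hW (hb n) ω
  have hmean : Measurable fun θ => ((∫ w, periodogram h (A n) (X w) θ ∂P : ℝ) : ℂ) :=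
    Complex.measurable_ofReal.comp ((measurable_periodogram hX hh).comp
      measurable_swap).stronglyMeasurable.integral_prod_right'.measurable
  have hle : ∀ θ, ‖taperedSpectrum lam h (A n) θ -
      ((∫ w, periodogram h (A n) (X w) θ ∂P : ℝ) : ℂ)‖ ≤ K * ‖centerCoef h (A n) θ‖ := fun θ => by
    rw [(integral_periodogram hX hlam hG hh (hA.pos n) θ).2, norm_sub_rev]
    exact norm_covForm_centeredTaper_sub_le hh (hA.pos n) hG hstat hM θ
  have i1 : Integrable (taperedSpectrum lam h (A n)) (kernelMeasure W (b n) ω) :=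
    Integrable.of_bound (continuous_taperedSpectrum hh hG (A n)).aestronglyMeasurable B
      (ae_of_all _ (hB (A n)))
  have i2 : Integrable (fun θ => taperedSpectrum lam h (A n) θ -
      ((∫ w, periodogram h (A n) (X w) θ ∂P : ℝ) : ℂ)) (kernelMeasure W (b n) ω) :=
    Integrable.of_bound ((continuous_taperedSpectrum hh hG (A n)).measurable.sub
      hmean).aestronglyMeasurable K (ae_of_all _ fun θ => (hle θ).trans
        (mul_le_of_le_one_right hK0 (norm_centerCoef_le hh (hA.pos n) θ)))
  have i3 : Integrable (fun θ => ((∫ w, periodogram h (A n) (X w) θ ∂P : ℝ) : ℂ))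
      (kernelMeasure W (b n) ω) := by
    have := i1.sub i2
    refine this.congr (ae_of_all _ fun θ => ?_)
    simp
  have i4 : Integrable (fun θ => K * ‖centerCoef h (A n) θ‖) (kernelMeasure W (b n) ω) := by
    refine Integrable.const_mul ?_ K
    refine Integrable.of_bound (continuous_centerCoef hh).norm.aestronglyMeasurable 1
      (ae_of_all _ fun θ => ?_)
    rw [norm_norm]
    exact norm_centerCoef_le hh (hA.pos n) θ
  rw [dist_eq_norm, ← integral_complex_ofReal, ← integral_sub i1 i3]
  refine (norm_integral_le_of_norm_le i4 (ae_of_all _ hle)).trans ?_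
  rw [integral_const_mul]
  exact mul_le_mul_of_nonneg_left (hC (b n) (hb n) ω (A n) (hA.pos n)) hK0

end consistency
end PointSpectral

theorem theorem3 {Ω : Type*} [MeasurableSpace Ω] (P : Measure Ω) [IsProbabilityMeasure P]
    (d : ℕ) (hd : 1 ≤ d)
    (X : Ω → Set (Fin d → ℝ)) (hX : PointSpectral.IsSimplePointProcess X)
    (lam : (n : ℕ) → (Fin n → Fin d → ℝ) → ℝ)
    (hlam : ∀ n : ℕ, 1 ≤ n → n ≤ 4 → PointSpectral.IsIntensityFunction P X n (lam n))
    (hstat : PointSpectral.IsStationaryOfOrder 2 lam)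
    (hcum : PointSpectral.CumulantsIntegrable 4 lam)
    (A : ℕ → Fin d → ℝ) (hA : PointSpectral.IsGrowingWindow A)
    (h : (Fin d → ℝ) → ℝ) (hh : PointSpectral.IsTaper h)
    (W : (Fin d → ℝ) → ℝ) (hW : PointSpectral.IsSmoothingKernel W)
    (b : ℕ → ℝ) (hbpos : ∀ n, 0 < b n)
    (hb : Tendsto (fun n => b n + (PointSpectral.windowVol (A n))⁻¹ * (b n ^ d)⁻¹) atTop (𝓝 0))
    (ω : Fin d → ℝ) :
    TendstoInMeasure P
      (fun n w => (PointSpectral.kernelEstimator W h (A n) (b n) (X w) ω : ℂ)) atTop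
      (fun _ => PointSpectral.spectralDensity lam ω) := by
  obtain ⟨G, hG⟩ := PointSpectral.exists_cumulantBound hlam hstat hcum
  have hV := fun n => PointSpectral.windowVol_pos (hA.pos n)
  have hr0 : ∀ n, 0 ≤ (PointSpectral.windowVol (A n))⁻¹ * (b n ^ d)⁻¹ := fun n =>
    mul_nonneg (inv_pos.2 (hV n)).le (inv_pos.2 (pow_pos (hbpos n) d)).le
  have hb0 : Tendsto b atTop (𝓝 0) :=
    squeeze_zero (fun n => (hbpos n).le) (fun n => le_add_of_nonneg_right (hr0 n)) hb
  have hr : Tendsto (fun n => (PointSpectral.windowVol (A n))⁻¹ * (b n ^ d)⁻¹) atTop (𝓝 0) :=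
    squeeze_zero hr0 (fun n => le_add_of_nonneg_left (hbpos n).le) hb
  have hv : Tendsto (fun n => (PointSpectral.windowVol (A n))⁻¹) atTop (𝓝 0) :=
    tendsto_inv_atTop_zero.comp hA.vol_tendsto
  obtain ⟨C, hC⟩ := PointSpectral.exists_integral_sq_kernelEstimator_sub_le (h := h) hX hlam hG
    hstat hW hh
  have hmean := PointSpectral.tendsto_integral_integral_periodogram hX hlam hG hstat hh hW hA hbpos
    hb0 hr ω
  set m : ℕ → ℝ := fun n => ∫ θ, ∫ w, PointSpectral.periodogram h (A n) (X w) θ ∂P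
    ∂(PointSpectral.kernelMeasure W (b n) ω) with hm
  set F : ℕ → Ω → ℝ := fun n w => PointSpectral.kernelEstimator W h (A n) (b n) (X w) ω with hF
  have hbound : ∀ n, Integrable (fun w => (F n w - m n) ^ 2) P ∧ ∫ w, (F n w - m n) ^ 2 ∂P ≤
      C * ((PointSpectral.windowVol (A n))⁻¹ * (b n ^ d)⁻¹ + (PointSpectral.windowVol (A n))⁻¹) :=
    fun n => hC (b n) (hbpos n) ω (A n) (hA.pos n)
  have hvar : Tendsto (fun n => C * ((PointSpectral.windowVol (A n))⁻¹ * (b n ^ d)⁻¹ +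
      (PointSpectral.windowVol (A n))⁻¹)) atTop (𝓝 0) := by
    simpa using (hr.add hv).const_mul C
  rw [tendstoInMeasure_iff_norm]
  intro ε hε
  have hev : ∀ᶠ n in atTop, ‖(m n : ℂ) - PointSpectral.spectralDensity lam ω‖ < ε / 2 := by
    have := Metric.tendsto_nhds.1 hmean (ε / 2) (half_pos hε)
    simpa only [dist_eq_norm] using this
  -- Chebyshev's inequality at the level `ε / 2`, the bias taking up at most the other half.
  have hcheb : ∀ᶠ n in atTop, P {w | ε ≤ ‖(F n w : ℂ) - PointSpectral.spectralDensity lam ω‖} ≤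
      ENNReal.ofReal (((ε / 2) ^ 2)⁻¹ * (C * ((PointSpectral.windowVol (A n))⁻¹ * (b n ^ d)⁻¹ +
        (PointSpectral.windowVol (A n))⁻¹))) := by
    filter_upwards [hev] with n hn
    have hsub : {w | ε ≤ ‖(F n w : ℂ) - PointSpectral.spectralDensity lam ω‖} ⊆
        {w | (ε / 2) ^ 2 ≤ (F n w - m n) ^ 2} := by
      intro w hw
      have hw' : ε ≤ ‖(F n w : ℂ) - PointSpectral.spectralDensity lam ω‖ := hw
      have h1 : ‖(F n w : ℂ) - PointSpectral.spectralDensity lam ω‖ ≤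
          ‖((F n w - m n : ℝ) : ℂ)‖ + ‖(m n : ℂ) - PointSpectral.spectralDensity lam ω‖ := by
        have e : (F n w : ℂ) - PointSpectral.spectralDensity lam ω = ((F n w - m n : ℝ) : ℂ) +
          ((m n : ℂ) - PointSpectral.spectralDensity lam ω) := by push_cast; ring
        rw [e]
        exact norm_add_le _ _
      rw [Complex.norm_real, Real.norm_eq_abs] at h1
      have h2 : ε / 2 ≤ |F n w - m n| := by linarith
      change (ε / 2) ^ 2 ≤ (F n w - m n) ^ 2
      rw [← sq_abs (F n w - m n)]
      exact pow_le_pow_left₀ (half_pos hε).le h2 2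
    have h3 := (mul_meas_ge_le_integral_of_nonneg (ae_of_all _ fun w => sq_nonneg (F n w - m n))
      (hbound n).1 ((ε / 2) ^ 2)).trans (hbound n).2
    refine (measure_mono hsub).trans ?_
    rw [← ofReal_measureReal]
    refine ENNReal.ofReal_le_ofReal ?_
    rwa [← div_eq_inv_mul, le_div_iff₀' (by positivity)]
  have hz : Tendsto (fun n => ENNReal.ofReal (((ε / 2) ^ 2)⁻¹ *
      (C * ((PointSpectral.windowVol (A n))⁻¹ * (b n ^ d)⁻¹ +
        (PointSpectral.windowVol (A n))⁻¹)))) atTop (𝓝 0) := by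
    have := ENNReal.tendsto_ofReal (hvar.const_mul ((ε / 2) ^ 2)⁻¹)
    simpa using this
  exact tendsto_of_tendsto_of_tendsto_of_le_of_le' tendsto_const_nhds hz
    (Eventually.of_forall fun n => zero_le) hcheb
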